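/- Let $H$ be a separable real Hilbert space and let $W\subset H$ be a dense subspace which is itself a Hilbert space such that the inclusion $\iota:W\hookrightarrow H$ is a compact operator. Let $\mathcal L_{sa}(W,H)$ be the set of bounded operators $T:W\to H$ which, regarded as unbounded operators in $H$ with domain $W$, are self-adjoint (such operators are automatically Fredholm), with the operator norm topology. Let $a<b$ and let $T:[a,b]\to\mathcal L_{sa}(W,H)$ be a continuously differentiable path. Then the orientation transport $\varepsilon(T)$ and the spectral flow $\mathrm{SF}(T)$, as defined below, exist, and $$\varepsilon(T)=(-1)^{\mathrm{SF}(T)},$$ whatever choices are made in the two definitions. *Determinant line bundle.* For a finite dimensional real vector space $V$ let $\det V=\Lambda^{\dim V}V$, and for $0\ne u$ in a line let $u^*$ be the dual element with $u^*[u]=1$. For a Fredholm operator $S:H_1\to H_2$ put $\operatorname{coker}S=(\operatorname{im}S)^\perp$ and $\det S=\det(\ker S)\otimes(\det\operatorname{coker}S)^*$. If $V$ is a finite dimensional Hilbert space and $K:V\to H_2$ is linear such that $S_K:H_1\oplus V\to H_2$, $(e,v)\mapsto Se+Kv$, is surjective, there is a unique linear isomorphism $\Phi_K:\det S\to\det(\ker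 S_K)\otimes(\det V)^*$ with $$\Phi_K\big(\xi\otimes F(\omega)^*\big)=(-1)^{\frac{(n_0+n_1)(n_0+n_1+1)}2}(\xi\wedge\eta)\otimes(P_V(\eta)\wedge\omega)^*,$$ where $F=\operatorname{Proj}_{\operatorname{coker}S}\circ K$, $P_V:\ker S_K\to V$ is the projection, $n_0=\dim\operatorname{coker}S$, $n_1=\dim V$, and $\xi=\xi_1\wedge\dots\wedge\xi_p$, $\eta=\eta_1\wedge\dots\wedge\eta_q$, $\omega=\omega_1\wedge\dots\wedge\omega_{n_0}$ are any wedge products for which $(\xi_i)$ is a basis of $\ker S$, $\eta_j\in\ker S_K$, $\omega_k\in V$, and $(P_V\eta_1,\dots,P_V\eta_q,\omega_1,\dots,\omega_{n_0})$ is a basis of $V$. The lines $\det T_t$, $t\in[a,b]$, form a line bundle $\det T\to[a,b]$ whose topology is the one for which, for every relatively open $U\subset[a,b]$ and every continuous $K:U\to\mathcal L(V,H)$ with all $(T_t)_{K_t}$, $t\in U$, surjective, the maps $\Phi_{K_t}$ are a bundle isomorphism over $U$ onto $\det(\ker T_K)\otimes(\det V)^*$, where $\ker T_K$ is a subbundle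 of the trivial bundle with fibre $W\oplus V$. *Orientation transport.* For $S\in\mathcal L_{sa}(W,H)$ one has $\operatorname{coker}S=\ker S$, and one defines $\Psi_S:\det S\to\mathbb R$ by $\Psi_S(\xi\otimes\omega^*)=(-1)^{n_0(n_0+1)/2}\,\omega^*[\xi]$ with $n_0=\dim\ker S$. A trivialization of $\det T\to[a,b]$ induces an isomorphism $\Psi_{T_aT_b}:\det T_a\to\det T_b$, and $\varepsilon(T):=\operatorname{sgn}\big(\Psi_{T_b}\circ\Psi_{T_aT_b}\circ\Psi_{T_a}^{-1}(1)\big)$. *Spectral flow.* The crossing operator of a $C^1$ path $T$ at $t$ is $C_T(t)=\operatorname{Proj}_{\ker T_t}\circ T_t'|_{\ker T_t}:\ker T_t\to\ker T_t$, and $T$ is called transversal if $C_T(t)$ is invertible for all $t\in[a,b]$. Choose $\delta>0$ such that $T_a+\epsilon'$ and $T_b+\epsilon'$ are invertible for all $0<\epsilon'\le\delta$, and $\epsilon\in(0,\delta]$ such that $T+\epsilon$ is transversal. Then $\mathrm{SF}(T):=\sum_{t\in(a,b)}\operatorname{sign}C_{T+\epsilon}(t)$, where $\operatorname{sign}$ is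 the signature, i.e. the number of positive minus the number of negative eigenvalues, counted with multiplicity. -/

import Mathlib

open scoped TensorProduct

noncomputable section

namespace OTSF

open Module

/-! ### Determinant lines of finite dimensional vector spaces -/

section Lines

variable {A B : Type*} [AddCommGroup A] [Module ℝ A] [AddCommGroup B] [Module ℝ B]

variable (A) in
/-- The determinant line: the top exterior power of a finite dimensional real vector space. -/
abbrev DetLine : Type _ := ⋀[ℝ]^(finrank ℝ A) A

open Classical in
/-- The element `v₁ ∧ … ∧ vₙ` of `det A`, for `n = dim A` (set to `0` if `n ≠ dim A`). -/
def wedge {n : ℕ} (v : Fin n → A) : DetLine A :=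
  if h : finrank ℝ A = n then exteriorPower.ιMulti ℝ (finrank ℝ A) (v ∘ Fin.cast h) else 0

open Classical in
/-- The map `det A → det B` induced by a linear map between spaces of the same dimension
(set to `0` if the dimensions differ). -/
def detMap (j : A →ₗ[ℝ] B) : DetLine A →ₗ[ℝ] DetLine B :=
  if h : finrank ℝ A = finrank ℝ B then
    (LinearEquiv.ofEq (⋀[ℝ]^(finrank ℝ A) B) (⋀[ℝ]^(finrank ℝ B) B) (by rw [h])).toLinearMap ∘ₗ
      exteriorPower.map (finrank ℝ A) j
  else 0

/-- The family `v` is a basis of `A`. -/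
def IsBasis {n : ℕ} (v : Fin n → A) : Prop :=
  LinearIndependent ℝ v ∧ Submodule.span ℝ (Set.range v) = ⊤

end Lines

/-! ### The determinant line of a Fredholm operator -/

section Fredholm

variable {E F V : Type*}
  [NormedAddCommGroup E] [InnerProductSpace ℝ E]
  [NormedAddCommGroup F] [InnerProductSpace ℝ F] [CompleteSpace F]
  [NormedAddCommGroup V] [InnerProductSpace ℝ V]

/-- The cokernel, realized as the orthogonal complement of the image. -/
abbrev Coker (T : E →L[ℝ] F) : Submodule ℝ F := (T.range)ᗮ

/-- The orthogonal projection onto the cokernel. -/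
def projCoker (T : E →L[ℝ] F) : F →ₗ[ℝ] Coker T := ((Coker T).orthogonalProjectionOnto).toLinearMap

/-- The determinant line `det (ker T) ⊗ (det (coker T))^*` of a Fredholm operator. -/
abbrev FredholmDet (T : E →L[ℝ] F) : Type _ :=
  DetLine T.ker ⊗[ℝ] Dual ℝ (DetLine (Coker T))

/-- The operator `T_K : E ⊕ V → F`, `(e, v) ↦ T e + K v`. -/
abbrev stab (T : E →L[ℝ] F) (K : V →L[ℝ] F) : E × V →L[ℝ] F := T.coprod K

/-- The inclusion `ker T → ker T_K`, `e ↦ (e, 0)`. -/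
def kerIncl (T : E →L[ℝ] F) (K : V →L[ℝ] F) : T.ker →ₗ[ℝ] (stab T K).ker :=
  (LinearMap.inl ℝ E V).restrict (by intro x hx; simpa using hx)

/-- The projection `P_V : ker T_K → V`. -/
def kerProj (T : E →L[ℝ] F) (K : V →L[ℝ] F) : (stab T K).ker →ₗ[ℝ] V :=
  (LinearMap.snd ℝ E V) ∘ₗ (stab T K).ker.subtype

/-- The map `proj_{coker T} ∘ K : V → coker T`. -/
def stabCoker (T : E →L[ℝ] F) (K : V →L[ℝ] F) : V →ₗ[ℝ] Coker T :=
  projCoker T ∘ₗ K.toLinearMap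

/-- `ξ ⊗ (P_V(η) ∧ ω)` is an adapted basis for the exact sequence
`0 → ker T → ker T_K → V → coker T → 0`. -/
structure IsAdapted (T : E →L[ℝ] F) (K : V →L[ℝ] F) {p q r : ℕ}
    (ξ : Fin p → T.ker) (η : Fin q → (stab T K).ker) (ω : Fin r → V) : Prop where
  basis_ker : IsBasis ξ
  card_coker : r = finrank ℝ (Coker T)
  basis_V : IsBasis (Fin.append (kerProj T K ∘ η) ω)

/-- The defining property of the canonical map
`Φ_K : det T → det (ker T_K) ⊗ (det V)^*`: for every adapted basis,
`Φ_K (ξ ⊗ F(ω)^*) = (-1)^{(n₀+n₁)(n₀+n₁+1)/2} (ξ ∧ η) ⊗ (P_V(η) ∧ ω)^*`,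
where `F = proj_{coker T} ∘ K`, `n₀ = dim coker T`, `n₁ = dim V`, and the dual `u^*` of a nonzero
element `u` of a line is the functional with `u^*(u) = 1`. -/
def IsStabIso (T : E →L[ℝ] F) (K : V →L[ℝ] F)
    (Φ : FredholmDet T →ₗ[ℝ] DetLine (stab T K).ker ⊗[ℝ] Dual ℝ (DetLine V)) : Prop :=
  ∀ (p q r : ℕ) (ξ : Fin p → T.ker) (η : Fin q → (stab T K).ker) (ω : Fin r → V),
    IsAdapted T K ξ η ω →
    ∀ (α : Dual ℝ (DetLine (Coker T))) (β : Dual ℝ (DetLine V)),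
      α (wedge (stabCoker T K ∘ ω)) = 1 →
      β (wedge (Fin.append (kerProj T K ∘ η) ω)) = 1 →
      Φ (wedge ξ ⊗ₜ[ℝ] α) =
        (-1 : ℝ) ^ ((finrank ℝ (Coker T) + finrank ℝ V) *
          (finrank ℝ (Coker T) + finrank ℝ V + 1) / 2) •
        (wedge (Fin.append (kerIncl T K ∘ ξ) η) ⊗ₜ[ℝ] β)

open Classical in
/-- The canonical isomorphism `Φ_K`. For `T` Fredholm and `T_K` surjective there is exactly one map
with the property `IsStabIso`. -/
def stabIso (T : E →L[ℝ] F) (K : V →L[ℝ] F) :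
    FredholmDet T →ₗ[ℝ] DetLine (stab T K).ker ⊗[ℝ] Dual ℝ (DetLine V) :=
  if h : ∃ Φ, IsStabIso T K Φ then h.choose else 0

end Fredholm

/-! ### The determinant line bundle of a family of Fredholm operators -/

section Bundle

variable {X E F V : Type*} [TopologicalSpace X]
  [NormedAddCommGroup E] [InnerProductSpace ℝ E]
  [NormedAddCommGroup F] [InnerProductSpace ℝ F] [CompleteSpace F]
  [NormedAddCommGroup V] [InnerProductSpace ℝ V]

/-- `K` is a stabilizer of the family `T` over `U`. -/
structure IsStabilizerOn (T : X → E →L[ℝ] F) (K : X → V →L[ℝ] F) (U : Set X) : Prop where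
  continuousOn : ContinuousOn K U
  surjective : ∀ x ∈ U, Function.Surjective (stab (T x) (K x))

/-- Continuity over the open set `U` of a section of the line bundle `det (ker T_K) ⊗ (det V)^*`:
locally it is a continuous multiple of `(f₁ ∧ … ∧ fₘ) ⊗ β`, where `f` is a continuous frame of the
subbundle `ker T_K` of the trivial bundle with fibre `E ⊕ V`, and `β ≠ 0` is a fixed element
of the line `(det V)^*`. -/
def ContinuousStabSection (T : X → E →L[ℝ] F) (K : X → V →L[ℝ] F) (U : Set X)
    (y : ∀ x, DetLine (stab (T x) (K x)).ker ⊗[ℝ] Dual ℝ (DetLine V)) : Prop :=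
  ∀ x₀ ∈ U, ∃ N : Set X, IsOpen N ∧ x₀ ∈ N ∧ N ⊆ U ∧
    ∃ (m : ℕ) (f : ∀ x, Fin m → (stab (T x) (K x)).ker) (β : Dual ℝ (DetLine V)) (c : X → ℝ),
      (∀ i, ContinuousOn (fun x => (f x i : E × V)) N) ∧ (∀ x ∈ N, IsBasis (f x)) ∧
      β ≠ 0 ∧ ContinuousOn c N ∧ ∀ x ∈ N, y x = c x • (wedge (f x) ⊗ₜ[ℝ] β)

/-- Continuity of a section of the determinant line bundle `⋃ₓ det Tₓ → X`. The topology of the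
bundle is the one for which `Φ_K` is a bundle isomorphism onto `det (ker T_K) ⊗ (det V)^*` over `U`
for every stabilizer `K` of `T` over an open set `U`. Up to isometry, the finite dimensional
Hilbert spaces `V` are the spaces `ℝⁿ`. -/
def ContinuousDetSection (T : X → E →L[ℝ] F) (s : ∀ x, FredholmDet (T x)) : Prop :=
  ∀ (n : ℕ) (K : X → EuclideanSpace ℝ (Fin n) →L[ℝ] F) (U : Set X), IsOpen U →
    IsStabilizerOn T K U → ContinuousStabSection T K U (fun x => stabIso (T x) (K x) (s x))

/-- A trivialization of the determinant line bundle of `T`. -/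
def IsDetTrivialization (T : X → E →L[ℝ] F) (φ : ∀ x, ℝ ≃ₗ[ℝ] FredholmDet (T x)) : Prop :=
  ContinuousDetSection T (fun x => φ x 1)

end Bundle

/-! ### Self-adjoint operators with domain `W`, where `ι : W → H` is the embedding -/

section SelfAdjoint

variable {W H : Type*}
  [NormedAddCommGroup W] [InnerProductSpace ℝ W]
  [NormedAddCommGroup H] [InnerProductSpace ℝ H] [CompleteSpace H]

/-- A bounded operator `T : W → H`, regarded as an unbounded operator in `H` with domain `W`. -/
def toPMap (ι : W →L[ℝ] H) (hι : Function.Injective ι) (T : W →L[ℝ] H) : H →ₗ.[ℝ] H where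
  domain := LinearMap.range ι.toLinearMap
  toFun := T.toLinearMap ∘ₗ (LinearEquiv.ofInjective ι.toLinearMap hι).symm.toLinearMap

/-- The set of bounded operators `W → H` that are self-adjoint as unbounded operators in `H`. -/
def selfAdjointOps (ι : W →L[ℝ] H) (hι : Function.Injective ι) : Set (W →L[ℝ] H) :=
  {T | IsSelfAdjoint (toPMap ι hι T)}

/-! ### Orientation transport -/

/-- For self-adjoint `T` one has `coker T = (im T)^⊥ = ker T`; this is the resulting map
`ker T → coker T`, the embedding into `H` followed by the orthogonal projection (which is then the
identity on the image of `ker T`). -/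
def kerToCoker (ι T : W →L[ℝ] H) : T.ker →ₗ[ℝ] Coker T :=
  projCoker T ∘ₗ ι.toLinearMap ∘ₗ T.ker.subtype

/-- The canonical isomorphism `Ψ_T : det T → ℝ` of a self-adjoint Fredholm operator,
`Ψ_T (ξ ⊗ ω^*) = (-1)^{n₀(n₀+1)/2} ω^*[ξ]`, `n₀ = dim ker T`. -/
def Psi (ι T : W →L[ℝ] H) : FredholmDet T →ₗ[ℝ] ℝ :=
  (-1 : ℝ) ^ (finrank ℝ T.ker * (finrank ℝ T.ker + 1) / 2) •
    TensorProduct.lift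
      ((Dual.eval ℝ (DetLine (Coker T))) ∘ₗ detMap (kerToCoker ι T))

/-- `s` is the orientation transport along `T : [a, b] → 𝓕_sa(W, H)`: the sign of
`Ψ_{T_b} ∘ Ψ_{T_a T_b} ∘ Ψ_{T_a}⁻¹ (1)`, where `Ψ_{T_a T_b} : det T_a → det T_b` is induced
by a trivialization of `det T → [a, b]`. -/
def IsOrientationTransport (ι : W →L[ℝ] H) (a b : ℝ) (hab : a < b)
    (T : ℝ → W →L[ℝ] H) (s : ℝ) : Prop :=
  ∃ φ : ∀ t : Set.Icc a b, ℝ ≃ₗ[ℝ] FredholmDet (T t),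
    IsDetTrivialization (fun t : Set.Icc a b => T t) φ ∧
    ∃ x : FredholmDet (T a), Psi ι (T a) x = 1 ∧
      s = Real.sign (Psi ι (T b)
        (φ ⟨b, Set.right_mem_Icc.2 hab.le⟩ ((φ ⟨a, Set.left_mem_Icc.2 hab.le⟩).symm x)))

/-! ### Spectral flow -/

/-- The signature of a self-adjoint endomorphism of a finite dimensional space: the number of
positive eigenvalues minus the number of negative ones, counted with multiplicity. -/
def signature {N : Type*} [AddCommGroup N] [Module ℝ N] (S : End ℝ N) : ℤ :=
  (∑ᶠ μ ∈ Set.Ioi (0 : ℝ), (finrank ℝ (End.eigenspace S μ) : ℤ)) -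
    ∑ᶠ μ ∈ Set.Iio (0 : ℝ), (finrank ℝ (End.eigenspace S μ) : ℤ)

/-- The kernel of `T` as a subspace of `H`. -/
abbrev kerH (ι T : W →L[ℝ] H) : Submodule ℝ H := T.ker.map ι.toLinearMap

open Classical in
/-- The crossing operator `C_T(t) = proj_{ker T_t} ∘ T'_t : ker T_t → ker T_t` of a path
`T : [a, b] → 𝓛_sa(W, H)`, the kernel being viewed as a subspace of `H`. (The orthogonal projection
exists because the kernel is finite dimensional; otherwise the value is `0`.) -/
def crossingOp (ι : W →L[ℝ] H) (hι : Function.Injective ι) (a b : ℝ)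
    (T : ℝ → W →L[ℝ] H) (t : ℝ) : End ℝ (kerH ι (T t)) :=
  if _h : (kerH ι (T t)).HasOrthogonalProjection then
    ((kerH ι (T t)).orthogonalProjectionOnto).toLinearMap ∘ₗ
      (derivWithin T (Set.Icc a b) t).toLinearMap ∘ₗ (T t).ker.subtype ∘ₗ
      (Submodule.equivMapOfInjective ι.toLinearMap hι (T t).ker).symm.toLinearMap
  else 0

/-- The path `T` is transversal: all crossing operators are invertible. -/
def IsTransversal (ι : W →L[ℝ] H) (hι : Function.Injective ι) (a b : ℝ)
    (T : ℝ → W →L[ℝ] H) : Prop :=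
  ∀ t ∈ Set.Icc a b, Function.Bijective (crossingOp ι hι a b T t)

/-- The path `T + ε`. -/
def shift (ι : W →L[ℝ] H) (T : ℝ → W →L[ℝ] H) (ε : ℝ) : ℝ → W →L[ℝ] H :=
  fun t => T t + ε • ι

/-- `n` is the value of the spectral flow of the path `T : [a, b] → 𝓛_sa(W, H)`:
`n = ∑_{t ∈ (a, b)} sign C_{T+ε}(t)` for some `ε` with `0 < ε ≤ δ` such that `T + ε` is transversal,
where `δ > 0` is such that `T_a + ε'` and `T_b + ε'` are invertible for all `0 < ε' ≤ δ`.
(A transversal path has only finitely many `t` with `ker T_t ≠ 0`.) -/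
def IsSpectralFlow (ι : W →L[ℝ] H) (hι : Function.Injective ι) (a b : ℝ)
    (T : ℝ → W →L[ℝ] H) (n : ℤ) : Prop :=
  ∃ δ > 0,
    (∀ ε ∈ Set.Ioc 0 δ, Function.Bijective (shift ι T ε a) ∧
      Function.Bijective (shift ι T ε b)) ∧
    ∃ ε ∈ Set.Ioc 0 δ, IsTransversal ι hι a b (shift ι T ε) ∧
      n = ∑ᶠ t ∈ Set.Ioo a b, signature (crossingOp ι hι a b (shift ι T ε) t)

end SelfAdjoint

end OTSF

end

/-! Both sides are signs of one function. By compactness a single constant `K : ℝⁿ → H` stabilizes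
all operators `T_t + λ` with `t ∈ [a, b]` and `λ ∈ [0, ε]` (`exists_stabilizer`), and since this
rectangle is contractible the kernels of `(T_t + λ)_K` have a global continuous frame
(`exists_framedStabilizer`). Let `D(t, λ)` be the determinant of the `ℝⁿ`-components of the frame.
It is continuous, and it vanishes exactly where `T_t + λ` is not invertible
(`IsSA.det_ne_zero_iff`).

One local computation, `tendsto_det_repr`, is used twice. If `S_σ` has derivative `J` at `S` and `J`
induces an isomorphism `ker S → coker S`, then the determinants of convergent frames of `ker
(S_σ)_K` behave like `d σ^k` with `k = dim ker S` and `d ≠ 0`. For `S_σ = S + σ` the coefficient `d`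
describes `Φ_K`: up to a sign depending only on `n`, `Φ_K x` is `Ψ_S x / d` times the generator
given by the frame (`IsSA.stabIso_eq`). Thus the elements with `Ψ = d_t` form a continuous section.
Another stabilizer changes the determinants by a continuous factor, so this section trivializes the
bundle, and `ε(T)` is the sign of `d_a d_b`. That is the sign of `D(a, ε) D(b, ε)`, because `D(a,
·)` and `D(b, ·)` have no zeros on `(0, ε]`. For `S_σ = T_{z+σ} + ε` at a nondegenerate crossing
`z`, the function `D(·, ε)` has a zero of order `dim ker (T_z + ε)`. So the same sign is `(-1)` to
the sum of these dimensions, and the signature of an invertible symmetric operator has the parity of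
the dimension.

For the existence of the spectral flow, the end points become invertible under small shifts because
`D(t, λ) ∼ d λ^k`. Almost every shift is transversal (`volume_not_isTransversal`): near a given
operator the problem reduces to a symmetric form on a finite dimensional space that is strictly
increasing in `λ`. A degenerate crossing provides subspaces whose dimensions add up to more than the
total, on which the form is nonpositive, respectively nonnegative, to first order in `t`. Comparing
two such points shows that the bad `λ` vary more slowly than any multiple of `t`, so they form a
null set. -/

open scoped TensorProduct

noncomputable section

namespace OTSF

open Module

/-! ### Wedge products of bases -/

section Wedge

variable {A B : Type*} [AddCommGroup A] [Module ℝ A] [AddCommGroup B] [Module ℝ B]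

/-- The basis with underlying family `v`. -/
def IsBasis.basis {n : ℕ} {v : Fin n → A} (h : IsBasis v) : Basis (Fin n) ℝ A :=
  Basis.mk h.1 h.2.ge

@[simp] lemma IsBasis.coe_basis {n : ℕ} {v : Fin n → A} (h : IsBasis v) : ⇑h.basis = v :=
  Basis.coe_mk _ _

lemma IsBasis.finrank_eq {n : ℕ} {v : Fin n → A} (h : IsBasis v) : finrank ℝ A = n := by
  simpa using finrank_eq_card_basis h.basis

lemma IsBasis.of_basis {n : ℕ} (b : Basis (Fin n) ℝ A) : IsBasis b :=
  ⟨b.linearIndependent, b.span_eq⟩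

lemma IsBasis.of_linearIndependent {n : ℕ} {v : Fin n → A} (hv : LinearIndependent ℝ v)
    (h : finrank ℝ A = n) (hn : FiniteDimensional ℝ A) : IsBasis v :=
  ⟨hv, hv.span_eq_top_of_card_eq_finrank' (by simp [h])⟩

/-- Both sides are alternating in `v`, so it suffices to compare them on tuples of distinct basis
vectors; such a tuple is a permutation of the basis and contributes the same sign on both sides. -/
lemma alternatingMap_eq_det_smul {n : ℕ} {M : Type*} [AddCommGroup M] [Module ℝ M]
    (b : Basis (Fin n) ℝ A) (f : A [⋀^Fin n]→ₗ[ℝ] M) (v : Fin n → A) : f v = b.det v • f b := by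
  have : f = (LinearMap.toSpanSingleton ℝ M (f b)).compAlternatingMap b.det := by
    refine b.ext_alternating fun i hi => ?_
    have hbij : Function.Bijective i := Finite.injective_iff_bijective.1 hi
    set σ : Equiv.Perm (Fin n) := Equiv.ofBijective i hbij with hσ
    have h1 : (fun j => b (i j)) = ⇑b ∘ σ := rfl
    rw [h1, AlternatingMap.map_perm, AlternatingMap.map_perm]
    simp [Basis.det_self]
  conv_lhs => rw [this]
  simp

lemma wedge_eq_det_smul {n : ℕ} (b : Basis (Fin n) ℝ A) (v : Fin n → A) :
    wedge v = b.det v • wedge b := by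
  have h : finrank ℝ A = n := by simpa using finrank_eq_card_basis b
  subst h
  simp only [wedge, dite_true]
  exact alternatingMap_eq_det_smul b (exteriorPower.ιMulti ℝ (finrank ℝ A)) v

/-- The functional on `det A` whose value on `v₁ ∧ … ∧ vₙ` is the determinant of `v` in the
basis `b`. -/
lemma exists_detForm {n : ℕ} (b : Basis (Fin n) ℝ A) :
    ∃ β : Dual ℝ (DetLine A), ∀ v : Fin n → A, β (wedge v) = b.det v := by
  have h : finrank ℝ A = n := by simpa using finrank_eq_card_basis b
  subst h
  refine ⟨exteriorPower.alternatingMapLinearEquiv b.det, fun v => ?_⟩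
  simp only [wedge, dite_true]
  exact exteriorPower.alternatingMapLinearEquiv_apply_ιMulti b.det v

/-- The functional on `det A` whose value on `v₁ ∧ … ∧ vₙ` is the determinant of `v` in the
basis `b`. -/
def detForm {n : ℕ} (b : Basis (Fin n) ℝ A) : Dual ℝ (DetLine A) := (exists_detForm b).choose

lemma detForm_wedge {n : ℕ} (b : Basis (Fin n) ℝ A) (v : Fin n → A) :
    detForm b (wedge v) = b.det v := (exists_detForm b).choose_spec v

lemma exists_eq_smul_wedge {n : ℕ} (b : Basis (Fin n) ℝ A) (x : DetLine A) :
    ∃ c : ℝ, x = c • wedge b := by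
  have h : finrank ℝ A = n := by simpa using finrank_eq_card_basis b
  subst h
  have hx : x ∈ Submodule.span ℝ (Set.range (exteriorPower.ιMulti ℝ (finrank ℝ A) (M := A))) := by
    rw [exteriorPower.ιMulti_span]; trivial
  have hle : Submodule.span ℝ (Set.range (exteriorPower.ιMulti ℝ (finrank ℝ A) (M := A))) ≤
      Submodule.span ℝ {wedge b} := by
    rw [Submodule.span_le]
    rintro _ ⟨v, rfl⟩
    have := wedge_eq_det_smul b v
    simp only [wedge, dite_true] at this ⊢
    exact Submodule.mem_span_singleton.2 ⟨_, this.symm⟩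
  obtain ⟨c, hc⟩ := Submodule.mem_span_singleton.1 (hle hx)
  exact ⟨c, hc.symm⟩

lemma dual_eq_smul_detForm {n : ℕ} (b : Basis (Fin n) ℝ A) (β : Dual ℝ (DetLine A)) :
    β = β (wedge b) • detForm b := by
  refine LinearMap.ext fun x => ?_
  obtain ⟨c, rfl⟩ := exists_eq_smul_wedge b x
  simp [detForm_wedge, b.det_self, mul_comm]

lemma detMap_wedge {n : ℕ} (j : A →ₗ[ℝ] B) (h : finrank ℝ A = finrank ℝ B) (v : Fin n → A) :
    detMap j (wedge v) = wedge (j ∘ v) := by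
  by_cases hn : finrank ℝ A = n
  · subst hn
    have h' := h.symm
    simp only [detMap, wedge, h, dite_true, LinearMap.comp_apply]
    rw [exteriorPower.map_apply_ιMulti]
    ext
    have hcast : ∀ (k m : ℕ) (e : k = m) (w : Fin m → B),
        ExteriorAlgebra.ιMulti ℝ m w = ExteriorAlgebra.ιMulti ℝ k (w ∘ Fin.cast e) := by
      rintro k m rfl w
      rfl
    simpa [exteriorPower.ιMulti_apply_coe] using hcast _ _ h' _
  · rw [wedge, dif_neg hn, wedge, dif_neg (h ▸ hn), map_zero]

end Wedge

/-! ### Self-adjoint operators with compactly embedded domain -/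

section SelfAdjointTheory

open Filter Topology

variable {W H : Type*}
  [NormedAddCommGroup W] [InnerProductSpace ℝ W]
  [NormedAddCommGroup H] [InnerProductSpace ℝ H]

/-- `S : W → H` is self-adjoint as an unbounded operator in `H` with domain `W`, phrased without
partially defined maps: `S` is symmetric and has no proper symmetric adjoint extension. -/
structure IsSA (ι S : W →L[ℝ] H) : Prop where
  symm : ∀ x y, inner ℝ (S x) (ι y) = inner ℝ (ι x) (S y)
  maximal : ∀ y z, (∀ w, inner ℝ (S w) y = inner ℝ (ι w) z) → ∃ x, ι x = y ∧ S x = z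

/-- Formal adjointness gives the symmetry. The relation between `y` and `z` in `maximal` says that
`y` lies in the domain of the adjoint with value `z`, and the adjoint is the operator itself. -/
lemma IsSA.of_mem [CompleteSpace H] {ι : W →L[ℝ] H} {hι : Function.Injective ι} {S : W →L[ℝ] H}
    (h : S ∈ selfAdjointOps ι hι) : IsSA ι S := by
  have hA : IsSelfAdjoint (toPMap ι hι S) := h
  have hd := hA.dense_domain
  have heq : LinearPMap.adjoint (toPMap ι hι S) = toPMap ι hι S := hA
  have hval : ∀ x, (toPMap ι hι S) ⟨ι x, ⟨x, rfl⟩⟩ = S x := by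
    intro x
    have : (LinearEquiv.ofInjective ι.toLinearMap hι).symm ⟨ι x, ⟨x, rfl⟩⟩ = x := by
      rw [LinearEquiv.symm_apply_eq]; rfl
    exact congrArg S this
  constructor
  · intro x y
    have hf := LinearPMap.adjoint_isFormalAdjoint hd
    rw [heq] at hf
    have := hf ⟨ι x, ⟨x, rfl⟩⟩ ⟨ι y, ⟨y, rfl⟩⟩
    rw [hval, hval] at this
    exact this
  · intro y z hyz
    have key : ∃ hy : y ∈ (LinearPMap.adjoint (toPMap ι hι S)).domain,
        LinearPMap.adjoint (toPMap ι hι S) ⟨y, hy⟩ = z := by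
      have hx : ∀ x : (toPMap ι hι S).domain,
          inner ℝ z (x : H) = inner ℝ y ((toPMap ι hι S) x) := by
        rintro ⟨_, w, rfl⟩
        have := hval w
        rw [real_inner_comm, real_inner_comm _ y]
        erw [this]
        exact (hyz w).symm
      refine ⟨LinearPMap.mem_adjoint_domain_of_exists y ⟨z, hx⟩, ?_⟩
      exact LinearPMap.adjoint_apply_eq hd _ hx
    rw [heq] at key
    obtain ⟨⟨x, rfl⟩, hy⟩ := key
    exact ⟨x, rfl, (hval x).symm.trans hy⟩

lemma IsSA.add_smul {ι S : W →L[ℝ] H} (h : IsSA ι S) (c : ℝ) : IsSA ι (S + c • ι) := by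
  constructor
  · intro x y
    simp [inner_add_left, inner_add_right, inner_smul_left, inner_smul_right, h.symm x y]
  · intro y z hyz
    obtain ⟨x, hx, hSx⟩ := h.maximal y (z - c • y) fun w => by
      have := hyz w
      simp only [add_apply, smul_apply, inner_add_left,
        inner_smul_left, RCLike.conj_to_real] at this
      rw [inner_sub_right, inner_smul_right]
      linarith
    exact ⟨x, hx, by simp [hx, hSx]⟩

/-- Orthogonality to the image is the adjoint relation with value `0`, so maximality places the
vector in `ι (ker S)`. This is what makes the index zero. -/
lemma IsSA.map_ker_eq_coker {ι S : W →L[ℝ] H} (h : IsSA ι S) :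
    kerH ι S = Coker S := by
  ext y
  constructor
  · rintro ⟨x, hx, rfl⟩
    rw [Submodule.mem_orthogonal]
    rintro _ ⟨w, rfl⟩
    have hx0 : S x = 0 := hx
    have := h.symm w x
    rw [hx0, inner_zero_right] at this
    exact this
  · intro hy
    rw [Submodule.mem_orthogonal] at hy
    obtain ⟨x, hx, hSx⟩ := h.maximal y 0 fun w => by
      rw [inner_zero_right]; exact hy _ ⟨w, rfl⟩
    exact ⟨x, hSx, hx⟩

variable [CompleteSpace W] [CompleteSpace H]

/-- The graph of a self-adjoint operator is closed, by maximality. Hence the injective map `w ↦ (ι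
w, S w)` has closed range and is bounded below by the open mapping theorem: the graph norm dominates
the norm of `W`. -/
lemma IsSA.exists_norm_le {ι S : W →L[ℝ] H} (hι : Function.Injective ι) (h : IsSA ι S) :
    ∃ C : ℝ, 0 < C ∧ ∀ w, ‖w‖ ≤ C * (‖S w‖ + ‖ι w‖) := by
  have hinj : (ι.prod S).ker = ⊥ := by
    rw [LinearMap.ker_eq_bot]
    intro x y hxy
    exact hι (congrArg Prod.fst hxy)
  have hcl : IsClosed ((ι.prod S).range : Set (H × H)) := by
    rw [← isSeqClosed_iff_isClosed]
    rintro u ⟨y, z⟩ hu hlim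
    have h1 : Tendsto (fun n => (u n).1) atTop (𝓝 y) := (continuous_fst.tendsto _).comp hlim
    have h2 : Tendsto (fun n => (u n).2) atTop (𝓝 z) := (continuous_snd.tendsto _).comp hlim
    obtain ⟨x, hx, hSx⟩ := h.maximal y z fun w => by
      refine tendsto_nhds_unique (tendsto_const_nhds.inner h1) ?_
      refine (tendsto_const_nhds.inner h2).congr fun n => ?_
      obtain ⟨v, hv⟩ := hu n
      rw [← hv]
      exact (h.symm w v).symm
    exact ⟨x, Prod.ext hx hSx⟩
  obtain ⟨K, hK⟩ := (ι.prod S).antilipschitz_of_injective_of_isClosed_range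
    (LinearMap.ker_eq_bot.1 hinj) hcl
  refine ⟨K + 1, by positivity, fun w => ?_⟩
  have h1 := hK.le_mul_dist w 0
  simp only [dist_zero_right, map_zero] at h1
  have h2 : ‖(ι.prod S) w‖ ≤ ‖S w‖ + ‖ι w‖ := by
    rw [ContinuousLinearMap.prod_apply, Prod.norm_mk]
    exact max_le (by linarith [norm_nonneg (S w)]) (by linarith [norm_nonneg (ι w)])
  nlinarith [norm_nonneg ((ι.prod S) w), K.2, norm_nonneg (S w), norm_nonneg (ι w)]

/-- A bounded sequence along which `S` tends to zero has a convergent subsequence. -/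
lemma IsSA.exists_subseq_tendsto {ι S : W →L[ℝ] H} (hι : Function.Injective ι)
    (hc : IsCompactOperator ι) (h : IsSA ι S) {u : ℕ → W} (hu : ∀ n, ‖u n‖ ≤ 1)
    (hS : Tendsto (fun n => S (u n)) atTop (𝓝 0)) :
    ∃ (φ : ℕ → ℕ) (x : W), StrictMono φ ∧ Tendsto (u ∘ φ) atTop (𝓝 x) := by
  obtain ⟨C, hC, hle⟩ := h.exists_norm_le hι
  obtain ⟨Kc, hKc, hsub⟩ := hc.image_closedBall_subset_compact (𝕜₁ := ℝ) (f := ι.toLinearMap) 1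
  obtain ⟨y, -, φ, hφ, hy⟩ := hKc.tendsto_subseq (x := fun n => ι (u n))
    (fun n => hsub ⟨u n, by simpa using hu n, rfl⟩)
  refine ⟨φ, ?_⟩
  -- Compactness of `ι` makes `ι u` Cauchy along the subsequence, and `S u` tends to zero; the graph
  -- norm estimate combines the two into a Cauchy property in `W`.
  have hcau : CauchySeq (u ∘ φ) := by
    have h1 : CauchySeq (fun n => ι (u (φ n))) := hy.cauchySeq
    have h2 : CauchySeq (fun n => S (u (φ n))) := (hS.comp hφ.tendsto_atTop).cauchySeq
    rw [Metric.cauchySeq_iff] at h1 h2 ⊢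
    intro ε hε
    obtain ⟨N1, hN1⟩ := h1 (ε / (2 * C)) (by positivity)
    obtain ⟨N2, hN2⟩ := h2 (ε / (2 * C)) (by positivity)
    refine ⟨max N1 N2, fun m hm n hn => ?_⟩
    have a1 := hN1 m (le_trans (le_max_left _ _) hm) n (le_trans (le_max_left _ _) hn)
    have a2 := hN2 m (le_trans (le_max_right _ _) hm) n (le_trans (le_max_right _ _) hn)
    rw [dist_eq_norm, ← map_sub] at a1 a2
    rw [dist_eq_norm]
    calc ‖(u ∘ φ) m - (u ∘ φ) n‖ ≤ C * (‖S (u (φ m) - u (φ n))‖ + ‖ι (u (φ m) - u (φ n))‖) :=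
          hle _
      _ < C * (ε / (2 * C) + ε / (2 * C)) := by gcongr
      _ = ε := by field_simp; ring
  obtain ⟨x, hx⟩ := cauchySeq_tendsto_of_complete hcau
  exact ⟨x, hφ, hx⟩

/-- Riesz: bounded sequences in the kernel have convergent subsequences, so its closed unit ball is
compact. -/
lemma IsSA.finiteDimensional_ker {ι S : W →L[ℝ] H} (hι : Function.Injective ι)
    (hc : IsCompactOperator ι) (h : IsSA ι S) : FiniteDimensional ℝ S.ker := by
  have : IsCompact (Metric.closedBall (0 : S.ker) 1) := by
    refine IsSeqCompact.isCompact fun u hu => ?_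
    obtain ⟨φ, x, hφ, hx⟩ := h.exists_subseq_tendsto hι hc (u := fun n => (u n : W))
      (fun n => by simpa using hu n) (by
        have : (fun n => S (u n : W)) = fun _ => 0 := funext fun n => (u n).2
        rw [this]; exact tendsto_const_nhds)
    have hxk : x ∈ S.ker := S.isClosed_ker.mem_of_tendsto hx (Eventually.of_forall fun n => (u _).2)
    have hx' : Tendsto (u ∘ φ) atTop (𝓝 ⟨x, hxk⟩) := tendsto_subtype_rng.2 hx
    exact ⟨⟨x, hxk⟩, Metric.isClosed_closedBall.mem_of_tendsto hx'
      (Eventually.of_forall fun n => hu _), φ, hφ, hx'⟩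
  exact FiniteDimensional.of_isCompact_closedBall ℝ one_pos this

/-- `S` is bounded below on `(ker S)ᗮ`. Otherwise unit vectors `u_n` there with `S u_n → 0` would
subconverge to a unit vector lying in both `ker S` and its complement. -/
lemma IsSA.isClosed_range {ι S : W →L[ℝ] H} (hι : Function.Injective ι)
    (hc : IsCompactOperator ι) (h : IsSA ι S) : IsClosed (S.range : Set H) := by
  have hfd := h.finiteDimensional_ker hι hc
  set L : S.kerᗮ →L[ℝ] H := S.comp S.kerᗮ.subtypeL with hL
  have hb : ∃ c : ℝ, 0 < c ∧ ∀ x : S.kerᗮ, c * ‖x‖ ≤ ‖L x‖ := by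
    by_contra! hcon
    have h1 : ∀ n : ℕ, ∃ x : S.kerᗮ, ‖x‖ = 1 ∧ ‖L x‖ < 1 / ((n : ℝ) + 1) := by
      intro n
      obtain ⟨x, hx⟩ := hcon (1 / ((n : ℝ) + 1)) (by positivity)
      have hx0 : x ≠ 0 := by rintro rfl; simp at hx
      have hn : 0 < ‖x‖ := norm_pos_iff.2 hx0
      refine ⟨‖x‖⁻¹ • x, by rw [norm_smul, norm_inv, norm_norm, inv_mul_cancel₀ hn.ne'], ?_⟩
      rw [map_smul, norm_smul, norm_inv, norm_norm, inv_mul_lt_iff₀ hn]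
      linarith
    choose u hu1 hu2 using h1
    obtain ⟨φ, x, hφ, hx⟩ := h.exists_subseq_tendsto hι hc (u := fun n => (u n : W))
      (fun n => by simpa using (hu1 n).le)
      (squeeze_zero_norm (fun n => (hu2 n).le) tendsto_one_div_add_atTop_nhds_zero_nat)
    have hx1 : ‖x‖ = 1 := tendsto_nhds_unique hx.norm
      (tendsto_const_nhds.congr fun n => (hu1 (φ n)).symm)
    have hxo : x ∈ S.kerᗮ := (Submodule.isClosed_orthogonal _).mem_of_tendsto hx
      (Eventually.of_forall fun n => (u _).2)
    have hxk : x ∈ S.ker := by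
      have h3 : Tendsto (fun n => S (u (φ n))) atTop (𝓝 (S x)) := (S.continuous.tendsto x).comp hx
      have h4 : Tendsto (fun n => S (u (φ n))) atTop (𝓝 0) :=
        (squeeze_zero_norm (fun n => (hu2 n).le) tendsto_one_div_add_atTop_nhds_zero_nat).comp
          hφ.tendsto_atTop
      exact tendsto_nhds_unique h3 h4
    have := Submodule.inner_right_of_mem_orthogonal hxk hxo
    rw [real_inner_self_eq_norm_sq, hx1] at this
    norm_num at this
  obtain ⟨c, hc0, hle⟩ := hb
  have hanti : AntilipschitzWith (Real.toNNReal c⁻¹) L := by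
    refine L.antilipschitz_of_bound fun x => ?_
    rw [Real.coe_toNNReal _ (by positivity), ← div_eq_inv_mul, le_div_iff₀ hc0, mul_comm]
    exact hle x
  have hr : (S.range : Set H) = Set.range L := by
    ext y
    constructor
    · rintro ⟨x, rfl⟩
      refine ⟨⟨x - S.ker.starProjection x, Submodule.sub_starProjection_mem_orthogonal _⟩, ?_⟩
      have : S (S.ker.starProjection x) = 0 := (Submodule.starProjection_apply_mem S.ker x)
      simp [hL, this]
    · rintro ⟨x, rfl⟩
      exact ⟨x, rfl⟩
  rw [hr]
  exact hanti.isClosed_range L.uniformContinuous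

/-- `H = im S ⊕ ι (ker S)`. -/
lemma IsSA.exists_add_eq {ι S : W →L[ℝ] H} (hι : Function.Injective ι)
    (hc : IsCompactOperator ι) (h : IsSA ι S) (y : H) :
    ∃ w, ∃ z ∈ kerH ι S, S w + z = y := by
  have hcl := h.isClosed_range hι hc
  have : CompleteSpace S.range := hcl.completeSpace_coe
  refine ⟨?_, ?_⟩
  · exact (S.range.starProjection_apply_mem y).choose
  · refine ⟨y - S.range.starProjection y, ?_, ?_⟩
    · rw [h.map_ker_eq_coker]
      exact Submodule.sub_starProjection_mem_orthogonal y
    · have := (S.range.starProjection_apply_mem y).choose_spec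
      erw [this]; simp

end SelfAdjointTheory

/-! ### Adapted bases -/

section Adapted

variable {W H V : Type*}
  [NormedAddCommGroup W] [InnerProductSpace ℝ W]
  [NormedAddCommGroup H] [InnerProductSpace ℝ H]
  [NormedAddCommGroup V] [InnerProductSpace ℝ V]

lemma IsSA.finrank_coker {ι S : W →L[ℝ] H} (hι : Function.Injective ι) (h : IsSA ι S) :
    finrank ℝ (Coker S) = finrank ℝ S.ker := by
  rw [← h.map_ker_eq_coker]
  exact (LinearEquiv.finrank_eq (Submodule.equivMapOfInjective ι.toLinearMap hι S.ker)).symm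

lemma mem_ker_stab {S : W →L[ℝ] H} {K : V →L[ℝ] H} (x : (stab S K).ker) :
    S (x : W × V).1 + K (x : W × V).2 = 0 := by
  have := x.2
  simpa using this

variable [CompleteSpace H]

lemma projCoker_map (S : W →L[ℝ] H) (w : W) : projCoker S (S w) = 0 := by
  have : S w ∈ (Coker S)ᗮ := Submodule.le_orthogonal_orthogonal _ ⟨w, rfl⟩
  exact Submodule.orthogonalProjectionOnto_eq_zero_iff.2 this

lemma projCoker_of_mem (S : W →L[ℝ] H) (y : Coker S) : projCoker S y = y :=
  Submodule.orthogonalProjectionOnto_mem_subspace_eq_self y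

lemma IsSA.kerToCoker_bijective {ι S : W →L[ℝ] H} (hι : Function.Injective ι) (h : IsSA ι S) :
    Function.Bijective (kerToCoker ι S) := by
  have hval : ∀ x : S.ker, ((kerToCoker ι S x : Coker S) : H) = ι x := by
    intro x
    have hm : ι x ∈ Coker S := h.map_ker_eq_coker ▸ ⟨x, x.2, rfl⟩
    exact congrArg Subtype.val (projCoker_of_mem S ⟨ι x, hm⟩)
  constructor
  · intro x y hxy
    have := congrArg Subtype.val hxy
    rw [hval, hval] at this
    exact Subtype.ext (hι this)
  · rintro ⟨y, hy⟩
    have hy' := hy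
    rw [← h.map_ker_eq_coker] at hy'
    obtain ⟨x, hx, hxy⟩ := hy'
    exact ⟨⟨x, hx⟩, Subtype.ext ((hval _).trans hxy)⟩

/-- Together with the next two lemmas this is exactness of `ker S_K → V → coker S → 0`. -/
lemma stabCoker_surjective {S : W →L[ℝ] H} {K : V →L[ℝ] H}
    (hK : Function.Surjective (stab S K)) : Function.Surjective (stabCoker S K) := by
  intro y
  obtain ⟨⟨w, v⟩, hwv⟩ := hK y
  refine ⟨v, ?_⟩
  have h1 : S w + K v = y := by simpa using hwv
  have h2 := congrArg (projCoker S) h1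
  rw [map_add, projCoker_map, zero_add, projCoker_of_mem] at h2
  exact h2

lemma stabCoker_kerProj {S : W →L[ℝ] H} {K : V →L[ℝ] H} (x : (stab S K).ker) :
    stabCoker S K (kerProj S K x) = 0 := by
  have h1 : K (x : W × V).2 = S (-(x : W × V).1) := by
    rw [map_neg]; exact (neg_eq_of_add_eq_zero_right (mem_ker_stab x)).symm
  change projCoker S (K (x : W × V).2) = 0
  rw [h1, projCoker_map]

/-- The projection to the cokernel kills the closure of the image; closedness of the range turns
this into membership in the image. -/
lemma exists_kerProj_eq {S : W →L[ℝ] H} {K : V →L[ℝ] H} (hcl : IsClosed (S.range : Set H)) {v : V}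
    (hv : stabCoker S K v = 0) : ∃ x, kerProj S K x = v := by
  have : CompleteSpace S.range := hcl.completeSpace_coe
  have h1 : K v ∈ (Coker S)ᗮ :=
    (Submodule.orthogonalProjectionOnto_eq_zero_iff).1 hv
  rw [Submodule.orthogonal_orthogonal] at h1
  obtain ⟨w, hw⟩ := h1
  have hw' : S w = K v := hw
  exact ⟨⟨(-w, v), by simp [hw']⟩, rfl⟩

/-- `V → coker S` is onto and kills the vectors `P_V η`, so the images of the `ω` span; their number
is the dimension. -/
lemma isBasis_stabCoker [FiniteDimensional ℝ V] {S : W →L[ℝ] H} {K : V →L[ℝ] H}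
    (hK : Function.Surjective (stab S K))
    {p q r : ℕ} {ξ : Fin p → S.ker} {η : Fin q → (stab S K).ker} {ω : Fin r → V}
    (had : IsAdapted S K ξ η ω) : IsBasis (stabCoker S K ∘ ω) := by
  have hF := stabCoker_surjective hK
  have hspan : Submodule.span ℝ (Set.range (stabCoker S K ∘ ω)) = ⊤ := by
    rw [eq_top_iff]
    rintro y -
    obtain ⟨v, rfl⟩ := hF y
    have hv : v ∈ Submodule.span ℝ (Set.range (Fin.append (kerProj S K ∘ η) ω)) := by
      rw [had.basis_V.2]; trivial
    have := Submodule.mem_map_of_mem (f := stabCoker S K) hv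
    rw [Submodule.map_span] at this
    refine Submodule.span_le.2 ?_ this
    rintro _ ⟨_, ⟨i, rfl⟩, rfl⟩
    induction i using Fin.addCases with
    | left i => simp [stabCoker_kerProj]
    | right i =>
      simp only [Fin.append_right]
      exact Submodule.subset_span ⟨i, rfl⟩
  have : FiniteDimensional ℝ (Coker S) := Module.Finite.of_surjective _ hF
  refine ⟨linearIndependent_of_top_le_span_of_card_eq_finrank hspan.ge ?_, hspan⟩
  simp [had.card_coker]

/-- A diagram chase: `P_V` kills the included `ξ` and keeps the `η` independent, while for an
element of `ker S_K` the `ω`-coordinates of its projection vanish after applying `V → coker S`, so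
subtracting the `η`-part leaves an element of `ker S`. -/
lemma isBasis_append_kerIncl [FiniteDimensional ℝ V] {S : W →L[ℝ] H} {K : V →L[ℝ] H}
    (hK : Function.Surjective (stab S K))
    {p q r : ℕ} {ξ : Fin p → S.ker} {η : Fin q → (stab S K).ker} {ω : Fin r → V}
    (had : IsAdapted S K ξ η ω) : IsBasis (Fin.append (kerIncl S K ∘ ξ) η) := by
  have hPincl : ∀ x, kerProj S K (kerIncl S K x) = 0 := fun x => rfl
  have hlV := Fintype.linearIndependent_iff.1 had.basis_V.1
  have hlC := Fintype.linearIndependent_iff.1 (isBasis_stabCoker hK had).1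
  have hlξ := Fintype.linearIndependent_iff.1 had.basis_ker.1
  have hinj : Function.Injective (kerIncl S K) := by
    intro x y hxy
    have := congrArg (fun z : (stab S K).ker => (z : W × V).1) hxy
    exact Subtype.ext this
  constructor
  · rw [Fintype.linearIndependent_iff]
    intro g hg
    rw [Fin.sum_univ_add] at hg
    simp only [Fin.append_left, Fin.append_right, Function.comp_apply] at hg
    have hP := congrArg (kerProj S K) hg
    simp only [map_add, map_sum, map_smul, hPincl, smul_zero, Finset.sum_const_zero, zero_add,
      map_zero] at hP
    have hη : ∀ i, g (Fin.natAdd p i) = 0 := by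
      have := hlV (Fin.append (fun i => g (Fin.natAdd p i)) 0) (by
        rw [Fin.sum_univ_add]; simpa using hP)
      intro i
      simpa using this (Fin.castAdd r i)
    have hξ : ∀ i, g (Fin.castAdd q i) = 0 := by
      refine hlξ _ (hinj ?_)
      simpa [hη] using hg
    intro i
    induction i using Fin.addCases with
    | left i => exact hξ i
    | right i => exact hη i
  · rw [eq_top_iff]
    rintro u -
    have hu : kerProj S K u ∈ Submodule.span ℝ (Set.range (Fin.append (kerProj S K ∘ η) ω)) := by
      rw [had.basis_V.2]; trivial
    obtain ⟨c, hc⟩ := (Submodule.mem_span_range_iff_exists_fun ℝ).1 hu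
    rw [Fin.sum_univ_add] at hc
    simp only [Fin.append_left, Fin.append_right, Function.comp_apply] at hc
    have hF := congrArg (stabCoker S K) hc
    simp only [map_add, map_sum, map_smul, stabCoker_kerProj, smul_zero, Finset.sum_const_zero,
      zero_add] at hF
    have hω := hlC _ hF
    simp only [hω, zero_smul, Finset.sum_const_zero, add_zero] at hc
    set u' := u - ∑ i, c (Fin.castAdd r i) • η i with hu'
    have hPu' : kerProj S K u' = 0 := by rw [hu', map_sub, map_sum]; simp [hc]
    have hSu' : (u' : W × V).1 ∈ S.ker := by
      have := mem_ker_stab u'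
      have h2 : (u' : W × V).2 = 0 := hPu'
      rw [h2, map_zero, add_zero] at this
      exact this
    have hmem : (⟨(u' : W × V).1, hSu'⟩ : S.ker) ∈ Submodule.span ℝ (Set.range ξ) := by
      rw [had.basis_ker.2]; trivial
    have hinc : kerIncl S K ⟨(u' : W × V).1, hSu'⟩ = u' :=
      Subtype.ext (Prod.ext rfl hPu'.symm)
    have h1 : u' ∈ Submodule.span ℝ (Set.range (Fin.append (kerIncl S K ∘ ξ) η)) := by
      rw [← hinc]
      have := Submodule.mem_map_of_mem (f := kerIncl S K) hmem
      rw [Submodule.map_span] at this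
      refine Submodule.span_mono ?_ this
      rintro _ ⟨_, ⟨i, rfl⟩, rfl⟩
      exact ⟨Fin.castAdd q i, by simp⟩
    have h2 : ∑ i, c (Fin.castAdd r i) • η i ∈
        Submodule.span ℝ (Set.range (Fin.append (kerIncl S K ∘ ξ) η)) :=
      Submodule.sum_mem _ fun i _ => Submodule.smul_mem _ _
        (Submodule.subset_span ⟨Fin.natAdd p i, by simp⟩)
    have : u = u' + ∑ i, c (Fin.castAdd r i) • η i := by rw [hu']; abel
    rw [this]
    exact Submodule.add_mem _ h1 h2

/-- `η` lifts a basis of the kernel of `V → coker S`, and `ω` lifts a basis of `coker S`. -/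
lemma exists_isAdapted [FiniteDimensional ℝ V] {S : W →L[ℝ] H} {K : V →L[ℝ] H}
    (hfd : FiniteDimensional ℝ S.ker) (hcl : IsClosed (S.range : Set H))
    (hK : Function.Surjective (stab S K)) :
    ∃ (p q r : ℕ) (ξ : Fin p → S.ker) (η : Fin q → (stab S K).ker) (ω : Fin r → V),
      IsAdapted S K ξ η ω := by
  have hF := stabCoker_surjective hK
  have : FiniteDimensional ℝ (Coker S) := Module.Finite.of_surjective _ hF
  set N := LinearMap.ker (stabCoker S K) with hN
  let bN := finBasis ℝ N
  let bC := finBasis ℝ (Coker S)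
  choose ω hω using fun i => hF (bC i)
  choose η hη using fun i => exists_kerProj_eq hcl (LinearMap.mem_ker.1 (bN i).2)
  refine ⟨_, _, _, finBasis ℝ S.ker, η, ω, IsBasis.of_basis _, rfl, ?_⟩
  have hli : LinearIndependent ℝ (Fin.append (kerProj S K ∘ η) ω) := by
    rw [Fintype.linearIndependent_iff]
    intro g hg
    rw [Fin.sum_univ_add] at hg
    simp only [Fin.append_left, Fin.append_right, Function.comp_apply, hη] at hg
    have hg2 := congrArg (stabCoker S K) hg
    have hz : ∀ i, stabCoker S K (bN i : V) = 0 := fun i => LinearMap.mem_ker.1 (bN i).2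
    simp only [map_add, map_sum, map_smul, hz, hω, smul_zero, Finset.sum_const_zero, zero_add,
      map_zero] at hg2
    have h2 := Fintype.linearIndependent_iff.1 bC.linearIndependent _ hg2
    simp only [h2, zero_smul, Finset.sum_const_zero, add_zero] at hg
    have h1 := Fintype.linearIndependent_iff.1 bN.linearIndependent
      (fun i => g (Fin.castAdd _ i)) (Subtype.ext (by simpa using hg))
    intro i
    induction i using Fin.addCases with
    | left i => exact h1 i
    | right i => exact h2 i
  refine IsBasis.of_linearIndependent hli ?_ inferInstance
  have h1 := LinearMap.finrank_range_add_finrank_ker (stabCoker S K)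
  rw [LinearMap.range_eq_top.2 hF, finrank_top, ← hN] at h1
  omega

/-- The index of `T_K` is `dim V` if `T` has index zero. -/
lemma finrank_ker_stab [FiniteDimensional ℝ V] {S : W →L[ℝ] H} {K : V →L[ℝ] H}
    (hfd : FiniteDimensional ℝ S.ker) (hcl : IsClosed (S.range : Set H))
    (hind : finrank ℝ (Coker S) = finrank ℝ S.ker) (hK : Function.Surjective (stab S K)) :
    finrank ℝ (stab S K).ker = finrank ℝ V ∧ FiniteDimensional ℝ (stab S K).ker := by
  obtain ⟨p, q, r, ξ, η, ω, had⟩ := exists_isAdapted hfd hcl hK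
  have h0 := had.card_coker
  have h3 := had.basis_ker.finrank_eq
  have h1 := (isBasis_append_kerIncl hK had).finrank_eq
  have h2 := had.basis_V.finrank_eq
  exact ⟨by omega, Module.Finite.of_basis (isBasis_append_kerIncl hK had).basis⟩

end Adapted

/-! ### The asymptotics of the stabilized determinant -/

/-! ### The sign of exchanging two blocks of arguments. -/

section BlockSwap

lemma finRotate_pow_val {n : ℕ} (j : ℕ) (i : Fin n) :
    (((finRotate n) ^ j) i : ℕ) = (i + j) % n := by
  cases n with
  | zero => exact i.elim0
  | succ n =>
    induction j with
    | zero => simp [Nat.mod_eq_of_lt i.2]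
    | succ j ih =>
      rw [pow_succ', Equiv.Perm.mul_apply, finRotate_apply, Fin.val_add, ih, Fin.val_one',
        ← Nat.add_mod, add_assoc]

/-- Exchanging the blocks is the `k`-th power of the cyclic rotation, whose sign `(-1)^((k+q-1)k)`
equals `(-1)^(kq)` because `k(k-1)` is even. -/
lemma map_append_swap {A M : Type*} [AddCommGroup A] [Module ℝ A] [AddCommGroup M] [Module ℝ M]
    {k q : ℕ} (f : A [⋀^Fin (k + q)]→ₗ[ℝ] M) (v : Fin k → A) (y : Fin q → A) :
    f (Fin.append v y) =
      (-1 : ℝ) ^ (k * q) • f (Fin.append y v ∘ Fin.cast (Nat.add_comm k q)) := by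
  have hσ : Fin.append y v ∘ Fin.cast (Nat.add_comm k q) =
      Fin.append v y ∘ ((finRotate (k + q)) ^ k) := by
    funext i
    simp only [Function.comp_apply]
    by_cases hi : (i : ℕ) < q
    · have h1 : Fin.cast (Nat.add_comm k q) i = Fin.castAdd k ⟨i, hi⟩ := Fin.ext rfl
      have h2 : ((finRotate (k + q)) ^ k) i = Fin.natAdd k ⟨i, hi⟩ := by
        ext
        rw [finRotate_pow_val, Nat.mod_eq_of_lt (by omega)]
        simp [add_comm]
      rw [h1, h2, Fin.append_left, Fin.append_right]
    · have hi2 := i.2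
      have h1 : Fin.cast (Nat.add_comm k q) i = Fin.natAdd q ⟨i - q, by omega⟩ :=
        Fin.ext (by simp; omega)
      have h2 : ((finRotate (k + q)) ^ k) i = Fin.castAdd q ⟨i - q, by omega⟩ := by
        ext
        rw [finRotate_pow_val, Nat.mod_eq_sub_mod (by omega), Nat.mod_eq_of_lt (by omega)]
        simp; omega
      rw [h1, h2, Fin.append_left, Fin.append_right]
  rw [hσ, AlternatingMap.map_perm, map_pow, sign_finRotate, ← pow_mul]
  have hpar : (-1 : ℝ) ^ (k * q) * (-1 : ℝ) ^ ((k + q - 1) * k) = 1 := by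
    rw [← pow_add]
    refine Even.neg_one_pow ?_
    rcases Nat.eq_zero_or_pos k with rfl | hk
    · simp
    · have h0 : k * q + (k + q - 1) * k = k * (k - 1) + 2 * (k * q) := by
        obtain ⟨m, rfl⟩ : ∃ m, k = m + 1 := ⟨k - 1, by omega⟩
        have : m + 1 + q - 1 = m + q := by omega
        rw [this, Nat.add_sub_cancel]
        ring
      rw [h0]
      exact (Nat.even_mul_pred_self k).add (even_two_mul _)
  have hu : ∀ (m : ℕ) (z : M), ((-1 : ℤˣ) ^ m) • z = (-1 : ℝ) ^ m • z := by
    intro m z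
    rcases Nat.even_or_odd m with h | h <;> simp [h.neg_one_pow]
  rw [hu, smul_smul, hpar, one_smul]

end BlockSwap

/-! ### Leading terms of determinants of frames of stabilized kernels. -/

section Asymptotics

open Filter Topology

variable {W H V : Type*}
  [NormedAddCommGroup W] [InnerProductSpace ℝ W]
  [NormedAddCommGroup H] [InnerProductSpace ℝ H] [CompleteSpace H]
  [NormedAddCommGroup V] [InnerProductSpace ℝ V]

lemma wedge_comp_cast {A : Type*} [AddCommGroup A] [Module ℝ A] {m n : ℕ} (h : m = n)
    (v : Fin n → A) : wedge (v ∘ Fin.cast h) = wedge v := by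
  subst h; rfl

/-- Coordinates of the stabilized kernel with respect to an adapted basis of `V`, rescaled in the
cokernel directions. -/
lemma tendsto_det_repr [FiniteDimensional ℝ V] {S : W →L[ℝ] H} {K : V →L[ℝ] H}
    (hK : Function.Surjective (stab S K)) {k q : ℕ}
    {ξ : Fin k → S.ker} {η : Fin q → (stab S K).ker} {ω : Fin k → V}
    (had : IsAdapted S K ξ η ω) (bw : Basis (Fin (k + q)) ℝ V)
    (hbw : ⇑bw = Fin.append ω (kerProj S K ∘ η))
    {l : Filter ℝ} {Sσ : ℝ → W →L[ℝ] H} {J : W →L[ℝ] H}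
    (hJ : Tendsto (fun σ => σ⁻¹ • (Sσ σ - S)) l (𝓝 J))
    {g : ℝ → Fin (k + q) → W × V}
    (hg : ∀ᶠ σ in l, ∀ i, Sσ σ (g σ i).1 + K (g σ i).2 = 0)
    (hlim : ∀ i, Tendsto (fun σ => g σ i) l
      (𝓝 ((Fin.append (kerIncl S K ∘ ξ) η i : (stab S K).ker) : W × V))) :
    Tendsto (fun σ => bw.det (fun i => (g σ i).2) / σ ^ k) l
      (𝓝 ((-1) ^ k * (isBasis_stabCoker hK had).basis.det (fun i => projCoker S (J (ξ i))))) := by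
  set bC := (isBasis_stabCoker hK had).basis with hbC
  have : FiniteDimensional ℝ (Coker S) := Module.Finite.of_basis bC
  -- Since `V → coker S` kills `P_V η`, the `ω`-coordinates of a vector of `V` are the coordinates
  -- of its image in the cokernel.
  have hreprω : ∀ (v : V) (i : Fin k),
      bw.repr v (Fin.castAdd q i) = bC.repr (stabCoker S K v) i := by
    intro v i
    conv_rhs => rw [← bw.sum_repr v]
    rw [Fin.sum_univ_add]
    have h1 : ∀ j : Fin k, stabCoker S K (bw (Fin.castAdd q j)) = bC j := by
      intro j; rw [hbw, Fin.append_left, hbC, IsBasis.coe_basis]; rfl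
    have h2 : ∀ j : Fin q, stabCoker S K (bw (Fin.natAdd k j)) = 0 := by
      intro j; rw [hbw, Fin.append_right]; exact stabCoker_kerProj _
    simp [h1, h2, Finsupp.single_apply]
  -- Only the `k` rows of cokernel coordinates are divided by `σ`; this accounts for the factor
  -- `σ^k` in the determinant.
  set u : ℝ → Fin (k + q) → ℝ := fun σ => Fin.append (fun _ => σ⁻¹) (fun _ => 1) with hu
  set Nσ : ℝ → Matrix (Fin (k + q)) (Fin (k + q)) ℝ :=
    fun σ => Matrix.of fun i j => u σ i * bw.toMatrix (fun i => (g σ i).2) i j with hNσ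
  have hdet : ∀ σ, (Nσ σ).det = bw.det (fun i => (g σ i).2) / σ ^ k := by
    intro σ
    rw [hNσ, Matrix.det_mul_column, Basis.det_apply, Fin.prod_univ_add]
    simp only [hu, Fin.append_left, Fin.append_right, Finset.prod_const, Finset.card_univ,
      Fintype.card_fin, one_pow, mul_one, inv_pow]
    rw [div_eq_inv_mul]
  set g0 : Fin (k + q) → W × V :=
    fun i => ((Fin.append (kerIncl S K ∘ ξ) η i : (stab S K).ker) : W × V) with hg0
  set N0 : Matrix (Fin (k + q)) (Fin (k + q)) ℝ := Matrix.of fun i j =>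
    Fin.append (fun i' => -bC.repr (projCoker S (J (g0 j).1)) i')
      (fun i' => bw.repr (g0 j).2 (Fin.natAdd k i')) i with hN0
  have hlimN : Tendsto Nσ l (𝓝 N0) := by
    refine tendsto_pi_nhds.2 fun i => tendsto_pi_nhds.2 fun j => ?_
    induction i using Fin.addCases with
    | left i =>
      have hev : ∀ᶠ σ in l, -bC.repr (projCoker S ((σ⁻¹ • (Sσ σ - S)) (g σ j).1)) i =
          Nσ σ (Fin.castAdd q i) j := by
        filter_upwards [hg] with σ hσ
        -- On the kernel `K v = -S_σ w`, and modulo the image of `S` this equals `-(S_σ - S) w`. So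
        -- these rows are of order `σ`, and after division they converge to the coordinates of `-J
        -- w`.
        have h1 : K (g σ j).2 = -(Sσ σ (g σ j).1) :=
          (neg_eq_of_add_eq_zero_right (hσ j)).symm
        have h2 : stabCoker S K (g σ j).2 = -projCoker S ((Sσ σ - S) (g σ j).1) := by
          change projCoker S (K (g σ j).2) = _
          rw [h1, map_neg, sub_apply, map_sub, projCoker_map, sub_zero]
        simp only [hNσ, hu, Matrix.of_apply, Fin.append_left, Basis.toMatrix_apply, hreprω, h2]
        simp
        ring
      refine Tendsto.congr' hev ?_
      have hcont : Continuous (fun y : H => -bC.repr (projCoker S y) i) := by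
        have hc1 : Continuous (bC.coord i) := LinearMap.continuous_of_finiteDimensional _
        exact (hc1.comp ((Coker S).orthogonalProjectionOnto).continuous).neg
      have hJg : Tendsto (fun σ => (σ⁻¹ • (Sσ σ - S)) (g σ j).1) l (𝓝 (J (g0 j).1)) :=
        (isBoundedBilinearMap_apply.continuous.tendsto (J, (g0 j).1)).comp
          (hJ.prodMk_nhds ((continuous_fst.tendsto _).comp (hlim j)))
      have := (hcont.tendsto _).comp hJg
      simpa [hN0, Function.comp_def] using this
    | right i =>
      have hcont : Continuous (bw.coord (Fin.natAdd k i)) :=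
        LinearMap.continuous_of_finiteDimensional _
      have := (hcont.tendsto _).comp ((continuous_snd.tendsto (g0 j)).comp (hlim j))
      simpa [hN0, hNσ, hu, Function.comp_def, Basis.toMatrix_apply] using this
  have hdetN0 : N0.det = (-1) ^ k * bC.det (fun i => projCoker S (J (ξ i))) := by
    -- The limit is block upper triangular: the included `ξ` have no `V`-component, and the `P_V η`
    -- are basis vectors. The remaining block is minus the matrix of `J` on the `ξ`, whence the sign
    -- `(-1)^k`.
    rw [← Matrix.det_submatrix_equiv_self finSumFinEquiv N0]
    have : N0.submatrix finSumFinEquiv finSumFinEquiv = Matrix.fromBlocks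
        (-(bC.toMatrix fun i => projCoker S (J (ξ i))))
        (Matrix.of fun i j => -bC.repr (projCoker S (J (η j : W × V).1)) i) 0 1 := by
      ext i j
      rcases i with i | i <;> rcases j with j | j
      · simp [hN0, hg0, Basis.toMatrix_apply, kerIncl]
      · simp [hN0, hg0]
      · simp [hN0, hg0, kerIncl]
      · have h1 : (η j : W × V).2 = bw (Fin.natAdd k j) := by
          rw [hbw, Fin.append_right]; rfl
        simp [hN0, hg0, h1, Finsupp.single_apply, Matrix.one_apply, eq_comm]
    rw [this, Matrix.det_fromBlocks_zero₂₁, Matrix.det_one, mul_one, Matrix.det_neg,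
      Basis.det_apply, Fintype.card_fin]
  rw [← hdetN0]
  exact ((Continuous.matrix_det continuous_id).tendsto N0 |>.comp hlimN).congr hdet

/-- The coefficient of `(ξ ∧ η) ⊗ (P_V η ∧ ω)^*` in a frame `f₀` of the stabilized kernel, in terms
of the determinants of a family of frames tending to `f₀`. -/
lemma exists_coeff_tendsto_det [FiniteDimensional ℝ V] {S : W →L[ℝ] H} {K : V →L[ℝ] H}
    (hK : Function.Surjective (stab S K)) {k q n : ℕ}
    {ξ : Fin k → S.ker} {η : Fin q → (stab S K).ker} {ω : Fin k → V}
    (had : IsAdapted S K ξ η ω) (e : Basis (Fin n) ℝ V)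
    {α : Dual ℝ (DetLine (Coker S))} {β : Dual ℝ (DetLine V)}
    (hα : α (wedge (stabCoker S K ∘ ω)) = 1)
    (hβ : β (wedge (Fin.append (kerProj S K ∘ η) ω)) = 1)
    {f₀ : Fin n → (stab S K).ker} (hf₀ : IsBasis f₀) :
    ∃ c : ℝ, c ≠ 0 ∧
      wedge (Fin.append (kerIncl S K ∘ ξ) η) ⊗ₜ[ℝ] β = c • (wedge f₀ ⊗ₜ[ℝ] detForm e) ∧
      ∀ (l : Filter ℝ) (Sσ : ℝ → W →L[ℝ] H) (J : W →L[ℝ] H),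
        Tendsto (fun σ => σ⁻¹ • (Sσ σ - S)) l (𝓝 J) →
        ∀ f : ℝ → Fin n → W × V, (∀ᶠ σ in l, ∀ i, Sσ σ (f σ i).1 + K (f σ i).2 = 0) →
          (∀ i, Tendsto (fun σ => f σ i) l (𝓝 (f₀ i : W × V))) →
          Tendsto (fun σ => c * (e.det (fun i => (f σ i).2) / σ ^ k)) l
            (𝓝 ((-1) ^ (k * q + k) * α (wedge fun i => projCoker S (J (ξ i))))) := by
  have hbas := isBasis_append_kerIncl hK had
  obtain rfl : k + q = n := by
    have h1 := hbas.finrank_eq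
    have h2 := hf₀.finrank_eq
    omega
  set bf := hf₀.basis with hbf
  -- Change of frame from `f₀` to `(ξ, η)`.
  set A := bf.toMatrix (Fin.append (kerIncl S K ∘ ξ) η) with hA
  have hdetA : A.det ≠ 0 := by
    have h1 := bf.isUnit_det hbas.basis
    rw [IsBasis.coe_basis, Basis.det_apply] at h1
    exact h1.ne_zero
  set v0 : Fin (k + q) → V := Fin.append (kerProj S K ∘ η) ω ∘ Fin.cast (Nat.add_comm k q) with hv0
  have hβe : β (wedge e) * e.det v0 = 1 := by
    rw [← hβ, ← wedge_comp_cast (Nat.add_comm k q)]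
    conv_rhs => rw [wedge_eq_det_smul e]
    rw [map_smul, smul_eq_mul, mul_comm]
  have hw0 : IsBasis (Fin.append ω (kerProj S K ∘ η)) := by
    have h1 : IsUnit (e.det (Fin.append ω (kerProj S K ∘ η))) := by
      rw [map_append_swap]
      refine IsUnit.mk0 _ ?_
      rw [smul_eq_mul]
      refine mul_ne_zero (pow_ne_zero _ (by norm_num)) ?_
      exact right_ne_zero_of_mul_eq_one hβe
    obtain ⟨h2, h3⟩ := (e.is_basis_iff_det).2 h1
    exact ⟨h2, h3⟩
  -- The first factor rewrites `ξ ∧ η` in the frame `f₀`, the second rewrites `β` in terms of the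
  -- coordinate functional of `e`.
  refine ⟨A.det * β (wedge e), mul_ne_zero hdetA (left_ne_zero_of_mul_eq_one hβe), ?_, ?_⟩
  · rw [wedge_eq_det_smul bf, dual_eq_smul_detForm e β, TensorProduct.smul_tmul_smul,
      Basis.det_apply]
    simp [hbf, hA, detForm_wedge, e.det_self]
  · intro l Sσ J hJ f hf hlim
    -- Applying the constant matrix `A` to the frames gives frames of the same kernels that tend to
    -- the adapted frame `(ξ, η)`.
    set g : ℝ → Fin (k + q) → W × V := fun σ j => ∑ i, A i j • f σ i with hg
    have hgdet : ∀ σ, e.det (fun i => (g σ i).2) = e.det (fun i => (f σ i).2) * A.det := by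
      intro σ
      rw [Basis.det_apply, Basis.det_apply, ← Matrix.det_mul]
      congr 1
      ext i j
      simp only [hg, Basis.toMatrix_apply, Matrix.mul_apply, Prod.snd_sum, Prod.smul_snd, map_sum,
        map_smul, Finsupp.coe_finsetSum, Finset.sum_apply, Finsupp.smul_apply, smul_eq_mul]
      exact Finset.sum_congr rfl fun _ _ => mul_comm _ _
    have h1 : ∀ᶠ σ in l, ∀ i, Sσ σ (g σ i).1 + K (g σ i).2 = 0 := by
      filter_upwards [hf] with σ hσ i
      simp only [hg, Prod.fst_sum, Prod.snd_sum, Prod.smul_fst, Prod.smul_snd, map_sum, map_smul,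
        ← Finset.sum_add_distrib, ← smul_add, hσ, smul_zero, Finset.sum_const_zero]
    have h2 : ∀ i, Tendsto (fun σ => g σ i) l
        (𝓝 ((Fin.append (kerIncl S K ∘ ξ) η i : (stab S K).ker) : W × V)) := by
      intro j
      have h3 : ((Fin.append (kerIncl S K ∘ ξ) η j : (stab S K).ker) : W × V) =
          ∑ i, A i j • (f₀ i : W × V) := by
        have := bf.sum_repr (Fin.append (kerIncl S K ∘ ξ) η j)
        conv_lhs => rw [← this]
        simp [hA, hbf, Basis.toMatrix_apply]
      rw [h3]
      exact tendsto_finsetSum _ fun i _ => (hlim i).const_smul _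
    have h3 := tendsto_det_repr hK had hw0.basis hw0.coe_basis hJ h1 h2
    have hαw : ∀ z : Fin k → Coker S, α (wedge z) = (isBasis_stabCoker hK had).basis.det z := by
      intro z
      rw [wedge_eq_det_smul (isBasis_stabCoker hK had).basis z, map_smul, IsBasis.coe_basis, hα]
      simp
    rw [hαw, pow_add, mul_assoc]
    refine (h3.const_mul ((-1 : ℝ) ^ (k * q))).congr fun σ => ?_
    -- Both sides compute the determinant of `g` with respect to the adapted basis of `V`; the sign
    -- comes from the order of the blocks `ω` and `P_V η`.
    have h4 : A.det * β (wedge e) * e.det (fun i => (f σ i).2) =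
        (-1) ^ (k * q) * hw0.basis.det (fun i => (g σ i).2) := by
      have h5 := alternatingMap_eq_det_smul hw0.basis e.det (fun i => (g σ i).2)
      rw [hgdet, IsBasis.coe_basis, map_append_swap, ← hv0, smul_eq_mul, smul_eq_mul] at h5
      calc A.det * β (wedge e) * e.det (fun i => (f σ i).2)
          = β (wedge e) * (e.det (fun i => (f σ i).2) * A.det) := by ring
        _ = (-1) ^ (k * q) * hw0.basis.det (fun i => (g σ i).2) * (β (wedge e) * e.det v0) := by
            rw [h5]; ring
        _ = _ := by rw [hβe, mul_one]
    rw [← mul_div_assoc, ← mul_div_assoc, h4]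

end Asymptotics

/-! ### The stabilization isomorphism of a self-adjoint operator -/

section StabIso

open Filter Topology

lemma triangle_add (k n : ℕ) :
    (k + n) * (k + n + 1) / 2 = k * (k + 1) / 2 + n * (n + 1) / 2 + k * n := by
  obtain ⟨a, ha⟩ := Nat.even_mul_succ_self k
  obtain ⟨b, hb⟩ := Nat.even_mul_succ_self n
  obtain ⟨c, hc⟩ := Nat.even_mul_succ_self (k + n)
  rw [ha, hb, hc, ← two_mul, ← two_mul, ← two_mul, Nat.mul_div_cancel_left _ two_pos,
    Nat.mul_div_cancel_left _ two_pos, Nat.mul_div_cancel_left _ two_pos]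
  nlinarith

/-- The sign in `Φ_K` (with `n₀ = k`, `n₁ = k + q`), the sign from the asymptotics and the sign in
`Ψ` multiply to one that depends on `n = k + q` only. This is what allows kernels of varying
dimension to be compared along the path. -/
lemma neg_one_pow_triangle (k q : ℕ) :
    (-1 : ℝ) ^ ((k + (k + q)) * (k + (k + q) + 1) / 2) *
      ((-1) ^ (k * q + k) * (-1) ^ (k * (k + 1) / 2)) =
    (-1) ^ ((k + q) * (k + q + 1) / 2) := by
  rw [triangle_add k (k + q), ← pow_add, ← pow_add]
  set a := k * (k + 1) / 2
  set b := (k + q) * (k + q + 1) / 2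
  have h : a + b + k * (k + q) + (k * q + k + a) = b + (2 * (a + k * q) + k * (k + 1)) := by ring
  rw [h, pow_add, Even.neg_one_pow ((even_two_mul _).add (Nat.even_mul_succ_self k)), mul_one]

variable {W H V : Type*}
  [NormedAddCommGroup W] [InnerProductSpace ℝ W]
  [NormedAddCommGroup H] [InnerProductSpace ℝ H]
  [NormedAddCommGroup V] [InnerProductSpace ℝ V]

lemma exists_eq_smul_tmul {S : W →L[ℝ] H} {p r : ℕ} (b : Basis (Fin p) ℝ S.ker)
    (c : Basis (Fin r) ℝ (Coker S)) (x : FredholmDet S) :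
    ∃ t : ℝ, x = t • (wedge b ⊗ₜ[ℝ] detForm c) := by
  induction x using TensorProduct.induction_on with
  | zero => exact ⟨0, by simp⟩
  | tmul y β =>
    obtain ⟨s, rfl⟩ := exists_eq_smul_wedge b y
    rw [dual_eq_smul_detForm c β, TensorProduct.smul_tmul_smul]
    exact ⟨_, rfl⟩
  | add x y hx hy =>
    obtain ⟨s, rfl⟩ := hx
    obtain ⟨t, rfl⟩ := hy
    exact ⟨s + t, (add_smul _ _ _).symm⟩

lemma tendsto_inv_smul_add_smul_sub {ι S : W →L[ℝ] H} {l : Filter ℝ} (hl : l ≤ 𝓝[≠] 0) :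
    Tendsto (fun σ : ℝ => σ⁻¹ • ((S + σ • ι) - S)) l (𝓝 ι) := by
  refine Tendsto.congr' ?_ (tendsto_const_nhds (x := ι))
  filter_upwards [hl self_mem_nhdsWithin] with σ hσ
  rw [add_sub_cancel_left, smul_smul, inv_mul_cancel₀ hσ, one_smul]

/-- The image of `S` is orthogonal to `ι (ker S)`. Hence the direction `J = ι` always satisfies the
nondegeneracy condition of `IsSA.exists_tendsto_det`. -/
lemma IsSA.eq_zero_of_mem_range {ι S : W →L[ℝ] H} (hι : Function.Injective ι) (h : IsSA ι S) :
    ∀ x ∈ S.ker, ι x ∈ S.range → x = 0 := by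
  rintro x hx ⟨w, hw⟩
  have h1 := h.symm w x
  rw [show S x = 0 from hx, inner_zero_right, show S w = ι x from hw,
    inner_self_eq_zero] at h1
  exact hι (by rw [h1, map_zero])

variable [CompleteSpace H]

lemma IsSA.Psi_tmul {ι S : W →L[ℝ] H} (hι : Function.Injective ι) (h : IsSA ι S) {p : ℕ}
    (ξ : Fin p → S.ker) (α : Dual ℝ (DetLine (Coker S))) :
    Psi ι S (wedge ξ ⊗ₜ[ℝ] α) = (-1) ^ (finrank ℝ S.ker * (finrank ℝ S.ker + 1) / 2) *
      α (wedge fun i => projCoker S (ι (ξ i))) := by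
  simp only [Psi, LinearMap.smul_apply, TensorProduct.lift.tmul, LinearMap.comp_apply,
    detMap_wedge _ (h.finrank_coker hι).symm, smul_eq_mul, Dual.eval_apply]
  rfl

variable [CompleteSpace W]

/-- The source is spanned by `wedge b ⊗ detForm c`; with `c` the image of `b` under `ker S ≅ coker
S`, this element has value `±1`. -/
lemma IsSA.Psi_bijective {ι S : W →L[ℝ] H} (hι : Function.Injective ι)
    (hc : IsCompactOperator ι) (h : IsSA ι S) : Function.Bijective (Psi ι S) := by
  have hfd := h.finiteDimensional_ker hι hc
  set b := finBasis ℝ S.ker with hb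
  set c : Basis _ ℝ (Coker S) :=
    b.map (LinearEquiv.ofBijective (kerToCoker ι S) (h.kerToCoker_bijective hι)) with hcdef
  have hval : Psi ι S (wedge b ⊗ₜ[ℝ] detForm c) =
      (-1) ^ (finrank ℝ S.ker * (finrank ℝ S.ker + 1) / 2) := by
    rw [h.Psi_tmul hι, detForm_wedge]
    have : (fun i => projCoker S (ι (b i))) = c := by
      funext i; simp [hcdef]; rfl
    rw [this, c.det_self, mul_one]
  have hne : Psi ι S (wedge b ⊗ₜ[ℝ] detForm c) ≠ 0 := by
    rw [hval]; exact pow_ne_zero _ (by norm_num)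
  constructor
  · rw [injective_iff_map_eq_zero]
    intro x hx
    obtain ⟨t, rfl⟩ := exists_eq_smul_tmul b c x
    rw [map_smul, smul_eq_mul, mul_eq_zero] at hx
    simp [hx.resolve_right hne]
  · intro y
    refine ⟨(y / Psi ι S (wedge b ⊗ₜ[ℝ] detForm c)) • (wedge b ⊗ₜ[ℝ] detForm c), ?_⟩
    rw [map_smul, smul_eq_mul, div_mul_cancel₀ _ hne]

/-- The rescaled determinants of a family of frames of the kernels of `(S_σ)_K`, where `S_σ` has
derivative `J` at `σ = 0`, converge; the limit is non-zero if `J` induces an isomorphism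
from the kernel to the cokernel. -/
lemma IsSA.exists_tendsto_det [FiniteDimensional ℝ V] {ι S : W →L[ℝ] H} {K : V →L[ℝ] H}
    (hι : Function.Injective ι) (hc : IsCompactOperator ι) (h : IsSA ι S)
    (hK : Function.Surjective (stab S K)) {n : ℕ} (e : Basis (Fin n) ℝ V)
    {f₀ : Fin n → (stab S K).ker} (hf₀ : IsBasis f₀)
    {l : Filter ℝ} {Sσ : ℝ → W →L[ℝ] H} {J : W →L[ℝ] H}
    (hJ : Tendsto (fun σ => σ⁻¹ • (Sσ σ - S)) l (𝓝 J))
    (hJinj : ∀ x ∈ S.ker, J x ∈ S.range → x = 0)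
    {f : ℝ → Fin n → W × V} (hf : ∀ᶠ σ in l, ∀ i, Sσ σ (f σ i).1 + K (f σ i).2 = 0)
    (hlim : ∀ i, Tendsto (fun σ => f σ i) l (𝓝 (f₀ i : W × V))) :
    ∃ d : ℝ, d ≠ 0 ∧
      Tendsto (fun σ => e.det (fun i => (f σ i).2) / σ ^ finrank ℝ S.ker) l (𝓝 d) := by
  have hfd := h.finiteDimensional_ker hι hc
  have hcl := h.isClosed_range hι hc
  obtain ⟨p, q, r, ξ, η, ω, had⟩ := exists_isAdapted hfd hcl hK
  have hp := had.basis_ker.finrank_eq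
  obtain rfl : r = p := by rw [had.card_coker, h.finrank_coker hι, hp]
  rw [hp]
  set bC := (isBasis_stabCoker hK had).basis with hbC
  set bV := had.basis_V.basis with hbV
  obtain ⟨c, hc0, -, hlimc⟩ := exists_coeff_tendsto_det hK had e (α := detForm bC)
    (β := detForm bV)
    (by rw [detForm_wedge]; simpa [hbC] using bC.det_self)
    (by rw [detForm_wedge]; simpa [hbV] using bV.det_self) hf₀
  have h1 := hlimc l Sσ J hJ f hf hlim
  have h2 := h1.const_mul c⁻¹
  refine ⟨_, ?_, h2.congr fun σ => by rw [← mul_assoc, inv_mul_cancel₀ hc0, one_mul]⟩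
  refine mul_ne_zero (inv_ne_zero hc0) (mul_ne_zero (pow_ne_zero _ (by norm_num)) ?_)
  rw [detForm_wedge]
  have : CompleteSpace S.range := hcl.completeSpace_coe
  -- A relation between the classes of the `J ξ` in the cokernel is an element of `ker S` that `J`
  -- sends into the closed image of `S`.
  have hinj : LinearIndependent ℝ fun i => projCoker S (J (ξ i)) := by
    rw [Fintype.linearIndependent_iff]
    intro g hg
    have h3 : projCoker S (J (∑ i, g i • ξ i : S.ker)) = 0 := by
      rw [← hg]; simp
    have h4 : J (∑ i, g i • ξ i : S.ker) ∈ (Coker S)ᗮ :=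
      Submodule.orthogonalProjectionOnto_eq_zero_iff.1 h3
    rw [Submodule.orthogonal_orthogonal] at h4
    have h5 := hJinj _ (∑ i, g i • ξ i : S.ker).2 h4
    exact Fintype.linearIndependent_iff.1 had.basis_ker.1 g (Subtype.ext h5)
  have hfdC : FiniteDimensional ℝ (Coker S) := Module.Finite.of_basis bC
  have hbas := IsBasis.of_linearIndependent hinj ((h.finrank_coker hι).trans hp) hfdC
  exact ((bC.is_basis_iff_det).1 ⟨hbas.1, hbas.2⟩).ne_zero

/-- `Φ_K` in terms of `Ψ` and of the leading coefficient of the determinants of frames of the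
kernels of `(S + σ)_K`, `σ → 0`. -/
theorem IsSA.stabIso_eq [FiniteDimensional ℝ V] {ι S : W →L[ℝ] H} {K : V →L[ℝ] H}
    (hι : Function.Injective ι) (hc : IsCompactOperator ι) (h : IsSA ι S)
    (hK : Function.Surjective (stab S K)) {n : ℕ} (e : Basis (Fin n) ℝ V)
    {f₀ : Fin n → (stab S K).ker} (hf₀ : IsBasis f₀)
    {l : Filter ℝ} [l.NeBot] (hl : l ≤ 𝓝[≠] 0)
    {f : ℝ → Fin n → W × V} (hf : ∀ᶠ σ in l, ∀ i, (S + σ • ι) (f σ i).1 + K (f σ i).2 = 0)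
    (hlim : ∀ i, Tendsto (fun σ => f σ i) l (𝓝 (f₀ i : W × V))) {d : ℝ} (hd0 : d ≠ 0)
    (hd : Tendsto (fun σ => e.det (fun i => (f σ i).2) / σ ^ finrank ℝ S.ker) l (𝓝 d))
    (x : FredholmDet S) :
    stabIso S K x = ((-1) ^ (n * (n + 1) / 2) * Psi ι S x / d) • (wedge f₀ ⊗ₜ[ℝ] detForm e) := by
  have hfd := h.finiteDimensional_ker hι hc
  have hcl := h.isClosed_range hι hc
  have hJ := tendsto_inv_smul_add_smul_sub (ι := ι) (S := S) hl
  -- The asserted formula defines a linear map; it is checked to have the defining property of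
  -- `Φ_K`, so existence and value of `Φ_K` are obtained together.
  set Φ : FredholmDet S →ₗ[ℝ] DetLine (stab S K).ker ⊗[ℝ] Dual ℝ (DetLine V) :=
    ((-1) ^ (n * (n + 1) / 2) / d) • (LinearMap.toSpanSingleton ℝ _
      (wedge f₀ ⊗ₜ[ℝ] detForm e)) ∘ₗ Psi ι S with hΦ
  have hΦx : ∀ x, Φ x =
      ((-1) ^ (n * (n + 1) / 2) * Psi ι S x / d) • (wedge f₀ ⊗ₜ[ℝ] detForm e) := by
    intro x
    simp only [hΦ, LinearMap.smul_apply, LinearMap.comp_apply, LinearMap.toSpanSingleton_apply,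
      smul_smul]
    congr 1
    ring
  have hiso : IsStabIso S K Φ := by
    intro p q r ξ η ω had α β hα hβ
    have hr := had.card_coker
    have hp := had.basis_ker.finrank_eq
    have hcok := h.finrank_coker hι
    have hV := had.basis_V.finrank_eq
    have hn : finrank ℝ V = n := by simpa using finrank_eq_card_basis e
    obtain rfl : r = p := by omega
    obtain ⟨c, hc0, hceq, hlimc⟩ := exists_coeff_tendsto_det hK had e hα hβ hf₀
    have h1 := hlimc l _ ι hJ f hf hlim
    -- The limit defining `d` and the limit in terms of the adapted basis are taken along the same
    -- nontrivial filter, so they agree.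
    have h2 : c * d = (-1) ^ (r * q + r) * α (wedge fun i => projCoker S (ι (ξ i))) := by
      refine tendsto_nhds_unique ?_ h1
      rw [hp] at hd
      exact hd.const_mul c
    rw [hΦx, hceq, smul_smul, h.Psi_tmul hι]
    congr 1
    generalize α (wedge fun i => projCoker S (ι (ξ i))) = a at h2 ⊢
    rw [hcok, hp, hn]
    rw [div_eq_iff hd0, mul_assoc, h2]
    obtain rfl : n = r + q := by omega
    rw [← neg_one_pow_triangle r q]
    have hsq : ((-1 : ℝ) ^ (r * (r + 1) / 2)) * (-1) ^ (r * (r + 1) / 2) = 1 := by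
      rw [← mul_pow]; norm_num
    linear_combination ((-1 : ℝ) ^ ((r + (r + q)) * (r + (r + q) + 1) / 2) * (-1) ^ (r * q + r) *
      a) * hsq
  have hex : ∃ Φ, IsStabIso S K Φ := ⟨Φ, hiso⟩
  have hspec : IsStabIso S K (stabIso S K) := by
    rw [stabIso, dif_pos hex]; exact hex.choose_spec
  -- Uniqueness: `stabIso` is only some map with the defining property, but this property fixes the
  -- value on a generator of the line.
  obtain ⟨p, q, r, ξ, η, ω, had⟩ := exists_isAdapted hfd hcl hK
  set bC := (isBasis_stabCoker hK had).basis with hbC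
  set bV := had.basis_V.basis with hbV
  have hα : detForm bC (wedge (stabCoker S K ∘ ω)) = 1 := by
    rw [detForm_wedge]; simpa [hbC] using bC.det_self
  have hβ : detForm bV (wedge (Fin.append (kerProj S K ∘ η) ω)) = 1 := by
    rw [detForm_wedge]; simpa [hbV] using bV.det_self
  have heq := (hspec _ _ _ ξ η ω had _ _ hα hβ).trans (hiso _ _ _ ξ η ω had _ _ hα hβ).symm
  obtain ⟨t, rfl⟩ := exists_eq_smul_tmul had.basis_ker.basis bC x
  rw [← hΦx, map_smul, map_smul, IsBasis.coe_basis, heq]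

end StabIso

/-! ### Continuous frames of stabilized kernels -/

section Coefficients

open Filter Topology

/-- The coefficients of a continuous family of vectors with respect to a continuous frame are
continuous. -/
lemma continuousWithinAt_coeff {X E : Type*} [TopologicalSpace X] [NormedAddCommGroup E]
    [NormedSpace ℝ E] {n : ℕ} {s : Set X} {x₀ : X} (hx₀ : x₀ ∈ s) {f : X → Fin n → E}
    (hf : ∀ i, ContinuousWithinAt (fun x => f x i) s x₀) (hli : LinearIndependent ℝ (f x₀))
    {u : X → E} (hu : ContinuousWithinAt u s x₀) {a : X → Fin n → ℝ}
    (ha : ∀ x ∈ s, u x = ∑ i, a x i • f x i) (i : Fin n) :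
    ContinuousWithinAt (fun x => a x i) s x₀ := by
  set Λ : (Fin n → ℝ) →L[ℝ] E := (Fintype.linearCombination ℝ (f x₀)).toContinuousLinearMap with hΛ
  have hinj : Function.Injective Λ := by
    rw [injective_iff_map_eq_zero]
    intro c hc
    exact funext (Fintype.linearIndependent_iff.1 hli c hc)
  -- A continuous left inverse of the coefficient map at `x₀`. Applying it turns the equations into
  -- an `n × n` system whose matrix is the identity at `x₀`.
  obtain ⟨L, hL⟩ : ∃ L : E →L[ℝ] (Fin n → ℝ), ∀ c, L (Λ c) = c := by
    obtain ⟨p, hp⟩ := Submodule.ClosedComplemented.of_finiteDimensional Λ.range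
    let eq := LinearEquiv.ofInjective Λ.toLinearMap hinj
    refine ⟨(LinearMap.toContinuousLinearMap eq.symm.toLinearMap).comp p, fun c => ?_⟩
    have h1 : p (Λ c) = eq c := hp (eq c)
    simp [h1]
  have hL0 : ∀ j, L (f x₀ j) = Pi.single j 1 := by
    intro j
    have := hL (Pi.single j 1)
    rw [← this]
    congr 1
    simp [hΛ, Fintype.linearCombination_apply_single]
  set G : X → Matrix (Fin n) (Fin n) ℝ := fun x => Matrix.of fun i j => L (f x j) i with hG
  have hG0 : G x₀ = 1 := by
    ext i j
    simp [hG, hL0, Pi.single_apply, Matrix.one_apply]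
  have hGc : ContinuousWithinAt G s x₀ := by
    refine continuousWithinAt_pi.2 fun i => continuousWithinAt_pi.2 fun j => ?_
    exact ((continuous_apply i).comp L.continuous).continuousAt.comp_continuousWithinAt (hf j)
  have hdet : ContinuousWithinAt (fun x => (G x).det) s x₀ :=
    (Continuous.matrix_det continuous_id).continuousAt.comp_continuousWithinAt hGc
  have hdet0 : (G x₀).det ≠ 0 := by simp [hG0]
  have hev : ∀ᶠ x in 𝓝[s] x₀, (G x).det ≠ 0 := hdet.eventually_ne hdet0
  have hsol : ∀ x ∈ s, L (u x) = (G x).mulVec (a x) := by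
    intro x hx
    rw [ha x hx]
    ext i
    simp [hG, Matrix.mulVec, dotProduct, mul_comm]
  -- Cramer's rule expresses the coefficients by continuous functions near `x₀`.
  have hform : ∀ᶠ x in 𝓝[s] x₀, ((G x).det)⁻¹ * ((G x).adjugate.mulVec (L (u x))) i = a x i := by
    filter_upwards [hev, self_mem_nhdsWithin] with x hx hxs
    rw [hsol x hxs, Matrix.mulVec_mulVec, Matrix.adjugate_mul, Matrix.smul_mulVec,
      Matrix.one_mulVec, Pi.smul_apply, smul_eq_mul, ← mul_assoc, inv_mul_cancel₀ hx, one_mul]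
  clear_value G
  have hadj : ContinuousWithinAt (fun x => (G x).adjugate) s x₀ :=
    (Continuous.matrix_adjugate continuous_id).continuousAt.comp_continuousWithinAt hGc
  have hLu : ContinuousWithinAt (fun x => L (u x)) s x₀ :=
    L.continuous.continuousAt.comp_continuousWithinAt hu
  have hmv : ContinuousWithinAt (fun x => ((G x).adjugate.mulVec (L (u x))) i) s x₀ := by
    have hc : Continuous fun p : Matrix (Fin n) (Fin n) ℝ × (Fin n → ℝ) => (p.1.mulVec p.2) i :=
      (continuous_apply i).comp (Continuous.matrix_mulVec continuous_fst continuous_snd)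
    exact ContinuousAt.comp_continuousWithinAt
      (g := fun p : Matrix (Fin n) (Fin n) ℝ × (Fin n → ℝ) => (p.1.mulVec p.2) i)
      (f := fun x => ((G x).adjugate, L (u x))) hc.continuousAt (hadj.prodMk hLu)
  have hfin : ContinuousWithinAt
      (fun x => ((G x).det)⁻¹ * ((G x).adjugate.mulVec (L (u x))) i) s x₀ :=
    (hdet.inv₀ hdet0).mul hmv
  exact hfin.congr_of_eventuallyEq (hform.mono fun x hx => hx.symm)
    (hform.self_of_nhdsWithin hx₀).symm

/-- If `P z = z` and `Q z = 0`, then `‖(Q - P) z‖ = ‖z‖`, which forces `z = 0`. So projecting to a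
nearby subspace preserves independence. -/
lemma linearIndependent_of_norm_sub_lt {E : Type*} [NormedAddCommGroup E] [NormedSpace ℝ E]
    {n : ℕ} {P Q : E →L[ℝ] E} (hPQ : ‖Q - P‖ < 1) {v : Fin n → E} (hv : LinearIndependent ℝ v)
    (hP : ∀ i, P (v i) = v i) : LinearIndependent ℝ (fun i => Q (v i)) := by
  rw [Fintype.linearIndependent_iff] at hv ⊢
  intro g hg
  refine hv g ?_
  set z := ∑ i, g i • v i with hz
  have h1 : P z = z := by simp [hz, hP]
  have h2 : Q z = 0 := by rw [← hg]; simp [hz]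
  by_contra hne
  have h3 : ‖(Q - P) z‖ = ‖z‖ := by rw [sub_apply, h1, h2, zero_sub, norm_neg]
  have h4 := (Q - P).le_opNorm z
  have : 0 < ‖z‖ := norm_pos_iff.2 hne
  nlinarith

end Coefficients

/-! ### Right inverses and kernel projections depending continuously on the operators. -/

section Projections

open Filter Topology

variable {W H V V' : Type*}
  [NormedAddCommGroup W] [InnerProductSpace ℝ W]
  [NormedAddCommGroup H] [InnerProductSpace ℝ H]
  [NormedAddCommGroup V] [InnerProductSpace ℝ V]
  [NormedAddCommGroup V'] [InnerProductSpace ℝ V']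

lemma continuous_stab : Continuous fun p : (W →L[ℝ] H) × (V →L[ℝ] H) => stab p.1 p.2 := by
  have h : (fun p : (W →L[ℝ] H) × (V →L[ℝ] H) => stab p.1 p.2) = fun p =>
      p.1.comp (ContinuousLinearMap.fst ℝ W V) + p.2.comp (ContinuousLinearMap.snd ℝ W V) := by
    funext p
    ext x <;> simp
  rw [h]
  fun_prop

variable [CompleteSpace W] [CompleteSpace H] [CompleteSpace V] [CompleteSpace V']

/-- The operator `S S^* + K K^*`, which is invertible if and only if `S_K` is surjective. -/
def gram (S : W →L[ℝ] H) (K : V →L[ℝ] H) : H →L[ℝ] H :=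
  S.comp (ContinuousLinearMap.adjoint S) + K.comp (ContinuousLinearMap.adjoint K)

/-- An inverse of the gram operator yields preimages under `S_K`. Conversely, preimages of
controlled norm bound `‖y‖` by the norms of `S^* y` and `K^* y`, so the gram operator is coercive.
Surjectivity thus becomes the open condition of being a unit. -/
lemma isUnit_gram_iff {S : W →L[ℝ] H} {K : V →L[ℝ] H} :
    IsUnit (gram S K) ↔ Function.Surjective (stab S K) := by
  constructor
  · rintro ⟨g, hg⟩ y
    have h1 : gram S K (g⁻¹.1 y) = y := by
      rw [← hg, ← mul_apply_eq_comp, Units.mul_inv]; rfl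
    refine ⟨(ContinuousLinearMap.adjoint S (g⁻¹.1 y), ContinuousLinearMap.adjoint K (g⁻¹.1 y)), ?_⟩
    conv_rhs => rw [← h1]
    simp [gram]
  · intro hK
    obtain ⟨C, hC, hpre⟩ := (stab S K).exists_preimage_norm_le hK
    have hbound : ∀ y : H, ‖y‖ ≤
        C * (‖ContinuousLinearMap.adjoint S y‖ + ‖ContinuousLinearMap.adjoint K y‖) := by
      intro y
      rcases eq_or_ne y 0 with rfl | hy
      · simp
      obtain ⟨⟨w, v⟩, hwv, hn⟩ := hpre y
      have h1 : S w + K v = y := by simpa using hwv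
      have h2 : ‖y‖ ^ 2 = inner ℝ w (ContinuousLinearMap.adjoint S y) +
          inner ℝ v (ContinuousLinearMap.adjoint K y) := by
        rw [ContinuousLinearMap.adjoint_inner_right, ContinuousLinearMap.adjoint_inner_right,
          ← inner_add_left, h1, real_inner_self_eq_norm_sq]
      have h3 := real_inner_le_norm w (ContinuousLinearMap.adjoint S y)
      have h4 := real_inner_le_norm v (ContinuousLinearMap.adjoint K y)
      have h5 : ‖w‖ ≤ C * ‖y‖ := (le_max_left _ _).trans hn
      have h6 : ‖v‖ ≤ C * ‖y‖ := (le_max_right _ _).trans hn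
      have hy0 : 0 < ‖y‖ := norm_pos_iff.2 hy
      have h7 : ‖w‖ * ‖ContinuousLinearMap.adjoint S y‖ ≤
          C * ‖y‖ * ‖ContinuousLinearMap.adjoint S y‖ := by gcongr
      have h8 : ‖v‖ * ‖ContinuousLinearMap.adjoint K y‖ ≤
          C * ‖y‖ * ‖ContinuousLinearMap.adjoint K y‖ := by gcongr
      refine le_of_mul_le_mul_left ?_ hy0
      nlinarith
    -- The constant combines `‖y‖ ≤ C (a + b)` with `(a + b)² ≤ 2 (a² + b²)`.
    have hc : (0 : ℝ) < (2 * C ^ 2)⁻¹ := by positivity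
    refine ContinuousLinearMap.isUnit_of_forall_le_norm_inner_map (gram S K)
      (c := ⟨(2 * C ^ 2)⁻¹, hc.le⟩) hc fun y => ?_
    have h1 : inner ℝ (gram S K y) y = ‖ContinuousLinearMap.adjoint S y‖ ^ 2 +
        ‖ContinuousLinearMap.adjoint K y‖ ^ 2 := by
      simp only [gram, add_apply, ContinuousLinearMap.comp_apply, inner_add_left]
      rw [← ContinuousLinearMap.adjoint_inner_right S, ← ContinuousLinearMap.adjoint_inner_right K,
        real_inner_self_eq_norm_sq, real_inner_self_eq_norm_sq]
    rw [h1, Real.norm_of_nonneg (by positivity)]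
    have h2 := hbound y
    set a := ‖ContinuousLinearMap.adjoint S y‖
    set b := ‖ContinuousLinearMap.adjoint K y‖
    have h3 : ‖y‖ ^ 2 ≤ (C * (a + b)) ^ 2 := by gcongr
    have h4 : ‖y‖ ^ 2 ≤ 2 * C ^ 2 * (a ^ 2 + b ^ 2) := by
      nlinarith [mul_nonneg (sq_nonneg C) (sq_nonneg (a - b))]
    change ‖y‖ ^ 2 * (2 * C ^ 2)⁻¹ ≤ a ^ 2 + b ^ 2
    rw [← div_eq_mul_inv, div_le_iff₀ (by positivity)]
    linarith

/-- A right inverse of `S_K`, if `S_K` is surjective. -/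
def rinv (S : W →L[ℝ] H) (K : V →L[ℝ] H) : H →L[ℝ] W × V :=
  ((ContinuousLinearMap.adjoint S).prod (ContinuousLinearMap.adjoint K)).comp
    (Ring.inverse (gram S K))

lemma stab_rinv {S : W →L[ℝ] H} {K : V →L[ℝ] H} (hK : Function.Surjective (stab S K)) (y : H) :
    stab S K (rinv S K y) = y := by
  have h1 := Ring.mul_inverse_cancel _ (isUnit_gram_iff.2 hK)
  have h2 := congrArg (fun A : H →L[ℝ] H => A y) h1
  simpa [gram, rinv] using h2

lemma continuous_gram : Continuous fun p : (W →L[ℝ] H) × (V →L[ℝ] H) => gram p.1 p.2 := by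
  have h1 : Continuous fun p : (W →L[ℝ] H) × (V →L[ℝ] H) => ContinuousLinearMap.adjoint p.1 :=
    (ContinuousLinearMap.adjoint (𝕜 := ℝ) (E := W) (F := H)).continuous.comp continuous_fst
  have h2 : Continuous fun p : (W →L[ℝ] H) × (V →L[ℝ] H) => ContinuousLinearMap.adjoint p.2 :=
    (ContinuousLinearMap.adjoint (𝕜 := ℝ) (E := V) (F := H)).continuous.comp continuous_snd
  exact (continuous_fst.clm_comp h1).add (continuous_snd.clm_comp h2)

lemma continuousAt_rinv {S : W →L[ℝ] H} {K : V →L[ℝ] H} (hK : Function.Surjective (stab S K)) :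
    ContinuousAt (fun p : (W →L[ℝ] H) × (V →L[ℝ] H) => rinv p.1 p.2) (S, K) := by
  have h1 : Continuous fun p : (W →L[ℝ] H) × (V →L[ℝ] H) => ContinuousLinearMap.adjoint p.1 :=
    (ContinuousLinearMap.adjoint (𝕜 := ℝ) (E := W) (F := H)).continuous.comp continuous_fst
  have h2 : Continuous fun p : (W →L[ℝ] H) × (V →L[ℝ] H) => ContinuousLinearMap.adjoint p.2 :=
    (ContinuousLinearMap.adjoint (𝕜 := ℝ) (E := V) (F := H)).continuous.comp continuous_snd
  obtain ⟨g, hg⟩ := isUnit_gram_iff.2 hK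
  have h3 : ContinuousAt (fun p : (W →L[ℝ] H) × (V →L[ℝ] H) => Ring.inverse (gram p.1 p.2))
      (S, K) := by
    refine ContinuousAt.comp (g := Ring.inverse) ?_ continuous_gram.continuousAt
    change ContinuousAt Ring.inverse (gram S K)
    rw [← hg]
    exact NormedRing.inverse_continuousAt g
  have h4 : Continuous fun p : (W →L[ℝ] H) × (V →L[ℝ] H) =>
      (ContinuousLinearMap.adjoint p.1).prod (ContinuousLinearMap.adjoint p.2) := by
    have : (fun p : (W →L[ℝ] H) × (V →L[ℝ] H) =>
      (ContinuousLinearMap.adjoint p.1).prod (ContinuousLinearMap.adjoint p.2)) = fun p =>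
        (ContinuousLinearMap.inl ℝ W V).comp (ContinuousLinearMap.adjoint p.1) +
        (ContinuousLinearMap.inr ℝ W V).comp (ContinuousLinearMap.adjoint p.2) := by
      funext p
      ext x <;> simp
    rw [this]
    exact (continuous_const.clm_comp h1).add (continuous_const.clm_comp h2)
  exact h4.continuousAt.clm_comp h3

/-- A projection onto the kernel of `S_K`, if `S_K` is surjective. -/
def kproj (S : W →L[ℝ] H) (K : V →L[ℝ] H) : W × V →L[ℝ] W × V :=
  ContinuousLinearMap.id ℝ (W × V) - (rinv S K).comp (stab S K)

lemma continuousAt_kproj {S : W →L[ℝ] H} {K : V →L[ℝ] H} (hK : Function.Surjective (stab S K)) :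
    ContinuousAt (fun p : (W →L[ℝ] H) × (V →L[ℝ] H) => kproj p.1 p.2) (S, K) :=
  continuousAt_const.sub ((continuousAt_rinv hK).clm_comp continuous_stab.continuousAt)

lemma kproj_mem {S : W →L[ℝ] H} {K : V →L[ℝ] H} (hK : Function.Surjective (stab S K))
    (x : W × V) : kproj S K x ∈ (stab S K).ker := by
  change stab S K (kproj S K x) = 0
  rw [kproj, sub_apply, map_sub, ContinuousLinearMap.comp_apply, stab_rinv hK]
  simp

lemma kproj_eq_self {S : W →L[ℝ] H} {K : V →L[ℝ] H} {x : W × V} (hx : x ∈ (stab S K).ker) :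
    kproj S K x = x := by
  have : stab S K x = 0 := hx
  rw [kproj, sub_apply, ContinuousLinearMap.comp_apply, this]
  simp

/-- The determinants of continuous frames of the stabilized kernels for two stabilizers differ
by a continuous factor. -/
lemma exists_continuousOn_det_eq_mul [FiniteDimensional ℝ V] [FiniteDimensional ℝ V']
    {X : Type*} [TopologicalSpace X] {s : Set X}
    {S : X → W →L[ℝ] H} {K : X → V →L[ℝ] H} {K' : X → V' →L[ℝ] H}
    (hS : ContinuousOn S s) (hKc : ContinuousOn K s) (hKc' : ContinuousOn K' s)
    (hK : ∀ p ∈ s, Function.Surjective (stab (S p) (K p)))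
    (hK' : ∀ p ∈ s, Function.Surjective (stab (S p) (K' p)))
    {n n' : ℕ} (e : Basis (Fin n) ℝ V) (e' : Basis (Fin n') ℝ V')
    {f : X → Fin n → W × V} (hf : ∀ i, ContinuousOn (fun p => f p i) s)
    (hfk : ∀ p ∈ s, ∀ i, S p (f p i).1 + K p (f p i).2 = 0)
    {f' : X → Fin n' → W × V'} (hf' : ∀ i, ContinuousOn (fun p => f' p i) s)
    (hfk' : ∀ p ∈ s, ∀ i, f' p i ∈ (stab (S p) (K' p)).ker)
    (hli : ∀ p ∈ s, LinearIndependent ℝ (f' p))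
    (hfr : ∀ p ∈ s, finrank ℝ (stab (S p) (K' p)).ker = n')
    (hfd : ∀ p ∈ s, FiniteDimensional ℝ (stab (S p) (K' p)).ker) :
    ∃ q : X → ℝ, ContinuousOn q s ∧ ∀ p ∈ s,
      e.det (fun i => (f p i).2) = e'.det (fun i => (f' p i).2) * q p := by
  -- every element of the kernel is a combination of the frame
  have hspan : ∀ p ∈ s, ∀ z : W × V', S p z.1 + K' p z.2 = 0 →
      ∃ c : Fin n' → ℝ, z = ∑ i, c i • f' p i := by
    intro p hp z hz
    have := hfd p hp
    have hb : IsBasis (fun i => (⟨f' p i, hfk' p hp i⟩ : (stab (S p) (K' p)).ker)) := by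
      refine IsBasis.of_linearIndependent ?_ (hfr p hp) (hfd p hp)
      exact LinearIndependent.of_comp (stab (S p) (K' p)).ker.subtype (hli p hp)
    have hzk : z ∈ (stab (S p) (K' p)).ker := by simpa using hz
    refine ⟨fun i => hb.basis.repr ⟨z, hzk⟩ i, ?_⟩
    have h1 := congrArg (Subtype.val) (hb.basis.sum_repr ⟨z, hzk⟩)
    simpa [eq_comm] using h1
  -- The two stabilizers are compared through `K ⊕ K'`. Its kernel has the frame made of `f` and of
  -- lifts of the `e'_j`, and the frame made of lifts of the `e_i` and of `f'`; `lift'` and `lift`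
  -- supply the missing components of these lifts.
  set lift' : X → Fin n → W × V' := fun p i => rinv (S p) (K' p) (-(K p (e i))) with hlift'
  set lift : X → Fin n' → W × V := fun p j => rinv (S p) (K p) (-(K' p (e' j))) with hlift
  have hl' : ∀ p ∈ s, ∀ i, S p (lift' p i).1 + K' p (lift' p i).2 = -(K p (e i)) := by
    intro p hp i
    exact stab_rinv (hK' p hp) (-(K p (e i)))
  have hl : ∀ p ∈ s, ∀ j, S p (lift p j).1 + K p (lift p j).2 = -(K' p (e' j)) := by
    intro p hp j
    exact stab_rinv (hK p hp) (-(K' p (e' j)))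
  have hl'c : ∀ i, ContinuousOn (fun p => lift' p i) s := by
    intro i p hp
    have h1 : ContinuousWithinAt (fun p => rinv (S p) (K' p)) s p :=
      ContinuousAt.comp_continuousWithinAt
        (g := fun p : (W →L[ℝ] H) × (V' →L[ℝ] H) => rinv p.1 p.2)
        (f := fun p => (S p, K' p)) (continuousAt_rinv (hK' p hp)) ((hS p hp).prodMk (hKc' p hp))
    exact h1.clm_apply (((hKc p hp).clm_apply continuousWithinAt_const).neg)
  have hlc : ∀ j, ContinuousOn (fun p => lift p j) s := by
    intro i p hp
    have h1 : ContinuousWithinAt (fun p => rinv (S p) (K p)) s p :=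
      ContinuousAt.comp_continuousWithinAt
        (g := fun p : (W →L[ℝ] H) × (V →L[ℝ] H) => rinv p.1 p.2)
        (f := fun p => (S p, K p)) (continuousAt_rinv (hK p hp)) ((hS p hp).prodMk (hKc p hp))
    exact h1.clm_apply (((hKc' p hp).clm_apply continuousWithinAt_const).neg)
  have hcoord : ∀ i, Continuous fun v : V => e.repr v i := fun i =>
    LinearMap.continuous_of_finiteDimensional (e.coord i)
  set m : X → Matrix (Fin n) (Fin n) ℝ := fun p => e.toMatrix fun j => (f p j).2 with hm
  set a : X → Matrix (Fin n) (Fin n') ℝ := fun p => Matrix.of fun i j => e.repr (lift p j).2 i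
    with ha
  have hmc : ∀ i j, ContinuousOn (fun p => m p i j) s := fun i j =>
    ((hcoord i).comp continuous_snd).comp_continuousOn (hf j)
  have hac : ∀ i j, ContinuousOn (fun p => a p i j) s := fun i j =>
    ((hcoord i).comp continuous_snd).comp_continuousOn (hlc j)
  -- Subtracting the lifts of the `e_i` with the right coefficients removes the `V`-component and
  -- leaves elements of `ker S_{K'}`, which expand in `f'`.
  set z : X → Fin n → W × V' := fun p j => ((f p j).1, 0) - ∑ i, m p i j • lift' p i with hz
  set y : X → Fin n' → W × V' := fun p j => ((lift p j).1, e' j) - ∑ i, a p i j • lift' p i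
    with hy
  have hzc : ∀ j, ContinuousOn (fun p => z p j) s := by
    intro j
    refine ContinuousOn.sub (((continuous_fst.comp_continuousOn (hf j))).prodMk
      continuousOn_const) (continuousOn_finsetSum _ fun i _ => (hmc i j).smul (hl'c i))
  have hyc : ∀ j, ContinuousOn (fun p => y p j) s := by
    intro j
    refine ContinuousOn.sub (((continuous_fst.comp_continuousOn (hlc j))).prodMk
      continuousOn_const) (continuousOn_finsetSum _ fun i _ => (hac i j).smul (hl'c i))
  have hlin : ∀ p ∈ s, ∀ c : Fin n → ℝ, S p (∑ i, c i • lift' p i).1 +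
      K' p (∑ i, c i • lift' p i).2 = -(K p (∑ i, c i • e i)) := by
    intro p hp c
    simp only [Prod.fst_sum, Prod.snd_sum, Prod.smul_fst, Prod.smul_snd, map_sum, map_smul,
      ← Finset.sum_add_distrib, ← smul_add, hl' p hp, smul_neg, Finset.sum_neg_distrib]
  have hzk : ∀ p ∈ s, ∀ j, S p (z p j).1 + K' p (z p j).2 = 0 := by
    intro p hp j
    have h1 := hlin p hp (fun i => m p i j)
    have h2 : ∑ i, m p i j • e i = (f p j).2 := by
      simp [hm, Basis.toMatrix_apply]
    rw [h2] at h1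
    have h3 := hfk p hp j
    simp only [hz, Prod.fst_sub, Prod.snd_sub, map_sub, map_zero]
    have h4 : ∀ A B C : H, A - B + (0 - C) = A - (B + C) := fun A B C => by abel
    rw [h4, h1, sub_neg_eq_add]
    exact h3
  have hyk : ∀ p ∈ s, ∀ j, S p (y p j).1 + K' p (y p j).2 = 0 := by
    intro p hp j
    have h1 := hlin p hp (fun i => a p i j)
    have h2 : ∑ i, a p i j • e i = (lift p j).2 := by
      simp [ha]
    rw [h2] at h1
    have h3 := hl p hp j
    simp only [hy, Prod.fst_sub, Prod.snd_sub, map_sub]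
    have h4 : ∀ A B C D : H, A - B + (D - C) = A + D - (B + C) := fun A B C D => by abel
    rw [h4, h1, sub_neg_eq_add, add_right_comm, h3, neg_add_cancel]
  have hB : ∀ p, ∃ B : Matrix (Fin n') (Fin n) ℝ, p ∈ s → ∀ j, z p j = ∑ i, B i j • f' p i := by
    intro p
    by_cases hp : p ∈ s
    · choose c hc using fun j => hspan p hp (z p j) (hzk p hp j)
      exact ⟨Matrix.of fun i j => c j i, fun _ j => hc j⟩
    · exact ⟨0, fun h => absurd h hp⟩
  have hb : ∀ p, ∃ b : Matrix (Fin n') (Fin n') ℝ, p ∈ s → ∀ j, y p j = ∑ i, b i j • f' p i := by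
    intro p
    by_cases hp : p ∈ s
    · choose c hc using fun j => hspan p hp (y p j) (hyk p hp j)
      exact ⟨Matrix.of fun i j => c j i, fun _ j => hc j⟩
    · exact ⟨0, fun h => absurd h hp⟩
  choose B hB using hB
  choose b hb using hb
  have hBc : ∀ i j, ContinuousOn (fun p => B p i j) s := fun i j p hp =>
    continuousWithinAt_coeff hp (fun i => hf' i p hp) (hli p hp) (hzc j p hp)
      (a := fun p i => B p i j) (fun x hx => hB x hx j) i
  have hbc : ∀ i j, ContinuousOn (fun p => b p i j) s := fun i j p hp =>
    continuousWithinAt_coeff hp (fun i => hf' i p hp) (hli p hp) (hyc j p hp)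
      (a := fun p i => b p i j) (fun x hx => hb x hx j) i
  -- The factor is the determinant of the change between the two frames. Being polynomial in
  -- continuous coefficients, it is continuous also where both determinants vanish and their
  -- quotient makes no sense.
  refine ⟨fun p => (Matrix.fromBlocks (m p) (a p) (B p) (b p)).det, ?_, ?_⟩
  · refine (Continuous.matrix_det continuous_id).comp_continuousOn ?_
    refine continuousOn_pi.2 fun i => continuousOn_pi.2 fun j => ?_
    rcases i with i | i <;> rcases j with j | j
    · exact hmc i j
    · exact hac i j
    · exact hBc i j
    · exact hbc i j
  · intro p hp
    set U : Matrix (Fin n') (Fin n) ℝ := e'.toMatrix fun i => (lift' p i).2 with hU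
    set m' : Matrix (Fin n') (Fin n') ℝ := e'.toMatrix fun j => (f' p j).2 with hm'
    -- This is the comparison of `V'`-components of the expansions of `z` and `y`; its determinants
    -- give the claim.
    have hprod : Matrix.fromBlocks (m p) (a p) 0 (1 : Matrix (Fin n') (Fin n') ℝ) =
        Matrix.fromBlocks 1 0 U m' * Matrix.fromBlocks (m p) (a p) (B p) (b p) := by
      rw [Matrix.fromBlocks_multiply]
      have h1 : U * m p + m' * B p = 0 := by
        ext l j
        have := congrArg (fun x : W × V' => e'.repr x.2 l) (hB p hp j)
        simp only [hz, Prod.snd_sub, Prod.snd_sum, Prod.smul_snd, map_sub, map_sum, map_smul,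
          map_zero, Finsupp.coe_sub, Finsupp.coe_zero, Pi.sub_apply, Pi.zero_apply,
          Finsupp.coe_finsetSum, Finset.sum_apply, Finsupp.smul_apply, smul_eq_mul] at this
        simp only [Matrix.add_apply, Matrix.mul_apply, hU, hm', Basis.toMatrix_apply,
          Matrix.zero_apply]
        simp only [mul_comm (e'.repr _ l)]
        linarith
      have h2 : U * a p + m' * b p = 1 := by
        ext l j
        have := congrArg (fun x : W × V' => e'.repr x.2 l) (hb p hp j)
        simp only [hy, Prod.snd_sub, Prod.snd_sum, Prod.smul_snd, map_sub, map_sum, map_smul,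
          Finsupp.coe_sub, Pi.sub_apply, Basis.repr_self, Finsupp.single_apply,
          Finsupp.coe_finsetSum, Finset.sum_apply, Finsupp.smul_apply, smul_eq_mul] at this
        simp only [Matrix.add_apply, Matrix.mul_apply, hU, hm', Basis.toMatrix_apply,
          Matrix.one_apply]
        simp only [mul_comm (e'.repr _ l), eq_comm (a := l)]
        linarith
      simp [h1, h2]
    have hdet := congrArg Matrix.det hprod
    rw [Matrix.det_mul, Matrix.det_fromBlocks_zero₂₁, Matrix.det_fromBlocks_zero₁₂,
      Matrix.det_one, Matrix.det_one, mul_one, one_mul] at hdet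
    rw [Basis.det_apply, Basis.det_apply]
    exact hdet

end Projections

/-! ### Global stabilizers and frames -/

section Global

open Filter Topology

variable {W H V : Type*}
  [NormedAddCommGroup W] [InnerProductSpace ℝ W] [CompleteSpace W]
  [NormedAddCommGroup H] [InnerProductSpace ℝ H] [CompleteSpace H]
  [NormedAddCommGroup V] [InnerProductSpace ℝ V]

/-- A compact family of self-adjoint operators has a constant stabilizer. -/
lemma exists_stabilizer {ι : W →L[ℝ] H} (hι : Function.Injective ι) (hc : IsCompactOperator ι)
    {X : Type*} [TopologicalSpace X] [CompactSpace X] {S : X → W →L[ℝ] H} (hS : Continuous S)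
    (hsa : ∀ x, IsSA ι (S x)) :
    ∃ (n : ℕ) (K : EuclideanSpace ℝ (Fin n) →L[ℝ] H),
      ∀ x, Function.Surjective (stab (S x) K) := by
  have hfd : ∀ x, FiniteDimensional ℝ (kerH ι (S x)) := fun x => by
    have := (hsa x).finiteDimensional_ker hι hc
    infer_instance
  have hcomp : ∀ x, CompleteSpace (kerH ι (S x)) := fun x => FiniteDimensional.complete ℝ _
  -- The kernel at `x`, included in `H`, stabilizes the operator at `x` and therefore the
  -- neighbouring ones. The sum of finitely many such kernels stabilizes all of them.
  have hopen : ∀ x ∈ (Set.univ : Set X),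
      {y | IsUnit (gram (S y) (kerH ι (S x)).subtypeL)} ∈ 𝓝 x := by
    intro x _
    have hcont : Continuous fun y => gram (S y) (kerH ι (S x)).subtypeL :=
      continuous_gram.comp (hS.prodMk continuous_const)
    refine (Units.isOpen.preimage hcont).mem_nhds ?_
    change IsUnit _
    rw [isUnit_gram_iff]
    intro y
    obtain ⟨w, z, hz, hwz⟩ := (hsa x).exists_add_eq hι hc y
    exact ⟨(w, ⟨z, hz⟩), by simpa using hwz⟩
  obtain ⟨t, -, ht⟩ := isCompact_univ.elim_nhds_subcover _ hopen
  set N : Submodule ℝ H := t.sup fun x => kerH ι (S x) with hN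
  have hNfd : FiniteDimensional ℝ N := Submodule.finiteDimensional_finset_sup t _
  set e := stdOrthonormalBasis ℝ N
  refine ⟨finrank ℝ N, N.subtypeL.comp
    (e.repr.symm.toContinuousLinearEquiv : EuclideanSpace ℝ (Fin (finrank ℝ N)) →L[ℝ] N), ?_⟩
  intro x y
  have hx := ht (Set.mem_univ x)
  simp only [Set.mem_iUnion, Set.mem_ofPred_eq, isUnit_gram_iff] at hx
  obtain ⟨i, hi, hsurj⟩ := hx
  obtain ⟨⟨w, z⟩, hwz⟩ := hsurj y
  have hz : (z : H) ∈ N := Finset.le_sup (f := fun x => kerH ι (S x)) hi z.2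
  refine ⟨(w, e.repr ⟨z, hz⟩), ?_⟩
  simpa using hwz

/-- Continuous frames extend along homotopies. -/
lemma exists_frame_of_homotopy {X : Type*} [PseudoMetricSpace X] [CompactSpace X]
    [CompleteSpace V] {K : V →L[ℝ] H} {S : X → ℝ → W →L[ℝ] H}
    (hS : Continuous fun p : X × ℝ => S p.1 p.2)
    (hK : ∀ x, ∀ τ ∈ Set.Icc (0 : ℝ) 1, Function.Surjective (stab (S x τ) K))
    {n : ℕ} {f₀ : Fin n → W × V} (hli : LinearIndependent ℝ f₀)
    (hker : ∀ x i, f₀ i ∈ (stab (S x 0) K).ker) :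
    ∃ f : X → Fin n → W × V, (∀ i, Continuous fun x => f x i) ∧
      (∀ x i, f x i ∈ (stab (S x 1) K).ker) ∧ ∀ x, LinearIndependent ℝ (f x) := by
  set Q : X × Set.Icc (0 : ℝ) 1 → W × V →L[ℝ] W × V := fun p => kproj (S p.1 p.2) K with hQ
  have hQc : Continuous Q := by
    rw [continuous_iff_continuousAt]
    intro p
    have h1 : Continuous fun p : X × Set.Icc (0 : ℝ) 1 => (S p.1 p.2, K) :=
      (hS.comp (continuous_fst.prodMk (continuous_subtype_val.comp continuous_snd))).prodMk
        continuous_const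
    exact ContinuousAt.comp (g := fun q : (W →L[ℝ] H) × (V →L[ℝ] H) => kproj q.1 q.2)
      (f := fun p : X × Set.Icc (0 : ℝ) 1 => (S p.1 p.2, K))
      (continuousAt_kproj (hK p.1 p.2 p.2.2)) h1.continuousAt
  -- On the compact space `X × [0, 1]` the kernel projections are uniformly continuous, so `[0, 1]`
  -- splits into steps along which they move by less than `1`; a frame is carried across each step
  -- by projecting it.
  have hQu : UniformContinuous Q := CompactSpace.uniformContinuous_of_continuous hQc
  obtain ⟨δ, hδ, hunif⟩ := (Metric.uniformContinuous_iff
    (α := X × Set.Icc (0 : ℝ) 1) (β := W × V →L[ℝ] W × V)).1 hQu 1 one_pos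
  obtain ⟨N, hN⟩ := exists_nat_one_div_lt hδ
  have hpos : (0 : ℝ) < N + 1 := by positivity
  have key : ∀ i : ℕ, i ≤ N + 1 → ∃ f : X → Fin n → W × V, (∀ j, Continuous fun x => f x j) ∧
      (∀ x j, f x j ∈ (stab (S x (i / (N + 1))) K).ker) ∧ ∀ x, LinearIndependent ℝ (f x) := by
    intro i
    induction i with
    | zero =>
      intro _
      exact ⟨fun _ => f₀, fun _ => continuous_const, by simpa using hker, fun _ => hli⟩
    | succ i ih =>
      intro hi
      obtain ⟨f, hfc, hfk, hfl⟩ := ih (by omega)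
      have hi' : (i : ℝ) + 1 ≤ N + 1 := by exact_mod_cast hi
      have hm0 : (i : ℝ) / (N + 1) ∈ Set.Icc (0 : ℝ) 1 :=
        ⟨by positivity, by rw [div_le_one hpos]; linarith⟩
      have hm1 : ((i + 1 : ℕ) : ℝ) / (N + 1) ∈ Set.Icc (0 : ℝ) 1 :=
        ⟨by positivity, by rw [div_le_one hpos]; push_cast; linarith⟩
      refine ⟨fun x j => Q (x, ⟨_, hm1⟩) (f x j), fun j => ?_, fun x j => ?_, fun x => ?_⟩
      · exact (hQc.comp (continuous_id.prodMk continuous_const)).clm_apply (hfc j)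
      · exact kproj_mem (hK x _ hm1) _
      · refine linearIndependent_of_norm_sub_lt (P := Q (x, ⟨_, hm0⟩)) ?_ (hfl x)
          fun j => kproj_eq_self (hfk x j)
        rw [← dist_eq_norm]
        refine hunif ?_
        rw [Prod.dist_eq, dist_self, max_lt_iff]
        refine ⟨hδ, ?_⟩
        rw [Subtype.dist_eq, Real.dist_eq, ← sub_div]
        push_cast
        rw [add_sub_cancel_left, abs_of_pos (by positivity)]
        exact hN
  obtain ⟨f, hfc, hfk, hfl⟩ := key (N + 1) le_rfl
  refine ⟨f, hfc, fun x i => ?_, hfl⟩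
  have := hfk x i
  rwa [show (((N + 1 : ℕ) : ℝ)) / (N + 1) = 1 by push_cast; exact div_self hpos.ne'] at this

lemma IsSA.finrank_ker_stab {ι S : W →L[ℝ] H} (hι : Function.Injective ι)
    (hc : IsCompactOperator ι) (h : IsSA ι S) {n : ℕ} {K : EuclideanSpace ℝ (Fin n) →L[ℝ] H}
    (hK : Function.Surjective (stab S K)) :
    finrank ℝ (stab S K).ker = n ∧ FiniteDimensional ℝ (stab S K).ker := by
  have := OTSF.finrank_ker_stab (h.finiteDimensional_ker hι hc) (h.isClosed_range hι hc)
    (h.finrank_coker hι) hK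
  simpa using this

lemma IsSA.isBasis_frame {ι S : W →L[ℝ] H} (hι : Function.Injective ι)
    (hc : IsCompactOperator ι) (h : IsSA ι S) {n : ℕ} {K : EuclideanSpace ℝ (Fin n) →L[ℝ] H}
    (hK : Function.Surjective (stab S K)) {f : Fin n → (stab S K).ker}
    (hf : LinearIndependent ℝ fun i => (f i : W × EuclideanSpace ℝ (Fin n))) : IsBasis f := by
  obtain ⟨h1, h2⟩ := h.finrank_ker_stab hι hc hK
  exact IsBasis.of_linearIndependent (LinearIndependent.of_comp (stab S K).ker.subtype hf) h1 h2

lemma IsSA.bijective_iff {ι S : W →L[ℝ] H} (hι : Function.Injective ι)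
    (hc : IsCompactOperator ι) (h : IsSA ι S) : Function.Bijective S ↔ S.ker = ⊥ := by
  constructor
  · intro hb
    exact LinearMap.ker_eq_bot.2 hb.1
  · intro hk
    refine ⟨LinearMap.ker_eq_bot.1 hk, fun y => ?_⟩
    obtain ⟨w, z, hz, hwz⟩ := h.exists_add_eq hι hc y
    obtain ⟨x, hx, rfl⟩ := hz
    have hx' : x ∈ S.ker := hx
    rw [hk] at hx'
    have hx0 : x = 0 := hx'
    exact ⟨w, by rw [← hwz, hx0]; simp⟩

/-- The kernel of `P_V` on `ker S_K` is the copy of `ker S`, and the frame has exactly `n = dim V`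
members. -/
lemma IsSA.det_ne_zero_iff {ι S : W →L[ℝ] H} (hι : Function.Injective ι)
    (hc : IsCompactOperator ι) (h : IsSA ι S) {n : ℕ} {K : EuclideanSpace ℝ (Fin n) →L[ℝ] H}
    (hK : Function.Surjective (stab S K)) (e : Basis (Fin n) ℝ (EuclideanSpace ℝ (Fin n)))
    {f : Fin n → W × EuclideanSpace ℝ (Fin n)} (hf : ∀ i, f i ∈ (stab S K).ker)
    (hli : LinearIndependent ℝ f) :
    e.det (fun i => (f i).2) ≠ 0 ↔ S.ker = ⊥ := by
  rw [← isUnit_iff_ne_zero, ← e.is_basis_iff_det]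
  constructor
  · rintro ⟨hl, -⟩
    rw [Submodule.eq_bot_iff]
    intro x hx
    have hx0 : S x = 0 := hx
    have hb := h.isBasis_frame hι hc hK (f := fun i => ⟨f i, hf i⟩) hli
    have h1 := congrArg (fun z : (stab S K).ker => (z : W × EuclideanSpace ℝ (Fin n)))
      (hb.basis.sum_repr ⟨(x, 0), by simp [hx0]⟩)
    set c := hb.basis.repr ⟨(x, 0), by simp [hx0]⟩ with hcdef
    simp only [IsBasis.coe_basis, Submodule.coe_sum, Submodule.coe_smul] at h1
    have h2 := congrArg Prod.snd h1
    simp only [Prod.snd_sum, Prod.smul_snd] at h2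
    have h3 := Fintype.linearIndependent_iff.1 hl _ h2
    simp only [h3, zero_smul, Finset.sum_const_zero] at h1
    exact (congrArg Prod.fst h1).symm
  · intro hk
    have hl : LinearIndependent ℝ fun i => (f i).2 := by
      rw [Fintype.linearIndependent_iff] at hli ⊢
      intro g hg
      refine hli g ?_
      have hmem : ∑ i, g i • f i ∈ (stab S K).ker :=
        Submodule.sum_mem _ fun i _ => Submodule.smul_mem _ _ (hf i)
      have h2 : (∑ i, g i • f i).2 = 0 := by simpa [Prod.snd_sum] using hg
      have h3 : S (∑ i, g i • f i).1 = 0 := by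
        have : S (∑ i, g i • f i).1 + K (∑ i, g i • f i).2 = 0 := by
          have h5 : stab S K (∑ i, g i • f i) = 0 := hmem
          rw [stab, ContinuousLinearMap.coprod_apply] at h5
          exact h5
        rwa [h2, map_zero, add_zero] at this
      have h4 : (∑ i, g i • f i).1 ∈ S.ker := h3
      rw [hk] at h4
      exact Prod.ext h4 h2
    exact ⟨hl, hl.span_eq_top_of_card_eq_finrank' (by simp)⟩

/-- A constant stabilizer and a continuous frame of the stabilized kernels for the operators
`T_t + λ`, where `t ∈ [a, b]` and `λ ∈ [0, ε]`. -/
structure FramedStabilizer (ι : W →L[ℝ] H) (a b ε : ℝ) (T : ℝ → W →L[ℝ] H) where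
  /-- The dimension of the stabilizing space. -/
  n : ℕ
  /-- The stabilizer. -/
  K : EuclideanSpace ℝ (Fin n) →L[ℝ] H
  /-- The frame. -/
  f : ℝ → ℝ → Fin n → W × EuclideanSpace ℝ (Fin n)
  surj : ∀ t ∈ Set.Icc a b, ∀ c ∈ Set.Icc 0 ε, Function.Surjective (stab (T t + c • ι) K)
  cont : ∀ i, Continuous fun p : ℝ × ℝ => f p.1 p.2 i
  mem : ∀ t ∈ Set.Icc a b, ∀ c ∈ Set.Icc 0 ε, ∀ i, f t c i ∈ (stab (T t + c • ι) K).ker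
  li : ∀ t ∈ Set.Icc a b, ∀ c ∈ Set.Icc 0 ε, LinearIndependent ℝ (f t c)

/-- The rectangle contracts along segments to the corner `(a, 0)`, so a basis of the kernel at that
corner extends to a frame over the whole rectangle. -/
lemma exists_framedStabilizer {ι : W →L[ℝ] H} (hι : Function.Injective ι)
    (hc : IsCompactOperator ι) {a b ε : ℝ} (hab : a ≤ b) (hε : 0 ≤ ε) {T : ℝ → W →L[ℝ] H}
    (hT : ContinuousOn T (Set.Icc a b)) (hsa : ∀ t ∈ Set.Icc a b, IsSA ι (T t)) :
    Nonempty (FramedStabilizer ι a b ε T) := by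
  let X := Set.Icc a b × Set.Icc (0 : ℝ) ε
  set T' : ℝ → W →L[ℝ] H := fun t => T (Set.projIcc a b hab t) with hT'
  have hT'c : Continuous T' := (continuousOn_iff_continuous_domRestrict.1 hT).comp continuous_projIcc
  have hT'eq : ∀ t ∈ Set.Icc a b, T' t = T t := fun t ht => by
    simp only [hT', Set.projIcc_of_mem hab ht]
  have hsa' : ∀ t, IsSA ι (T' t) := fun t => hsa _ (Set.projIcc a b hab t).2
  set S : X → W →L[ℝ] H := fun p => T' p.1 + (p.2 : ℝ) • ι with hS
  have hSc : Continuous S := by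
    refine (hT'c.comp (continuous_subtype_val.comp continuous_fst)).add ?_
    exact (continuous_subtype_val.comp continuous_snd).smul continuous_const
  obtain ⟨n, K, hK⟩ := exists_stabilizer hι hc hSc fun p => (hsa' p.1).add_smul p.2
  have ha : a ∈ Set.Icc a b := ⟨le_rfl, hab⟩
  have h0 : (0 : ℝ) ∈ Set.Icc 0 ε := ⟨le_rfl, hε⟩
  have hK0 : Function.Surjective (stab (T a) K) := by
    have := hK (⟨a, ha⟩, ⟨0, h0⟩)
    simpa [hS, hT'eq a ha] using this
  obtain ⟨hfr, hfd⟩ := (hsa a ha).finrank_ker_stab hι hc hK0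
  set b0 := finBasisOfFinrankEq ℝ (stab (T a) K).ker hfr
  have hhom : ∀ t ∈ Set.Icc a b, ∀ τ ∈ Set.Icc (0 : ℝ) 1, a + τ * (t - a) ∈ Set.Icc a b := by
    rintro t ⟨ht1, ht2⟩ τ ⟨hτ1, hτ2⟩
    constructor <;> nlinarith
  have hhom' : ∀ c ∈ Set.Icc 0 ε, ∀ τ ∈ Set.Icc (0 : ℝ) 1, τ * c ∈ Set.Icc 0 ε := by
    rintro t ⟨ht1, ht2⟩ τ ⟨hτ1, hτ2⟩
    constructor <;> nlinarith
  obtain ⟨f, hfc, hfk, hfl⟩ := exists_frame_of_homotopy (K := K)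
    (S := fun (p : X) τ => T' (a + τ * (p.1 - a)) + (τ * p.2 : ℝ) • ι)
    (by
      have h1 : Continuous fun p : (Set.Icc a b × Set.Icc (0 : ℝ) ε) × ℝ =>
          a + p.2 * ((p.1.1 : ℝ) - a) := by fun_prop
      have h2 : Continuous fun p : (Set.Icc a b × Set.Icc (0 : ℝ) ε) × ℝ =>
          p.2 * (p.1.2 : ℝ) := by fun_prop
      exact (hT'c.comp h1).add (h2.smul continuous_const))
    (fun p τ hτ => hK (⟨_, hhom _ p.1.2 τ hτ⟩, ⟨_, hhom' _ p.2.2 τ hτ⟩))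
    (f₀ := fun i => (b0 i : W × EuclideanSpace ℝ (Fin n)))
    (b0.linearIndependent.map' (Submodule.subtype _) (Submodule.ker_subtype _))
    (fun p i => by
      have := (b0 i).2
      simpa [hT'eq a ha] using this)
  -- Clamping both parameters to the rectangle makes the frame continuous on all of `ℝ × ℝ`.
  refine ⟨⟨n, K, fun t c => f (Set.projIcc a b hab t, Set.projIcc 0 ε hε c), ?_, ?_, ?_, ?_⟩⟩
  · intro t ht c hc'
    have := hK (⟨t, ht⟩, ⟨c, hc'⟩)
    simpa [hS, hT'eq t ht] using this
  · intro i
    exact (hfc i).comp ((continuous_projIcc.comp continuous_fst).prodMk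
      (continuous_projIcc.comp continuous_snd))
  · intro t ht c hc' i
    have := hfk (⟨t, ht⟩, ⟨c, hc'⟩) i
    simp only [one_mul, add_sub_cancel, hT'eq t ht] at this
    rw [Set.projIcc_of_mem hab ht, Set.projIcc_of_mem hε hc']
    exact this
  · intro t ht c hc'
    exact hfl _

/-- The determinant of the projection of the frame to the stabilizing space. -/
def FramedStabilizer.D {ι : W →L[ℝ] H} {a b ε : ℝ} {T : ℝ → W →L[ℝ] H}
    (F : FramedStabilizer ι a b ε T) (t c : ℝ) : ℝ :=
  (EuclideanSpace.basisFun (Fin F.n) ℝ).toBasis.det fun i => (F.f t c i).2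

lemma continuous_basis_det {X : Type*} [TopologicalSpace X] [FiniteDimensional ℝ V] {n : ℕ}
    (e : Basis (Fin n) ℝ V) {v : X → Fin n → V} (hv : ∀ i, Continuous fun x => v x i) :
    Continuous fun x => e.det (v x) := by
  simp only [Basis.det_apply]
  refine Continuous.matrix_det ?_
  refine continuous_matrix fun i j => ?_
  have : Continuous (e.coord i) := LinearMap.continuous_of_finiteDimensional _
  exact this.comp (hv j)

set_option linter.unusedSectionVars false in
lemma FramedStabilizer.continuous_D {ι : W →L[ℝ] H} {a b ε : ℝ} {T : ℝ → W →L[ℝ] H}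
    (F : FramedStabilizer ι a b ε T) : Continuous fun p : ℝ × ℝ => F.D p.1 p.2 :=
  continuous_basis_det _ fun i => continuous_snd.comp (F.cont i)

end Global

/-! ### Trivializations of the determinant line bundle -/

section Trivialization

open Filter Topology

variable {W H : Type*}
  [NormedAddCommGroup W] [InnerProductSpace ℝ W] [CompleteSpace W]
  [NormedAddCommGroup H] [InnerProductSpace ℝ H] [CompleteSpace H]

/-- The standard basis of `ℝⁿ`. -/
abbrev stdBasis (n : ℕ) : Basis (Fin n) ℝ (EuclideanSpace ℝ (Fin n)) :=
  (EuclideanSpace.basisFun (Fin n) ℝ).toBasis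

lemma IsSA.exists_leadingCoeff {ι S : W →L[ℝ] H} (hι : Function.Injective ι)
    (hc : IsCompactOperator ι) (h : IsSA ι S) {n : ℕ} {K : EuclideanSpace ℝ (Fin n) →L[ℝ] H}
    (hK : Function.Surjective (stab S K)) {f : ℝ → Fin n → W × EuclideanSpace ℝ (Fin n)}
    (hf : ∀ᶠ c in 𝓝[>] (0 : ℝ), ∀ i, f c i ∈ (stab (S + c • ι) K).ker)
    (hlim : ∀ i, Tendsto (fun c => f c i) (𝓝[>] 0) (𝓝 (f 0 i)))
    {f₀ : Fin n → (stab S K).ker} (hf₀ : ∀ i, (f₀ i : W × EuclideanSpace ℝ (Fin n)) = f 0 i)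
    (hli : LinearIndependent ℝ (f 0)) :
    ∃ d : ℝ, d ≠ 0 ∧
      Tendsto (fun c => (stdBasis n).det (fun i => (f c i).2) / c ^ finrank ℝ S.ker)
        (𝓝[>] 0) (𝓝 d) ∧
      ∀ x, stabIso S K x =
        ((-1) ^ (n * (n + 1) / 2) * Psi ι S x / d) • (wedge f₀ ⊗ₜ[ℝ] detForm (stdBasis n)) := by
  have hl : 𝓝[>] (0 : ℝ) ≤ 𝓝[≠] 0 := nhdsWithin_mono _ fun x hx => ne_of_gt hx
  have hb : IsBasis f₀ := h.isBasis_frame hι hc hK (by simpa only [hf₀] using hli)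
  have hf' : ∀ᶠ c in 𝓝[>] (0 : ℝ), ∀ i, (S + c • ι) (f c i).1 + K (f c i).2 = 0 := by
    filter_upwards [hf] with c hc i
    exact mem_ker_stab ⟨_, hc i⟩
  have hlim' : ∀ i, Tendsto (fun c => f c i) (𝓝[>] 0)
      (𝓝 (f₀ i : W × EuclideanSpace ℝ (Fin n))) := fun i => by rw [hf₀]; exact hlim i
  obtain ⟨d, hd0, hd⟩ := h.exists_tendsto_det hι hc hK (stdBasis n) hb
    (tendsto_inv_smul_add_smul_sub hl) (h.eq_zero_of_mem_range hι) hf' hlim'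
  exact ⟨d, hd0, hd, fun x => h.stabIso_eq hι hc hK (stdBasis n) hb hl hf' hlim' hd0 hd x⟩

lemma eventually_norm_sub_lt_one {X E : Type*} [TopologicalSpace X] [SeminormedAddCommGroup E]
    {Q : X → E} {x₀ : X} (hQ : ContinuousAt Q x₀) : ∀ᶠ x in 𝓝 x₀, ‖Q x - Q x₀‖ < 1 := by
  filter_upwards [hQ.eventually_mem (Metric.ball_mem_nhds _ one_pos)] with x hx
  rwa [← dist_eq_norm]

/-- Near `(x₀, 0)` the operator stays surjective and the kernel projection moves by less than `1`,
so the projections of the given vectors remain independent. -/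
lemma exists_local_frame {X : Type*} [TopologicalSpace X] {V : Type*} [NormedAddCommGroup V]
    [InnerProductSpace ℝ V] [CompleteSpace V] {ι : W →L[ℝ] H} {T : X → W →L[ℝ] H}
    (hT : Continuous T) {n : ℕ}
    {K : X → V →L[ℝ] H} {U : Set X} (hU : IsOpen U)
    (hK : IsStabilizerOn T K U) {x₀ : X} (hx₀ : x₀ ∈ U)
    {f₀ : Fin n → W × V} (hli : LinearIndependent ℝ f₀)
    (hker : ∀ i, f₀ i ∈ (stab (T x₀) (K x₀)).ker) :
    ∃ (N : Set X) (σ : ℝ) (f : X × ℝ → Fin n → W × V),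
      IsOpen N ∧ x₀ ∈ N ∧ N ⊆ U ∧ 0 < σ ∧
      (∀ p ∈ N ×ˢ Set.Icc 0 σ, Function.Surjective (stab (T p.1 + p.2 • ι) (K p.1))) ∧
      (∀ i, ContinuousOn (fun p => f p i) (N ×ˢ Set.Icc 0 σ)) ∧
      (∀ p ∈ N ×ˢ Set.Icc 0 σ, ∀ i, f p i ∈ (stab (T p.1 + p.2 • ι) (K p.1)).ker) ∧
      ∀ p ∈ N ×ˢ Set.Icc 0 σ, LinearIndependent ℝ (f p) := by
  set SK : X × ℝ → (W →L[ℝ] H) × (V →L[ℝ] H) :=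
    fun p => (T p.1 + p.2 • ι, K p.1) with hSK
  have hSKc : ∀ p : X × ℝ, p.1 ∈ U → ContinuousAt SK p := by
    intro p hp
    have h1 : ContinuousAt (fun p : X × ℝ => T p.1 + p.2 • ι) p :=
      ((hT.comp continuous_fst).add (continuous_snd.smul continuous_const)).continuousAt
    have h2 : ContinuousAt (fun p : X × ℝ => K p.1) p :=
      ContinuousAt.comp (g := K) (hK.continuousOn.continuousAt (hU.mem_nhds hp))
        continuous_fst.continuousAt
    exact h1.prodMk h2
  set Q : X × ℝ → _ := fun p => kproj (SK p).1 (SK p).2 with hQ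
  have hQc : ∀ p : X × ℝ, p.1 ∈ U → Function.Surjective (stab (SK p).1 (SK p).2) →
      ContinuousAt Q p := fun p hp hs =>
    ContinuousAt.comp (g := fun q : (W →L[ℝ] H) × (V →L[ℝ] H) =>
      kproj q.1 q.2) (f := SK) (continuousAt_kproj hs) (hSKc p hp)
  have hK0 := hK.surjective x₀ hx₀
  have hs0 : Function.Surjective (stab (SK (x₀, 0)).1 (SK (x₀, 0)).2) := by
    simpa [hSK] using hK0
  have hev : ∀ᶠ p in 𝓝 (x₀, (0 : ℝ)), p.1 ∈ U ∧
      Function.Surjective (stab (SK p).1 (SK p).2) ∧ ‖Q p - Q (x₀, 0)‖ < 1 := by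
    refine (continuous_fst.continuousAt.eventually (hU.mem_nhds hx₀)).and (Eventually.and ?_ ?_)
    · have h1 : ContinuousAt (fun p => gram (SK p).1 (SK p).2) (x₀, 0) :=
        ContinuousAt.comp (g := fun q : (W →L[ℝ] H) × (V →L[ℝ] H) =>
          gram q.1 q.2) (f := SK) continuous_gram.continuousAt (hSKc _ hx₀)
      have h2 : ∀ᶠ p in 𝓝 (x₀, (0 : ℝ)), IsUnit (gram (SK p).1 (SK p).2) :=
        h1.eventually (Units.isOpen.mem_nhds (isUnit_gram_iff.2 hs0))
      filter_upwards [h2] with p hp using isUnit_gram_iff.1 hp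
    · exact eventually_norm_sub_lt_one (E := W × V →L[ℝ] W × V) (hQc (x₀, 0) hx₀ hs0)
  rw [nhds_prod_eq, Filter.Eventually, Filter.mem_prod_iff] at hev
  obtain ⟨A, hA, B, hB, hAB⟩ := hev
  obtain ⟨N, hNA, hNo, hxN⟩ := mem_nhds_iff.1 hA
  obtain ⟨r, hr, hrB⟩ := Metric.mem_nhds_iff.1 hB
  have hmem : ∀ p ∈ N ×ˢ Set.Icc 0 (r / 2), p.1 ∈ U ∧
      Function.Surjective (stab (SK p).1 (SK p).2) ∧ ‖Q p - Q (x₀, 0)‖ < 1 := by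
    rintro ⟨x, c⟩ ⟨hx, hc0, hc1⟩
    refine hAB ⟨hNA hx, hrB ?_⟩
    have hc0' : 0 ≤ c := hc0
    have hc1' : c ≤ r / 2 := hc1
    rw [Metric.mem_ball, dist_zero_right, Real.norm_of_nonneg hc0']
    linarith
  refine ⟨N, r / 2, fun p i => Q p (f₀ i), hNo, hxN, ?_, by positivity, ?_, ?_, ?_, ?_⟩
  · intro x hx
    exact (hmem (x, 0) ⟨hx, le_rfl, by positivity⟩).1
  · exact fun p hp => (hmem p hp).2.1
  · intro i p hp
    exact ((hQc p (hmem p hp).1 (hmem p hp).2.1).clm_apply continuousAt_const).continuousWithinAt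
  · exact fun p hp i => kproj_mem (hmem p hp).2.1 _
  · intro p hp
    refine linearIndependent_of_norm_sub_lt (hmem p hp).2.2 hli fun i => ?_
    refine kproj_eq_self ?_
    have := hker i
    simpa [hSK] using this

lemma tendsto_of_continuousOn_Icc {E : Type*} [TopologicalSpace E] {g : ℝ → E} {σ : ℝ} (hσ : 0 < σ)
    (hg : ContinuousOn g (Set.Icc 0 σ)) : Tendsto g (𝓝[>] 0) (𝓝 (g 0)) := by
  have h1 : ContinuousWithinAt g (Set.Icc 0 σ) 0 := hg 0 ⟨le_rfl, hσ.le⟩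
  have h2 : Set.Icc 0 σ ∈ 𝓝[>] (0 : ℝ) := Icc_mem_nhdsGT hσ
  exact h1.mono_left (nhdsWithin_le_iff.2 h2)

variable {ι : W →L[ℝ] H} {a b ε : ℝ} {T : ℝ → W →L[ℝ] H}

/-- The frame at `λ = 0`. -/
def FramedStabilizer.frame₀ (F : FramedStabilizer ι a b ε T) (hε : 0 < ε) (t : Set.Icc a b) :
    Fin F.n → (stab (T t) F.K).ker :=
  fun i => ⟨F.f t 0 i, by
    have := F.mem t t.2 0 ⟨le_rfl, hε.le⟩ i
    rwa [zero_smul, add_zero] at this⟩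

set_option linter.unusedSectionVars false in
lemma FramedStabilizer.surj₀ (F : FramedStabilizer ι a b ε T) (hε : 0 < ε) (t : Set.Icc a b) :
    Function.Surjective (stab (T t) F.K) := by
  have := F.surj t t.2 0 ⟨le_rfl, hε.le⟩
  rwa [zero_smul, add_zero] at this

lemma FramedStabilizer.exists_leadingCoeff (F : FramedStabilizer ι a b ε T) (hε : 0 < ε)
    (hι : Function.Injective ι) (hc : IsCompactOperator ι)
    (hsa : ∀ t ∈ Set.Icc a b, IsSA ι (T t)) (t : Set.Icc a b) :
    ∃ d : ℝ, d ≠ 0 ∧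
      Tendsto (fun c => F.D t c / c ^ finrank ℝ (T t).ker) (𝓝[>] 0) (𝓝 d) ∧
      ∀ x, stabIso (T t) F.K x = ((-1) ^ (F.n * (F.n + 1) / 2) * Psi ι (T t) x / d) •
        (wedge (F.frame₀ hε t) ⊗ₜ[ℝ] detForm (stdBasis F.n)) := by
  refine (hsa t t.2).exists_leadingCoeff hι hc (F.surj₀ hε t) (f := F.f t) ?_ ?_ (fun i => rfl)
    (F.li t t.2 0 ⟨le_rfl, hε.le⟩)
  · filter_upwards [Icc_mem_nhdsGT hε] with c hc i using F.mem t t.2 c hc i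
  · intro i
    have h1 : Continuous fun c => F.f t c i := (F.cont i).comp (Continuous.prodMk_right _)
    exact (h1.tendsto 0).mono_left nhdsWithin_le_nhds

set_option linter.unusedSectionVars false in
lemma FramedStabilizer.D_def (F : FramedStabilizer ι a b ε T) (t c : ℝ) :
    F.D t c = (stdBasis F.n).det fun i => (F.f t c i).2 := rfl

attribute [local irreducible] FramedStabilizer.D

lemma IsSA.exists_equiv_Psi_eq {S : W →L[ℝ] H} (hι : Function.Injective ι)
    (hc : IsCompactOperator ι) (h : IsSA ι S) {d : ℝ} (hd : d ≠ 0) :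
    ∃ φ : ℝ ≃ₗ[ℝ] FredholmDet S, Psi ι S (φ 1) = d := by
  set E := LinearEquiv.ofBijective (Psi ι S) (h.Psi_bijective hι hc)
  refine ⟨(LinearEquiv.smulOfNeZero ℝ ℝ d hd).trans E.symm, ?_⟩
  have h1 : ((LinearEquiv.smulOfNeZero ℝ ℝ d hd).trans E.symm) 1 = E.symm d := by
    rw [LinearEquiv.trans_apply]
    congr 1
    simp
  rw [h1]
  exact E.apply_symm_apply d

set_option maxHeartbeats 800000 in
-- The section whose `Ψ`-value is the leading coefficient `d_t` of `D(t, ·)` has a constant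
-- coordinate in the global stabilization. For another stabilizer the coordinate is, up to a
-- constant sign, `d / d'`. Neither coefficient need be continuous, since the order of vanishing
-- jumps with the kernel, but their ratio is the continuous factor `q` at `λ = 0`.
theorem exists_isDetTrivialization (hι : Function.Injective ι) (hc : IsCompactOperator ι)
    (hab : a ≤ b) (hT : ContinuousOn T (Set.Icc a b)) (hsa : ∀ t ∈ Set.Icc a b, IsSA ι (T t)) :
    ∃ φ : ∀ t : Set.Icc a b, ℝ ≃ₗ[ℝ] FredholmDet (T t),
      IsDetTrivialization (fun t : Set.Icc a b => T t) φ := by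
  obtain ⟨F⟩ := exists_framedStabilizer hι hc hab zero_le_one hT hsa
  choose d hd0 hd hiso using F.exists_leadingCoeff one_pos hι hc hsa
  choose φ hφ using fun t : Set.Icc a b => (hsa t t.2).exists_equiv_Psi_eq hι hc (hd0 t)
  refine ⟨φ, ?_⟩
  intro n K U hU hK x₀ hx₀
  beta_reduce
  have hTc : Continuous fun t : Set.Icc a b => T t := continuousOn_iff_continuous_domRestrict.1 hT
  obtain ⟨hfr, hfd⟩ := (hsa x₀ x₀.2).finrank_ker_stab hι hc (hK.surjective x₀ hx₀)
  set b0 := finBasisOfFinrankEq ℝ (stab (T x₀) (K x₀)).ker hfr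
  obtain ⟨N, σ₀, f', hNo, hxN, hNU, hσ₀, hsurj, hfc, hfk, hfl⟩ :=
    exists_local_frame (ι := ι) hTc hU hK hx₀
      (f₀ := fun i => (b0 i : W × EuclideanSpace ℝ (Fin n)))
      (b0.linearIndependent.map' (Submodule.subtype _) (Submodule.ker_subtype _)) fun i => (b0 i).2
  set σ := min σ₀ 1 with hσdef
  have hσ : 0 < σ := lt_min hσ₀ one_pos
  have hsub : N ×ˢ Set.Icc 0 σ ⊆ N ×ˢ Set.Icc 0 σ₀ :=
    Set.prod_mono le_rfl (Set.Icc_subset_Icc_right (min_le_left _ _))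
  obtain ⟨q, hqc, hq⟩ := exists_continuousOn_det_eq_mul (s := N ×ˢ Set.Icc 0 σ)
    (S := fun p : Set.Icc a b × ℝ => T p.1 + p.2 • ι) (K := fun _ => F.K) (K' := fun p => K p.1)
    ((hTc.comp continuous_fst).add (continuous_snd.smul continuous_const)).continuousOn
    continuousOn_const
    (hK.continuousOn.comp continuousOn_fst fun p hp => hNU hp.1)
    (fun p hp => F.surj p.1 p.1.2 p.2 ⟨hp.2.1, hp.2.2.trans (min_le_right _ _)⟩)
    (fun p hp => hsurj p (hsub hp)) (stdBasis F.n) (stdBasis n)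
    (f := fun p => F.f p.1 p.2)
    (fun i => ((F.cont i).comp ((continuous_subtype_val.comp continuous_fst).prodMk
      continuous_snd)).continuousOn)
    (fun p hp i => mem_ker_stab
      ⟨_, F.mem p.1 p.1.2 p.2 ⟨hp.2.1, hp.2.2.trans (min_le_right _ _)⟩ i⟩)
    (f' := f') (fun i => (hfc i).mono hsub) (fun p hp => hfk p (hsub hp))
    (fun p hp => hfl p (hsub hp))
    (fun p hp => (((hsa p.1 p.1.2).add_smul p.2).finrank_ker_stab hι hc (hsurj p (hsub hp))).1)
    (fun p hp => (((hsa p.1 p.1.2).add_smul p.2).finrank_ker_stab hι hc (hsurj p (hsub hp))).2)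
  have h0 : ∀ x ∈ N, (x, (0 : ℝ)) ∈ N ×ˢ Set.Icc 0 σ := fun x hx => ⟨hx, le_rfl, hσ.le⟩
  have hmem0 : ∀ x ∈ N, ∀ i, f' (x, 0) i ∈ (stab (T x) (K x)).ker := by
    intro x hx i
    have := hfk _ (hsub (h0 x hx)) i
    simpa only [zero_smul, add_zero] using this
  classical
  -- Only the values over `N` matter; outside, `0` is a filler.
  set g : ∀ x : Set.Icc a b, Fin n → (stab (T x) (K x)).ker := fun x i =>
    if hx : x ∈ N then ⟨f' (x, 0) i, hmem0 x hx i⟩ else 0 with hg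
  have hgval : ∀ x ∈ N, ∀ i, (g x i : W × EuclideanSpace ℝ (Fin n)) = f' (x, 0) i := by
    intro x hx i
    simp [hg, hx]
  refine ⟨N, hNo, hxN, hNU, n, g, detForm (stdBasis n),
    fun x => (-1) ^ (n * (n + 1) / 2) * q (x, 0), ?_, ?_, ?_, ?_, ?_⟩
  · intro i
    have h1 : ContinuousOn (fun x : Set.Icc a b => f' (x, 0) i) N :=
      (hfc i).comp (Continuous.prodMk_left (0 : ℝ)).continuousOn fun x hx => hsub (h0 x hx)
    exact h1.congr fun x hx => hgval x hx i
  · intro x hx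
    refine (hsa x x.2).isBasis_frame hι hc (hK.surjective x (hNU hx)) ?_
    simp only [hgval x hx]
    exact hfl _ (hsub (h0 x hx))
  · intro hzero
    have := detForm_wedge (stdBasis n) (stdBasis n)
    rw [hzero, Basis.det_self] at this
    simp at this
  · exact continuousOn_const.mul
      (hqc.comp (Continuous.prodMk_left (0 : ℝ)).continuousOn fun x hx => h0 x hx)
  · intro x hx
    have hline : ∀ c ∈ Set.Icc 0 σ, (x, c) ∈ N ×ˢ Set.Icc 0 σ := fun c hc => ⟨hx, hc⟩
    obtain ⟨d', hd'0, hd', hiso'⟩ := (hsa x x.2).exists_leadingCoeff hι hc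
      (hK.surjective x (hNU hx)) (f := fun c => f' (x, c)) (f₀ := g x)
      (by
        filter_upwards [Icc_mem_nhdsGT hσ] with c hc i using hfk _ (hsub (hline c hc)) i)
      (fun i => tendsto_of_continuousOn_Icc hσ
        (((hfc i).mono hsub).comp (Continuous.prodMk_right x).continuousOn hline))
      (hgval x hx) (hfl _ (hsub (h0 x hx)))
    have hqlim : Tendsto (fun c => q (x, c)) (𝓝[>] 0) (𝓝 (q (x, 0))) :=
      tendsto_of_continuousOn_Icc hσ (hqc.comp (Continuous.prodMk_right x).continuousOn hline)
    -- Both determinants are divided by the same power of `λ`, so their relation passes to leading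
    -- coefficients.
    have hdq : d x = d' * q (x, 0) := by
      refine tendsto_nhds_unique (hd x) ((hd'.mul hqlim).congr' ?_)
      filter_upwards [Icc_mem_nhdsGT hσ] with c hc
      rw [F.D_def, hq _ (hline c hc)]
      ring
    refine (hiso' (φ x 1)).trans (congrArg (· • (wedge (g x) ⊗ₜ[ℝ] detForm (stdBasis n))) ?_)
    rw [hφ, hdq]
    field_simp

end Trivialization

/-! ### The orientation transport -/

section Transport

open Filter Topology

lemma sign_mul_eq_sign_mul {σ pa pb da db Da Db r : ℝ} (hσ : σ * σ = 1)
    (hpos : 0 < (σ * pa / da) * (σ * pb / db)) (ha : 0 < da * Da) (hb : 0 < db * Db)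
    (hr : r * pa = 1) : Real.sign (r * pb) = Real.sign (Da * Db) := by
  have hda : da ≠ 0 := left_ne_zero_of_mul ha.ne'
  have hdb : db ≠ 0 := left_ne_zero_of_mul hb.ne'
  have hpa : pa ≠ 0 := right_ne_zero_of_mul_eq_one hr
  have h1 : (σ * pa / da) * (σ * pb / db) * ((da * Da) * (db * Db)) * (r * r) =
      (r * pb) * (Da * Db) := by
    have h2 : (σ * pa / da) * (σ * pb / db) * ((da * Da) * (db * Db)) * (r * r) =
        (σ * σ) * (r * pa) * (r * pb) * (Da * Db) := by
      field_simp
    rw [h2, hσ, hr]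
    ring
  have hr0 : r ≠ 0 := left_ne_zero_of_mul_eq_one hr
  have hgoal : 0 < (r * pb) * (Da * Db) := by
    rw [← h1]
    exact mul_pos (mul_pos hpos (mul_pos ha hb)) (mul_self_pos.2 hr0)
  rcases pos_and_pos_or_neg_and_neg_of_mul_pos hgoal with ⟨h1, h2⟩ | ⟨h1, h2⟩
  · rw [Real.sign_of_pos h1, Real.sign_of_pos h2]
  · rw [Real.sign_of_neg h1, Real.sign_of_neg h2]

lemma mul_pos_of_continuous_of_ne_zero {X : Type*} [TopologicalSpace X] [PreconnectedSpace X]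
    {g : X → ℝ} (hg : Continuous g) (h0 : ∀ x, g x ≠ 0) (x y : X) : 0 < g x * g y := by
  by_contra! hle
  have hz : (0 : ℝ) ∈ Set.range g := by
    rcases lt_or_gt_of_ne (h0 x) with hx | hx
    · have hy : 0 ≤ g y := by by_contra! hy; nlinarith
      exact mem_range_of_exists_le_of_exists_ge hg ⟨x, hx.le⟩ ⟨y, hy⟩
    · have hy : g y ≤ 0 := by by_contra! hy; nlinarith
      exact mem_range_of_exists_le_of_exists_ge hg ⟨y, hy⟩ ⟨x, hx.le⟩
  obtain ⟨z, hz⟩ := hz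
  exact h0 z hz

lemma mul_pos_of_continuousOn_of_ne_zero {s : Set ℝ} (hs : s.OrdConnected) {g : ℝ → ℝ}
    (hg : ContinuousOn g s) (h0 : ∀ x ∈ s, g x ≠ 0) {x y : ℝ} (hx : x ∈ s) (hy : y ∈ s) :
    0 < g x * g y := by
  have : PreconnectedSpace s := Subtype.preconnectedSpace hs.isPreconnected
  exact mul_pos_of_continuous_of_ne_zero (X := s) (g := fun z => g z)
    (continuousOn_iff_continuous_domRestrict.1 hg) (fun z => h0 z z.2) ⟨x, hx⟩ ⟨y, hy⟩

lemma coeff_eq_of_smul_wedge_tmul_eq {A B : Type*} [AddCommGroup A] [Module ℝ A] [AddCommGroup B]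
    [Module ℝ B] {m n : ℕ} (u : Basis (Fin m) ℝ A) (e : Basis (Fin n) ℝ B) {κ c : ℝ}
    {v : Fin m → A} {β : Dual ℝ (DetLine B)}
    (h : κ • (wedge u ⊗ₜ[ℝ] detForm e) = c • (wedge v ⊗ₜ[ℝ] β)) :
    κ = c * (u.det v * β (wedge e)) := by
  set L := (LinearMap.mul' ℝ ℝ) ∘ₗ TensorProduct.map (detForm u)
    (Dual.eval ℝ (DetLine B) (wedge e)) with hL
  have hLt : ∀ (z : DetLine A) (γ : Dual ℝ (DetLine B)),
      L (z ⊗ₜ[ℝ] γ) = detForm u z * γ (wedge e) := fun z γ => rfl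
  have h1 := congrArg L h
  rw [map_smul, map_smul, hLt, hLt, detForm_wedge, detForm_wedge, detForm_wedge,
    Basis.det_self, Basis.det_self, smul_eq_mul, smul_eq_mul, mul_one, mul_one] at h1
  exact h1

variable {W H : Type*}
  [NormedAddCommGroup W] [InnerProductSpace ℝ W] [CompleteSpace W]
  [NormedAddCommGroup H] [InnerProductSpace ℝ H] [CompleteSpace H]
  {ι : W →L[ℝ] H} {a b ε : ℝ} {T : ℝ → W →L[ℝ] H}

lemma FramedStabilizer.D_ne_zero_iff (F : FramedStabilizer ι a b ε T)
    (hι : Function.Injective ι) (hc : IsCompactOperator ι)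
    (hsa : ∀ t ∈ Set.Icc a b, IsSA ι (T t)) {t : ℝ} (ht : t ∈ Set.Icc a b) {c : ℝ}
    (hcε : c ∈ Set.Icc 0 ε) : F.D t c ≠ 0 ↔ (T t + c • ι).ker = ⊥ :=
  ((hsa t ht).add_smul c).det_ne_zero_iff hι hc (F.surj t ht c hcε) _ (F.mem t ht c hcε)
    (F.li t ht c hcε)

attribute [local irreducible] FramedStabilizer.D

/-- The leading coefficient has the sign of the determinant at `λ = ε` if there is no crossing
in between. -/
lemma FramedStabilizer.leadingCoeff_mul_D_pos (F : FramedStabilizer ι a b ε T) (hε : 0 < ε)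
    (hι : Function.Injective ι) (hc : IsCompactOperator ι)
    (hsa : ∀ t ∈ Set.Icc a b, IsSA ι (T t)) {t : ℝ} (ht : t ∈ Set.Icc a b)
    (hbij : ∀ c ∈ Set.Ioc 0 ε, Function.Bijective (T t + c • ι)) {d : ℝ} (hd0 : d ≠ 0) {k : ℕ}
    (hd : Tendsto (fun c => F.D t c / c ^ k) (𝓝[>] 0) (𝓝 d)) : 0 < d * F.D t ε := by
  have hne : ∀ c ∈ Set.Ioc 0 ε, F.D t c ≠ 0 := fun c hcc =>
    (F.D_ne_zero_iff hι hc hsa ht ⟨hcc.1.le, hcc.2⟩).2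
      ((((hsa t ht).add_smul c).bijective_iff hι hc).1 (hbij c hcc))
  have hcont : Continuous fun c => F.D t c := F.continuous_D.comp (Continuous.prodMk_right t)
  have hpos : ∀ c ∈ Set.Ioc 0 ε, 0 < F.D t c * F.D t ε := fun c hcc =>
    mul_pos_of_continuousOn_of_ne_zero (g := fun c => F.D t c) Set.ordConnected_Ioc
      hcont.continuousOn hne hcc ⟨hε, le_rfl⟩
  -- On `(0, ε]` the determinant keeps its sign and dividing by `c^k > 0` does not affect it; the
  -- limit `d` inherits the sign weakly, and strictly since `d ≠ 0`.
  have hge : 0 ≤ d * F.D t ε := by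
    refine ge_of_tendsto (hd.mul_const (F.D t ε)) ?_
    filter_upwards [Ioc_mem_nhdsGT hε] with c hcc
    rw [div_mul_eq_mul_div]
    exact div_nonneg (hpos c hcc).le (pow_nonneg hcc.1.le _)
  exact lt_of_le_of_ne hge (mul_ne_zero hd0 (hne ε ⟨hε, le_rfl⟩)).symm

/-- The coordinate, in the frame of the stabilized kernels, of a continuous section of the
determinant line bundle is continuous. -/
lemma FramedStabilizer.continuous_coord (F : FramedStabilizer ι a b ε T) (hε : 0 < ε)
    (hι : Function.Injective ι) (hc : IsCompactOperator ι)
    (hsa : ∀ t ∈ Set.Icc a b, IsSA ι (T t))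
    {y : ∀ t : Set.Icc a b,
      DetLine (stab (T t) F.K).ker ⊗[ℝ] Dual ℝ (DetLine (EuclideanSpace ℝ (Fin F.n)))}
    (hy : ContinuousStabSection (fun t : Set.Icc a b => T t) (fun _ => F.K) Set.univ y)
    {κ : Set.Icc a b → ℝ}
    (hκ : ∀ t, y t = κ t • (wedge (F.frame₀ hε t) ⊗ₜ[ℝ] detForm (stdBasis F.n))) :
    Continuous κ := by
  have hbas : ∀ t, IsBasis (F.frame₀ hε t) := fun t =>
    (hsa t t.2).isBasis_frame hι hc (F.surj₀ hε t) (F.li t t.2 0 ⟨le_rfl, hε.le⟩)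
  rw [continuous_iff_continuousAt]
  intro x₀
  have hy₀ := hy x₀ trivial
  beta_reduce at hy₀
  obtain ⟨N, hNo, hxN, -, m, f', β, c, hfc, hfb, -, hcc, hyeq⟩ := hy₀
  obtain rfl : m = F.n :=
    (hfb x₀ hxN).finrank_eq.symm.trans ((hsa x₀ x₀.2).finrank_ker_stab hι hc (F.surj₀ hε x₀)).1
  have hform : ∀ x ∈ N, κ x = c x * ((hbas x).basis.det (f' x) * β (wedge (stdBasis F.n))) := by
    intro x hx
    refine coeff_eq_of_smul_wedge_tmul_eq (hbas x).basis (stdBasis F.n) ?_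
    rw [IsBasis.coe_basis]
    exact (hκ x).symm.trans (hyeq x hx)
  have hdetc : ContinuousWithinAt (fun x => (hbas x).basis.det (f' x)) N x₀ := by
    have hent : ∀ i j, ContinuousWithinAt (fun x => (hbas x).basis.toMatrix (f' x) i j) N x₀ := by
      intro i j
      refine continuousWithinAt_coeff hxN
        (f := fun x : Set.Icc a b => F.f x 0) (u := fun x => (f' x j : W × _))
        (a := fun x i => (hbas x).basis.toMatrix (f' x) i j) ?_ (F.li x₀ x₀.2 0 ⟨le_rfl, hε.le⟩)
        (hfc j x₀ hxN) ?_ i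
      · intro l
        exact ((F.cont l).comp
          (continuous_subtype_val.prodMk continuous_const)).continuousWithinAt
      · intro x hx
        have h1 := congrArg Subtype.val ((hbas x).basis.sum_repr (f' x j))
        rw [← h1]
        simp [Basis.toMatrix_apply, FramedStabilizer.frame₀]
    simp only [Basis.det_apply]
    refine ContinuousAt.comp_continuousWithinAt (g := Matrix.det)
      (Continuous.matrix_det continuous_id).continuousAt ?_
    exact continuousWithinAt_pi.2 fun i => continuousWithinAt_pi.2 fun j => hent i j
  have hκc : ContinuousWithinAt κ N x₀ :=
    ((hcc x₀ hxN).mul (hdetc.mul continuousWithinAt_const)).congr hform (hform x₀ hxN)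
  exact hκc.continuousAt (hNo.mem_nhds hxN)

set_option maxHeartbeats 800000 in
/-- The orientation transport in terms of a framed stabilizer. -/
theorem IsOrientationTransport.eq_sign {hab : a < b} (F : FramedStabilizer ι a b ε T) (hε : 0 < ε)
    (hι : Function.Injective ι) (hc : IsCompactOperator ι)
    (hsa : ∀ t ∈ Set.Icc a b, IsSA ι (T t))
    (ha : ∀ c ∈ Set.Ioc 0 ε, Function.Bijective (T a + c • ι))
    (hb : ∀ c ∈ Set.Ioc 0 ε, Function.Bijective (T b + c • ι)) {s : ℝ}
    (hs : IsOrientationTransport ι a b hab T s) : s = Real.sign (F.D a ε * F.D b ε) := by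
  obtain ⟨φ, hφ, x, hx, rfl⟩ := hs
  choose d hd0 hd hiso using F.exists_leadingCoeff hε hι hc hsa
  set A : Set.Icc a b := ⟨a, Set.left_mem_Icc.2 hab.le⟩ with hA
  set B : Set.Icc a b := ⟨b, Set.right_mem_Icc.2 hab.le⟩ with hB
  -- The coordinate of the trivializing section in the global frame. It is continuous and nowhere
  -- zero, so it has the same sign at both ends.
  set κ : Set.Icc a b → ℝ :=
    fun t => (-1) ^ (F.n * (F.n + 1) / 2) * Psi ι (T t) (φ t 1) / d t with hκ
  have hsec : ContinuousStabSection (fun t : Set.Icc a b => T t) (fun _ => F.K) Set.univ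
      (fun t => stabIso (T t) F.K (φ t 1)) :=
    hφ F.n (fun _ => F.K) Set.univ isOpen_univ ⟨continuousOn_const, fun t _ => F.surj₀ hε t⟩
  have hκc : Continuous κ := F.continuous_coord hε hι hc hsa hsec fun t => hiso t (φ t 1)
  have hPne : ∀ t : Set.Icc a b, Psi ι (T t) (φ t 1) ≠ 0 := by
    intro t h0
    have h1 := ((hsa t t.2).Psi_bijective hι hc).1 (h0.trans (map_zero _).symm)
    exact one_ne_zero ((map_eq_zero_iff _ (φ t).injective).1 h1)
  have hκ0 : ∀ t, κ t ≠ 0 := fun t =>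
    div_ne_zero (mul_ne_zero (pow_ne_zero _ (by norm_num)) (hPne t)) (hd0 t)
  have hconn : PreconnectedSpace (Set.Icc a b) :=
    Subtype.preconnectedSpace Set.ordConnected_Icc.isPreconnected
  have hpos := mul_pos_of_continuous_of_ne_zero hκc hκ0 A B
  have hda := F.leadingCoeff_mul_D_pos hε hι hc hsa A.2 ha (hd0 A) (hd A)
  have hdb := F.leadingCoeff_mul_D_pos hε hι hc hsa B.2 hb (hd0 B) (hd B)
  set r := (φ A).symm x with hr
  have hφr : ∀ t : Set.Icc a b, Psi ι (T t) (φ t r) = r * Psi ι (T t) (φ t 1) := by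
    intro t
    have h1 : φ t r = r • φ t 1 := by
      rw [← LinearEquiv.map_smul, smul_eq_mul, mul_one]
    exact (congrArg (Psi ι (T t)) h1).trans ((Psi ι (T t)).map_smul r (φ t 1))
  have hxa : r * Psi ι (T a) (φ A 1) = 1 :=
    (hφr A).symm.trans ((congrArg (Psi ι (T a)) ((φ A).apply_symm_apply x)).trans hx)
  have hsq : ((-1 : ℝ) ^ (F.n * (F.n + 1) / 2)) * (-1) ^ (F.n * (F.n + 1) / 2) = 1 := by
    rw [← mul_pow]; norm_num
  exact (congrArg Real.sign (hφr B)).trans (sign_mul_eq_sign_mul hsq hpos hda hdb hxa)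

end Transport

/-! ### Crossings -/

section SignChange

open Filter Topology

/-- The sign of a product of the boundary values of a function with finitely many zeros of finite
order. -/
lemma mul_mul_neg_one_pow_pos {a b : ℝ} (hab : a ≤ b) (k : ℝ → ℕ) (Z : Finset ℝ) :
    ∀ g : ℝ → ℝ, ContinuousOn g (Set.Icc a b) → (∀ t ∈ Set.Icc a b, t ∉ Z → g t ≠ 0) →
      (∀ z ∈ Z, z ∈ Set.Ioo a b ∧
        ∃ L ≠ 0, Tendsto (fun t => g t / (t - z) ^ k z) (𝓝[≠] z) (𝓝 L)) →
      0 < g a * g b * (-1) ^ ∑ z ∈ Z, k z := by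
  classical
  induction Z using Finset.induction_on with
  | empty =>
    intro g hg h0 _
    simpa using mul_pos_of_continuousOn_of_ne_zero Set.ordConnected_Icc hg
      (fun x hx => h0 x hx (Finset.notMem_empty x)) ⟨le_rfl, hab⟩ ⟨hab, le_rfl⟩
  | insert z Z hz ih =>
    intro g hg h0 hZ
    obtain ⟨hzI, L, hL0, hL⟩ := hZ z (Finset.mem_insert_self z Z)
    -- One zero is divided out, the limit `L ≠ 0` filling the gap; the quotient has one zero fewer.
    set g₁ : ℝ → ℝ := Function.update (fun t => g t / (t - z) ^ k z) z L with hg₁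
    have hne : ∀ t, t ≠ z → g₁ t = g t / (t - z) ^ k z := fun t ht => by
      rw [hg₁, Function.update_of_ne ht]
    have hmul : ∀ t, t ≠ z → g t = g₁ t * (t - z) ^ k z := fun t ht => by
      rw [hne t ht, div_mul_cancel₀ _ (pow_ne_zero _ (sub_ne_zero.2 ht))]
    have h1 : 0 < g₁ a * g₁ b * (-1) ^ ∑ z ∈ Z, k z := by
      refine ih g₁ ?_ ?_ ?_
      · intro t ht
        rcases eq_or_ne t z with rfl | htz
        · exact (continuousAt_update_same.2 hL).continuousWithinAt
        · rw [hg₁, continuousWithinAt_update_of_ne htz]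
          exact (hg t ht).div (by fun_prop) (pow_ne_zero _ (sub_ne_zero.2 htz))
      · intro t ht htZ
        rcases eq_or_ne t z with rfl | htz
        · rw [hg₁, Function.update_self]; exact hL0
        · rw [hne t htz]
          exact div_ne_zero (h0 t ht (by simp [htz, htZ])) (pow_ne_zero _ (sub_ne_zero.2 htz))
      · intro y hy
        have hyz : y ≠ z := fun h => hz (h ▸ hy)
        obtain ⟨hyI, M, hM0, hM⟩ := hZ y (Finset.mem_insert_of_mem hy)
        refine ⟨hyI, M / (y - z) ^ k z,
          div_ne_zero hM0 (pow_ne_zero _ (sub_ne_zero.2 hyz)), ?_⟩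
        have hc : Tendsto (fun t => (t - z) ^ k z) (𝓝[≠] y) (𝓝 ((y - z) ^ k z)) := by
          have : Continuous fun t : ℝ => (t - z) ^ k z := by fun_prop
          exact (this.tendsto y).mono_left nhdsWithin_le_nhds
        refine (hM.div hc (pow_ne_zero _ (sub_ne_zero.2 hyz))).congr' ?_
        filter_upwards [nhdsWithin_le_nhds (isOpen_ne.mem_nhds hyz)] with t ht
        rw [hne t ht]
        exact div_right_comm _ _ _
    rw [Finset.sum_insert hz, hmul a hzI.1.ne, hmul b hzI.2.ne', pow_add]
    have h2 : 0 < ((z - a) * (b - z)) ^ k z :=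
      pow_pos (mul_pos (sub_pos.2 hzI.1) (sub_pos.2 hzI.2)) _
    -- As `z` lies strictly between `a` and `b`, the factor divided out has values at the ends whose
    -- product has sign `(-1)^k`.
    have h3 : (a - z) ^ k z * (b - z) ^ k z * (-1) ^ k z = ((z - a) * (b - z)) ^ k z := by
      rw [← mul_pow, ← mul_pow]
      congr 1
      ring
    calc 0 < (g₁ a * g₁ b * (-1) ^ ∑ z ∈ Z, k z) * ((z - a) * (b - z)) ^ k z := mul_pos h1 h2
      _ = _ := by rw [← h3]; ring

/-- A nonzero leading coefficient isolates each zero, while infinitely many zeros would accumulate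
at a zero by compactness. -/
lemma finite_zeros_of_tendsto_div_pow {a b : ℝ} {g : ℝ → ℝ} (hg : ContinuousOn g (Set.Icc a b))
    (h : ∀ z ∈ Set.Icc a b, g z = 0 →
      ∃ (k : ℕ) (L : ℝ), L ≠ 0 ∧ Tendsto (fun t => g t / (t - z) ^ k) (𝓝[≠] z) (𝓝 L)) :
    {t ∈ Set.Icc a b | g t = 0}.Finite := by
  have hcl : IsCompact {t ∈ Set.Icc a b | g t = 0} := by
    have : IsClosed (Set.Icc a b ∩ g ⁻¹' {0}) :=
      hg.preimage_isClosed_of_isClosed isClosed_Icc isClosed_singleton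
    exact isCompact_Icc.of_isClosed_subset this fun t ht => ht.1
  by_contra hinf
  obtain ⟨z, hz, hacc⟩ := (Set.not_finite.1 hinf).exists_accPt_of_subset_isCompact hcl le_rfl
  obtain ⟨k, L, hL0, hL⟩ := h z hz.1 hz.2
  have hev : ∀ᶠ t in 𝓝[≠] z, g t ≠ 0 := by
    filter_upwards [hL.eventually_ne hL0] with t ht h0
    exact ht (by rw [h0, zero_div])
  obtain ⟨t, ht1, ht2⟩ := ((accPt_iff_frequently_nhdsNE.1 hacc).and_eventually hev).exists
  exact ht2 ht1.2

end SignChange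

/-! ### Parity of the signature. -/

section Signature

/-- The dimension of an eigenspace is the number of indices with that eigenvalue, so the sum has
finite support and counts indices. -/
lemma finsum_finrank_eigenspace {N : Type*} [NormedAddCommGroup N] [InnerProductSpace ℝ N]
    [FiniteDimensional ℝ N] {S : End ℝ N} (hS : LinearMap.IsSymmetric S) (A : Set ℝ)
    [DecidablePred (· ∈ A)] :
    ∑ᶠ μ ∈ A, (finrank ℝ (End.eigenspace S μ) : ℤ) =
      ((Finset.univ.filter fun i => hS.eigenvalues rfl i ∈ A).card : ℤ) := by
  classical
  set s := Finset.univ.filter fun i => hS.eigenvalues rfl i ∈ A with hs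
  have hcard : ∀ μ, (finrank ℝ (End.eigenspace S μ) : ℤ) =
      ((Finset.univ.filter fun i => hS.eigenvalues rfl i = μ).card : ℤ) := fun μ => by
    have := hS.card_filter_eigenvalues_eq rfl μ
    simp only [RCLike.ofReal_real_eq_id, id] at this
    rw [this]
  rw [finsum_mem_eq_sum_of_inter_support_eq _ (t := s.image (hS.eigenvalues rfl)),
    Finset.card_eq_sum_card_image (hS.eigenvalues rfl) s, Nat.cast_sum]
  · refine Finset.sum_congr rfl fun μ hμ => ?_
    rw [hcard μ]
    congr 2
    ext i
    obtain ⟨j, hj, rfl⟩ := Finset.mem_image.1 hμ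
    simp only [hs, Finset.mem_filter, Finset.mem_univ, true_and] at hj ⊢
    exact ⟨fun h => ⟨h ▸ hj, h⟩, fun h => h.2⟩
  · ext μ
    simp only [Set.mem_inter_iff, Function.mem_support, hcard, Finset.coe_image, Set.mem_image,
      Finset.mem_coe, hs, Finset.mem_filter, Finset.mem_univ, true_and]
    refine and_congr_left fun h => ⟨fun hμ => ?_, ?_⟩
    · obtain ⟨i, hi⟩ := Finset.card_pos.1 (Nat.pos_of_ne_zero (Nat.cast_ne_zero.1 h))
      have hi' := (Finset.mem_filter.1 hi).2
      exact ⟨i, hi' ▸ hμ, hi'⟩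
    · rintro ⟨i, hi, rfl⟩
      exact hi

/-- The signature of a nondegenerate form has the parity of the dimension. -/
lemma neg_one_zpow_signature {N : Type*} [NormedAddCommGroup N] [InnerProductSpace ℝ N]
    [FiniteDimensional ℝ N] {S : End ℝ N} (hS : LinearMap.IsSymmetric S)
    (hinj : Function.Injective S) : (-1 : ℝ) ^ signature S = (-1) ^ finrank ℝ N := by
  classical
  rw [signature, finsum_finrank_eigenspace hS, finsum_finrank_eigenspace hS]
  have hne : ∀ i, hS.eigenvalues rfl i ≠ 0 := by
    intro i h0
    have h1 := (hS.hasEigenvalue_eigenvalues rfl i)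
    rw [h0] at h1
    obtain ⟨v, hv, hv0⟩ := h1.exists_hasEigenvector
    rw [End.mem_eigenspace_iff] at hv
    refine hv0 (hinj ?_)
    rw [hv, map_zero]
    simp
  have hcompl : Finset.univ.filter (fun i => hS.eigenvalues rfl i ∈ Set.Iio (0 : ℝ)) =
      Finset.univ.filter fun i => ¬ hS.eigenvalues rfl i ∈ Set.Ioi (0 : ℝ) := by
    ext i
    simp only [Finset.mem_filter, Finset.mem_univ, true_and, Set.mem_Iio, Set.mem_Ioi, not_lt]
    exact ⟨le_of_lt, fun h => lt_of_le_of_ne h (hne i)⟩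
  have hsum := Finset.card_filter_add_card_filter_not (s := Finset.univ)
    (fun i => hS.eigenvalues rfl i ∈ Set.Ioi (0 : ℝ))
  rw [← hcompl, Finset.card_univ, Fintype.card_fin] at hsum
  set p := (Finset.univ.filter fun i => hS.eigenvalues rfl i ∈ Set.Ioi (0 : ℝ)).card
  set q := (Finset.univ.filter fun i => hS.eigenvalues rfl i ∈ Set.Iio (0 : ℝ)).card
  -- With `p + q` the dimension, `p - q` has the same parity.
  rw [← hsum, sub_eq_add_neg, zpow_add₀ (by norm_num), pow_add, zpow_natCast, zpow_neg, zpow_natCast]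
  congr 1
  rw [inv_eq_iff_eq_inv, ← inv_pow]
  norm_num

end Signature

/-! ### The crossing operator -/

section Crossing

open Filter Topology

variable {W H : Type*}
  [NormedAddCommGroup W] [InnerProductSpace ℝ W]
  [NormedAddCommGroup H] [InnerProductSpace ℝ H]
  {ι : W →L[ℝ] H} {a b : ℝ} {T : ℝ → W →L[ℝ] H}

lemma inner_crossingOp (hι : Function.Injective ι) (t : ℝ) [FiniteDimensional ℝ (T t).ker]
    {x y : W} (hx : x ∈ (T t).ker) (hy : y ∈ (T t).ker) :
    inner ℝ (crossingOp ι hι a b T t ⟨ι x, x, hx, rfl⟩ : kerH ι (T t)) ⟨ι y, y, hy, rfl⟩ =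
      inner ℝ (derivWithin T (Set.Icc a b) t x) (ι y) := by
  have hp : (kerH ι (T t)).HasOrthogonalProjection := inferInstance
  have h1 : (Submodule.equivMapOfInjective ι.toLinearMap hι (T t).ker).symm ⟨ι x, x, hx, rfl⟩ =
      ⟨x, hx⟩ := by
    rw [LinearEquiv.symm_apply_eq]
    rfl
  rw [crossingOp, dif_pos hp]
  simp only [LinearMap.comp_apply, LinearEquiv.coe_coe, h1, Submodule.subtype_apply]
  exact Submodule.inner_orthogonalProjectionOnto_eq_of_mem_right _ _

/-- The crossing operator represents the crossing form `⟨T'x, ι y⟩` on the kernel, so bijectivity is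
nondegeneracy of this form. -/
lemma bijective_crossingOp_iff (hι : Function.Injective ι) (t : ℝ)
    [FiniteDimensional ℝ (T t).ker] :
    Function.Bijective (crossingOp ι hι a b T t) ↔
      ∀ x ∈ (T t).ker,
        (∀ y ∈ (T t).ker, inner ℝ (derivWithin T (Set.Icc a b) t x) (ι y) = 0) → x = 0 := by
  have hbij : Function.Bijective (crossingOp ι hι a b T t) ↔
      Function.Injective (crossingOp ι hι a b T t) :=
    ⟨fun h => h.1, fun h => ⟨h, LinearMap.injective_iff_surjective.1 h⟩⟩
  rw [hbij, injective_iff_map_eq_zero]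
  constructor
  · intro h x hx hxy
    have h1 := h ⟨ι x, x, hx, rfl⟩ <| by
      refine ext_inner_right ℝ ?_
      rintro ⟨_, y, hy, rfl⟩
      rw [inner_zero_left]
      exact (inner_crossingOp hι t hx hy).trans (hxy y hy)
    exact hι ((congrArg Subtype.val h1).trans (map_zero ι).symm)
  · rintro h ⟨_, x, hx, rfl⟩ h0
    refine Subtype.ext ?_
    change ι x = 0
    rw [h x hx, map_zero]
    intro y hy
    rw [← inner_crossingOp hι t hx hy]
    exact (congrArg (fun z => inner ℝ z _) h0).trans (inner_zero_left _)

/-- The symmetry relation of `T_t` is differentiated within the interval, where derivatives are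
unique even at the end points. -/
lemma inner_deriv_symm (hab : a < b) (hsa : ∀ t ∈ Set.Icc a b, IsSA ι (T t)) {t : ℝ}
    (ht : t ∈ Set.Icc a b) {J : W →L[ℝ] H} (hJ : HasDerivWithinAt T J (Set.Icc a b) t) (x y : W) :
    inner ℝ (J x) (ι y) = inner ℝ (ι x) (J y) := by
  have h1 : HasDerivWithinAt (fun t => inner ℝ (T t x) (ι y)) (inner ℝ (J x) (ι y))
      (Set.Icc a b) t := by
    have := (hJ.clm_apply (hasDerivWithinAt_const t (Set.Icc a b) x)).inner ℝ
      (hasDerivWithinAt_const t (Set.Icc a b) (ι y))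
    simpa using this
  have h2 : HasDerivWithinAt (fun t => inner ℝ (ι x) (T t y)) (inner ℝ (ι x) (J y))
      (Set.Icc a b) t := by
    have := (hasDerivWithinAt_const t (Set.Icc a b) (ι x)).inner ℝ
      (hJ.clm_apply (hasDerivWithinAt_const t (Set.Icc a b) y))
    simpa using this
  have h3 := h1.congr (fun s hs => ((hsa s hs).symm x y).symm) ((hsa t ht).symm x y).symm
  exact (uniqueDiffOn_Icc hab t ht).eq_deriv _ h3 h2

lemma isSymmetric_crossingOp (hab : a < b) (hι : Function.Injective ι)
    (hsa : ∀ t ∈ Set.Icc a b, IsSA ι (T t)) {t : ℝ} (ht : t ∈ Set.Icc a b)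
    (hT : DifferentiableWithinAt ℝ T (Set.Icc a b) t) [FiniteDimensional ℝ (T t).ker] :
    LinearMap.IsSymmetric (crossingOp ι hι a b T t) := by
  rintro ⟨_, x, hx, rfl⟩ ⟨_, y, hy, rfl⟩
  refine (inner_crossingOp hι t hx hy).trans ?_
  rw [inner_deriv_symm hab hsa ht hT.hasDerivWithinAt, real_inner_comm,
    ← inner_crossingOp hι t hy hx, real_inner_comm]
  rfl

lemma derivWithin_shift (ε t : ℝ) :
    derivWithin (shift ι T ε) (Set.Icc a b) t = derivWithin T (Set.Icc a b) t := by
  unfold shift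
  exact derivWithin_add_const _

lemma finrank_kerH (hι : Function.Injective ι) (S : W →L[ℝ] H) :
    finrank ℝ (kerH ι S) = finrank ℝ S.ker :=
  (Submodule.equivMapOfInjective ι.toLinearMap hι S.ker).finrank_eq.symm

variable [CompleteSpace W] [CompleteSpace H] {ε : ℝ}

/-- At a nondegenerate crossing, the determinant has a zero whose order is the dimension of
the kernel. -/
lemma FramedStabilizer.exists_tendsto_D (F : FramedStabilizer ι a b ε T) (hε : 0 ≤ ε)
    (hι : Function.Injective ι) (hc : IsCompactOperator ι)
    (hsa : ∀ t ∈ Set.Icc a b, IsSA ι (T t)) {z : ℝ} (hz : z ∈ Set.Ioo a b)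
    (hT : DifferentiableWithinAt ℝ T (Set.Icc a b) z)
    (hbij : Function.Bijective (crossingOp ι hι a b (shift ι T ε) z)) :
    ∃ L ≠ 0, Tendsto (fun t => F.D t ε / (t - z) ^ finrank ℝ (T z + ε • ι).ker)
      (𝓝[≠] z) (𝓝 L) := by
  have hzI : z ∈ Set.Icc a b := Set.Ioo_subset_Icc_self hz
  have hεI : ε ∈ Set.Icc 0 ε := ⟨hε, le_rfl⟩
  have hSA := (hsa z hzI).add_smul ε
  have hfd := hSA.finiteDimensional_ker hι hc
  have hK := F.surj z hzI ε hεI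
  have hmap : Tendsto (fun t : ℝ => t - z) (𝓝[≠] z) (𝓝[≠] 0) := by
    refine tendsto_nhdsWithin_iff.2 ⟨?_, ?_⟩
    · have : Continuous fun t : ℝ => t - z := by fun_prop
      exact ((this.tendsto z).mono_left nhdsWithin_le_nhds).trans_eq (by simp)
    · filter_upwards [self_mem_nhdsWithin] with t ht using sub_ne_zero.2 ht
  have hmap' : Tendsto (fun σ : ℝ => z + σ) (𝓝[≠] 0) (𝓝[≠] z) := by
    refine tendsto_nhdsWithin_iff.2 ⟨?_, ?_⟩
    · have : Continuous fun σ : ℝ => z + σ := by fun_prop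
      exact ((this.tendsto 0).mono_left nhdsWithin_le_nhds).trans_eq (by simp)
    · filter_upwards [self_mem_nhdsWithin] with t ht
      simpa using ht
  have hder : HasDerivAt T (derivWithin T (Set.Icc a b) z) z :=
    hT.hasDerivWithinAt.hasDerivAt (Icc_mem_nhds hz.1 hz.2)
  obtain ⟨d, hd0, hd⟩ := hSA.exists_tendsto_det hι hc hK (stdBasis F.n)
    (f₀ := fun i => ⟨F.f z ε i, F.mem z hzI ε hεI i⟩)
    (hSA.isBasis_frame hι hc hK (F.li z hzI ε hεI)) (l := 𝓝[≠] 0)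
    (Sσ := fun σ => T (z + σ) + ε • ι) (J := derivWithin T (Set.Icc a b) z)
    (by
      have h1 := (hasDerivAt_iff_tendsto_slope.1 hder).comp hmap'
      refine h1.congr fun σ => ?_
      simp [slope, Function.comp_apply])
    (by
      -- If `T'x = S w`, then `⟨T'x, ι y⟩ = ⟨ι w, S y⟩ = 0` for all `y ∈ ker S`, contradicting
      -- nondegeneracy unless `x = 0`.
      rintro x hx ⟨w, hw⟩
      refine (@bijective_crossingOp_iff _ _ _ _ _ _ ι a b (shift ι T ε) hι z hfd).1 hbij x hx fun y hy => ?_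
      rw [derivWithin_shift]
      have hw' : (T z + ε • ι) w = derivWithin T (Set.Icc a b) z x := hw
      have hy' : (T z + ε • ι) y = 0 := hy
      rw [← hw', hSA.symm, hy', inner_zero_right])
    (f := fun σ => F.f (z + σ) ε)
    (by
      filter_upwards [hmap' (nhdsWithin_le_nhds (Icc_mem_nhds hz.1 hz.2))] with σ hσ i
      exact mem_ker_stab ⟨_, F.mem _ hσ ε hεI i⟩)
    (by
      intro i
      have h1 : Continuous fun t => F.f t ε i := (F.cont i).comp (Continuous.prodMk_left ε)
      exact ((h1.tendsto z).mono_left nhdsWithin_le_nhds).comp hmap')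
  refine ⟨d, hd0, (hd.comp hmap).congr fun t => ?_⟩
  simp only [Function.comp_apply, add_sub_cancel, F.D_def]

lemma neg_one_zpow_finset_sum {α : Type*} (s : Finset α) (f : α → ℤ) :
    (-1 : ℝ) ^ ∑ i ∈ s, f i = ∏ i ∈ s, (-1 : ℝ) ^ f i := by
  classical
  induction s using Finset.induction_on with
  | empty => simp
  | insert i s hi ih =>
    rw [Finset.sum_insert hi, Finset.prod_insert hi, zpow_add₀ (by norm_num), ih]

lemma signature_of_subsingleton {N : Type*} [AddCommGroup N] [Module ℝ N] [Subsingleton N]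
    (S : End ℝ N) : signature S = 0 := by
  have : ∀ μ, finrank ℝ (End.eigenspace S μ) = 0 := fun μ => finrank_zero_of_subsingleton
  simp [signature, this]

attribute [local irreducible] FramedStabilizer.D

/-- The parity of the number of crossings in terms of a framed stabilizer. -/
theorem FramedStabilizer.sign_eq_neg_one_zpow (F : FramedStabilizer ι a b ε T) (hε : 0 ≤ ε)
    (hab : a < b) (hι : Function.Injective ι) (hc : IsCompactOperator ι)
    (hsa : ∀ t ∈ Set.Icc a b, IsSA ι (T t)) (hT : DifferentiableOn ℝ T (Set.Icc a b))
    (ha : (T a + ε • ι).ker = ⊥) (hb : (T b + ε • ι).ker = ⊥)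
    (htr : IsTransversal ι hι a b (shift ι T ε)) :
    Real.sign (F.D a ε * F.D b ε) =
      (-1) ^ ∑ᶠ t ∈ Set.Ioo a b, signature (crossingOp ι hι a b (shift ι T ε) t) := by
  have hεI : ε ∈ Set.Icc 0 ε := ⟨hε, le_rfl⟩
  have haI : a ∈ Set.Icc a b := ⟨le_rfl, hab.le⟩
  have hbI : b ∈ Set.Icc a b := ⟨hab.le, le_rfl⟩
  have hDa : F.D a ε ≠ 0 := (F.D_ne_zero_iff hι hc hsa haI hεI).2 ha
  have hDb : F.D b ε ≠ 0 := (F.D_ne_zero_iff hι hc hsa hbI hεI).2 hb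
  have hcont : Continuous fun t => F.D t ε := F.continuous_D.comp (Continuous.prodMk_left ε)
  have hIoo : ∀ z ∈ Set.Icc a b, F.D z ε = 0 → z ∈ Set.Ioo a b := by
    rintro z ⟨h1, h2⟩ h0
    refine ⟨lt_of_le_of_ne h1 ?_, lt_of_le_of_ne h2 ?_⟩
    · rintro rfl; exact hDa h0
    · rintro rfl; exact hDb h0
  have hlim := fun z (hz : z ∈ Set.Ioo a b) => F.exists_tendsto_D hε hι hc hsa hz
    (hT z (Set.Ioo_subset_Icc_self hz)) (htr z (Set.Ioo_subset_Icc_self hz))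
  have hfin := finite_zeros_of_tendsto_div_pow (a := a) (b := b) (g := fun t => F.D t ε)
    hcont.continuousOn fun z hz h0 => ⟨_, hlim z (hIoo z hz h0)⟩
  set Z := hfin.toFinset with hZ
  have hmemZ : ∀ z, z ∈ Z ↔ z ∈ Set.Icc a b ∧ F.D z ε = 0 := fun z => by
    simp only [hZ, Set.Finite.mem_toFinset, Set.mem_ofPred_eq]
  have hpos := mul_mul_neg_one_pow_pos hab.le (fun z => finrank ℝ (T z + ε • ι).ker) Z
    (fun t => F.D t ε) hcont.continuousOn
    (fun t ht htZ h0 => htZ ((hmemZ t).2 ⟨ht, h0⟩))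
    (fun z hz => ⟨hIoo z ((hmemZ z).1 hz).1 ((hmemZ z).1 hz).2,
      hlim z (hIoo z ((hmemZ z).1 hz).1 ((hmemZ z).1 hz).2)⟩)
  -- Away from the zeros of `D(·, ε)` the kernel is trivial and the signature is zero.
  have hsum : ∑ᶠ t ∈ Set.Ioo a b, signature (crossingOp ι hι a b (shift ι T ε) t) =
      ∑ t ∈ Z, signature (crossingOp ι hι a b (shift ι T ε) t) := by
    refine finsum_mem_eq_sum_of_inter_support_eq _ ?_
    ext z
    simp only [Set.mem_inter_iff, Finset.mem_coe]
    refine and_congr_left fun hsupp => ⟨fun hz => ?_, fun hz => ?_⟩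
    · refine (hmemZ z).2 ⟨Set.Ioo_subset_Icc_self hz, ?_⟩
      by_contra h0
      have hker := (F.D_ne_zero_iff hι hc hsa (Set.Ioo_subset_Icc_self hz) hεI).1 h0
      have hk : kerH ι (shift ι T ε z) = ⊥ := by
        rw [kerH, shift, hker, Submodule.map_bot]
      have : Subsingleton (kerH ι (shift ι T ε z)) := by rw [hk]; infer_instance
      exact hsupp (signature_of_subsingleton _)
    · exact hIoo z ((hmemZ z).1 hz).1 ((hmemZ z).1 hz).2
  have hsign : (-1 : ℝ) ^ ∑ t ∈ Z, signature (crossingOp ι hι a b (shift ι T ε) t) =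
      (-1) ^ ∑ z ∈ Z, finrank ℝ (T z + ε • ι).ker := by
    rw [neg_one_zpow_finset_sum, ← Finset.prod_pow_eq_pow_sum]
    refine Finset.prod_congr rfl fun z hz => ?_
    have hzI := ((hmemZ z).1 hz).1
    have hSA : ∀ t ∈ Set.Icc a b, IsSA ι (shift ι T ε t) := fun t ht => (hsa t ht).add_smul ε
    have hfd := (hSA z hzI).finiteDimensional_ker hι hc
    rw [neg_one_zpow_signature (isSymmetric_crossingOp hab hι hSA hzI
      ((hT z hzI).add_const _)) (htr z hzI).1, finrank_kerH hι]
    rfl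
  rw [hsum, hsign]
  rcases neg_one_pow_eq_or ℝ (∑ z ∈ Z, finrank ℝ (T z + ε • ι).ker) with h | h
  · rw [h, mul_one] at hpos
    rw [h, Real.sign_of_pos hpos]
  · rw [h, mul_neg_one, neg_pos] at hpos
    rw [h, Real.sign_of_neg hpos]

/-- The operators `T_t + c` are invertible for small `c > 0`. -/
lemma exists_pos_bijective_add_smul (hab : a ≤ b) (hι : Function.Injective ι)
    (hc : IsCompactOperator ι) (hT : ContinuousOn T (Set.Icc a b))
    (hsa : ∀ t ∈ Set.Icc a b, IsSA ι (T t)) {t : ℝ} (ht : t ∈ Set.Icc a b) :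
    ∃ δ > 0, ∀ c ∈ Set.Ioc (0 : ℝ) δ, Function.Bijective (T t + c • ι) := by
  obtain ⟨F⟩ := exists_framedStabilizer hι hc hab zero_le_one hT hsa
  obtain ⟨d, hd0, hd, -⟩ := F.exists_leadingCoeff one_pos hι hc hsa ⟨t, ht⟩
  have hev : ∀ᶠ c : ℝ in 𝓝[>] 0, Function.Bijective (T t + c • ι) := by
    filter_upwards [hd.eventually_ne hd0, Icc_mem_nhdsGT one_pos] with c h1 h2
    refine (((hsa t ht).add_smul c).bijective_iff hι hc).2
      ((F.D_ne_zero_iff hι hc hsa ht h2).1 fun h0 => h1 ?_)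
    exact (congrArg (· / _) h0).trans (zero_div _)
  obtain ⟨δ, hδ, hsub⟩ := mem_nhdsGT_iff_exists_Ioc_subset.1 hev
  exact ⟨δ, hδ, fun c hc => hsub hc⟩

end Crossing

/-! ### Definite subspaces of symmetric bilinear forms -/

section Definite

variable {N : Type*} [AddCommGroup N] [Module ℝ N]

lemma apply_add_self_of_mem_ker {B : LinearMap.BilinForm ℝ N} (hB : B.IsSymm) {x k : N}
    (hk : k ∈ LinearMap.ker B) : B (x + k) (x + k) = B x x := by
  have h1 : B k = 0 := LinearMap.mem_ker.1 hk
  have h2 : B x k = 0 := by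
    rw [← hB.eq k x, h1]
    rfl
  simp [h1, h2]

variable [FiniteDimensional ℝ N]

/-- In an orthogonal basis the form is diagonal; the basis vectors are sorted by the sign of their
diagonal entry. -/
lemma exists_definite_subspaces {B : LinearMap.BilinForm ℝ N} (hB : B.IsSymm) :
    ∃ P Q : Submodule ℝ N, (∀ x ∈ P, x ≠ 0 → B x x < 0) ∧ (∀ x ∈ Q, x ≠ 0 → 0 < B x x) ∧
      finrank ℝ N ≤ finrank ℝ P + finrank ℝ Q + finrank ℝ (LinearMap.ker B) := by
  obtain ⟨v, hv⟩ := LinearMap.BilinForm.exists_orthogonal_basis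
    (LinearMap.BilinForm.isSymm_iff.1 hB)
  rw [LinearMap.isOrthoᵢ_def] at hv
  have hdiag : ∀ x, B x x = ∑ i, v.repr x i * v.repr x i * B (v i) (v i) := by
    intro x
    have h1 : ∀ j, B x (v j) = v.repr x j * B (v j) (v j) := by
      intro j
      conv_lhs => rw [← v.sum_repr x]
      rw [map_sum, LinearMap.sum_apply, Finset.sum_eq_single j]
      · simp
      · intro i _ hij
        simp [hv i j hij]
      · simp
    have h2 : B x x = B x (∑ i, v.repr x i • v i) := by rw [v.sum_repr x]
    rw [h2, map_sum]
    refine Finset.sum_congr rfl fun i _ => ?_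
    rw [map_smul, smul_eq_mul, h1, mul_assoc]
  have hsupp : ∀ s : Set (Fin (finrank ℝ N)), ∀ x ∈ Submodule.span ℝ (v '' s), ∀ i,
      v.repr x i ≠ 0 → i ∈ s := by
    intro s x hx i hi
    exact v.mem_span_image.1 hx (Finsupp.mem_support_iff.2 hi)
  have hex : ∀ x, x ≠ 0 → ∃ i, v.repr x i ≠ 0 := by
    intro x hx
    by_contra! h0
    exact hx (v.repr.injective (by ext i; simpa using h0 i))
  refine ⟨Submodule.span ℝ (v '' {i | B (v i) (v i) < 0}),
    Submodule.span ℝ (v '' {i | 0 < B (v i) (v i)}), ?_, ?_, ?_⟩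
  · intro x hx hx0
    obtain ⟨j, hj⟩ := hex x hx0
    rw [hdiag]
    refine Finset.sum_neg' (fun i _ => ?_) ⟨j, Finset.mem_univ _, ?_⟩
    · rcases eq_or_ne (v.repr x i) 0 with h0 | h0
      · simp [h0]
      · exact mul_nonpos_of_nonneg_of_nonpos (mul_self_nonneg _) (le_of_lt (hsupp _ x hx i h0))
    · exact mul_neg_of_pos_of_neg (mul_self_pos.2 hj) (hsupp _ x hx j hj)
  · intro x hx hx0
    obtain ⟨j, hj⟩ := hex x hx0
    rw [hdiag]
    refine Finset.sum_pos' (fun i _ => ?_) ⟨j, Finset.mem_univ _, ?_⟩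
    · rcases eq_or_ne (v.repr x i) 0 with h0 | h0
      · simp [h0]
      · exact mul_nonneg (mul_self_nonneg _) (le_of_lt (hsupp _ x hx i h0))
    · exact mul_pos (mul_self_pos.2 hj) (hsupp _ x hx j hj)
  · have htop : (⊤ : Submodule ℝ N) ≤ Submodule.span ℝ (v '' {i | B (v i) (v i) < 0}) ⊔
        Submodule.span ℝ (v '' {i | 0 < B (v i) (v i)}) ⊔ LinearMap.ker B := by
      rw [← v.span_eq, Submodule.span_le]
      rintro _ ⟨i, rfl⟩
      rcases lt_trichotomy (B (v i) (v i)) 0 with h | h | h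
      · exact Submodule.mem_sup_left (Submodule.mem_sup_left (Submodule.subset_span ⟨i, h, rfl⟩))
      · refine Submodule.mem_sup_right (LinearMap.mem_ker.2 (v.ext fun j => ?_))
        rcases eq_or_ne i j with rfl | hij
        · simpa using h
        · simpa using hv i j hij
      · exact Submodule.mem_sup_left (Submodule.mem_sup_right (Submodule.subset_span ⟨i, h, rfl⟩))
    exact (finrank_top ℝ N).symm.le.trans <| (Submodule.finrank_mono htop).trans ((Submodule.finrank_add_le_finrank_add_finrank _ _).trans
      (Nat.add_le_add_right (Submodule.finrank_add_le_finrank_add_finrank _ _) _))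

lemma finrank_sup_of_definite {B : LinearMap.BilinForm ℝ N} {P K : Submodule ℝ N}
    (hP : ∀ x ∈ P, x ≠ 0 → B x x ≠ 0) (hK : K ≤ LinearMap.ker B) :
    finrank ℝ (P ⊔ K : Submodule ℝ N) = finrank ℝ P + finrank ℝ K := by
  have h : P ⊓ K = ⊥ := by
    rw [Submodule.eq_bot_iff]
    rintro x ⟨hx1, hx2⟩
    by_contra h0
    refine hP x hx1 h0 ?_
    rw [LinearMap.mem_ker.1 (hK hx2), LinearMap.zero_apply]
  have := Submodule.finrank_sup_add_finrank_inf_eq P K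
  rwa [h, finrank_bot, add_zero] at this

/-- The kernel can be added to the negative as well as to the positive part; being counted twice, it
raises the sum of the dimensions above `dim N`. -/
lemma exists_semidefinite_subspaces {B : LinearMap.BilinForm ℝ N} (hB : B.IsSymm)
    (hker : LinearMap.ker B ≠ ⊥) :
    ∃ P Q : Submodule ℝ N, (∀ x ∈ P, B x x ≤ 0) ∧ (∀ x ∈ Q, 0 ≤ B x x) ∧
      finrank ℝ N + 1 ≤ finrank ℝ P + finrank ℝ Q := by
  obtain ⟨P, Q, hP, hQ, hdim⟩ := exists_definite_subspaces hB
  refine ⟨P ⊔ LinearMap.ker B, Q ⊔ LinearMap.ker B, ?_, ?_, ?_⟩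
  · intro x hx
    obtain ⟨y, hy, k, hk, rfl⟩ := Submodule.mem_sup.1 hx
    rw [apply_add_self_of_mem_ker hB hk]
    rcases eq_or_ne y 0 with rfl | h0
    · simp
    · exact (hP y hy h0).le
  · intro x hx
    obtain ⟨y, hy, k, hk, rfl⟩ := Submodule.mem_sup.1 hx
    rw [apply_add_self_of_mem_ker hB hk]
    rcases eq_or_ne y 0 with rfl | h0
    · simp
    · exact (hQ y hy h0).le
  · rw [finrank_sup_of_definite (fun x hx h0 => (hP x hx h0).ne) le_rfl,
      finrank_sup_of_definite (fun x hx h0 => (hQ x hx h0).ne') le_rfl]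
    have : 0 < finrank ℝ (LinearMap.ker B) := finrank_pos_iff_exists_ne_zero.2 <| by
      obtain ⟨x, hx, h0⟩ := (Submodule.ne_bot_iff _).1 hker
      exact ⟨⟨x, hx⟩, fun h => h0 (congrArg Subtype.val h)⟩
    omega

/-- If `q` is degenerate on the kernel of `m`, there are subspaces whose dimensions add up to more
than `dim N` on which `m + h q` is, to first order in `h > 0`, nonpositive and nonnegative,
respectively. -/
lemma exists_semidefinite_subspaces_of_pair {m q : LinearMap.BilinForm ℝ N} (hm : m.IsSymm)
    (hq : q.IsSymm)
    (hdeg : ∃ x ≠ 0, x ∈ LinearMap.ker m ∧ ∀ y ∈ LinearMap.ker m, q x y = 0) :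
    ∃ P Q : Submodule ℝ N,
      (∀ x ∈ P, m x x ≤ 0 ∧ (m x x = 0 → q x x ≤ 0)) ∧
      (∀ x ∈ Q, 0 ≤ m x x ∧ (m x x = 0 → 0 ≤ q x x)) ∧
      finrank ℝ N + 1 ≤ finrank ℝ P + finrank ℝ Q := by
  set K := LinearMap.ker m with hKdef
  obtain ⟨P, Q, hP, hQ, hdim⟩ := exists_definite_subspaces hm
  have hqK : (q.restrict K).IsSymm := hq.restrict K
  -- On `ker m` the sign is decided by `q`, whose restriction is degenerate by assumption; the
  -- pieces are added to the definite subspaces of `m`.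
  obtain ⟨P', Q', hP', hQ', hdim'⟩ := exists_semidefinite_subspaces hqK <| by
    obtain ⟨x, hx0, hx, hxq⟩ := hdeg
    refine (Submodule.ne_bot_iff _).2 ⟨⟨x, hx⟩, ?_, fun h => hx0 (congrArg Subtype.val h)⟩
    refine LinearMap.mem_ker.2 (LinearMap.ext fun y => ?_)
    exact hxq y y.2
  refine ⟨P ⊔ P'.map K.subtype, Q ⊔ Q'.map K.subtype, ?_, ?_, ?_⟩
  · intro x hx
    obtain ⟨y, hy, _, ⟨k, hk, rfl⟩, rfl⟩ := Submodule.mem_sup.1 hx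
    rw [Submodule.subtype_apply, apply_add_self_of_mem_ker hm k.2]
    rcases eq_or_ne y 0 with rfl | h0
    · refine ⟨by simp, fun _ => ?_⟩
      rw [zero_add]
      exact hP' k hk
    · exact ⟨(hP y hy h0).le, fun h => absurd h (hP y hy h0).ne⟩
  · intro x hx
    obtain ⟨y, hy, _, ⟨k, hk, rfl⟩, rfl⟩ := Submodule.mem_sup.1 hx
    rw [Submodule.subtype_apply, apply_add_self_of_mem_ker hm k.2]
    rcases eq_or_ne y 0 with rfl | h0
    · refine ⟨by simp, fun _ => ?_⟩
      rw [zero_add]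
      exact hQ' k hk
    · exact ⟨(hQ y hy h0).le, fun h => absurd h (hQ y hy h0).ne'⟩
  · rw [finrank_sup_of_definite (fun x hx h0 => (hP x hx h0).ne) (Submodule.map_subtype_le K P'),
      finrank_sup_of_definite (fun x hx h0 => (hQ x hx h0).ne') (Submodule.map_subtype_le K Q'),
      Submodule.finrank_map_subtype_eq, Submodule.finrank_map_subtype_eq]
    rw [← hKdef] at hdim
    omega

lemma exists_ne_zero_mem_of_finrank_lt {P Q : Submodule ℝ N}
    (h : finrank ℝ N < finrank ℝ P + finrank ℝ Q) : ∃ x ≠ 0, x ∈ P ∧ x ∈ Q := by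
  have h1 := Submodule.finrank_sup_add_finrank_inf_eq P Q
  have h2 : finrank ℝ (P ⊔ Q : Submodule ℝ N) ≤ finrank ℝ N := Submodule.finrank_le _
  have h3 : P ⊓ Q ≠ ⊥ := by
    intro h0
    rw [h0, finrank_bot] at h1
    omega
  obtain ⟨x, ⟨hx1, hx2⟩, h0⟩ := (Submodule.ne_bot_iff _).1 h3
  exact ⟨x, h0, hx1, hx2⟩

end Definite

/-! ### One-sided perturbation of semidefinite functions. -/

section Perturbation

open Filter Topology

/-- A nonpositive function on the unit sphere of a finite dimensional space becomes negative under
a perturbation `h R_h` whose limit is negative at the zeros. -/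
lemma eventually_forall_add_mul_neg {N : Type*} [NormedAddCommGroup N] [NormedSpace ℝ N]
    [FiniteDimensional ℝ N] {P : Submodule ℝ N} {m : N → ℝ} (hm : Continuous m) {l : Filter ℝ}
    (hl : l ≤ 𝓝[>] 0) {R : ℝ → N → ℝ} {R₀ : N → ℝ}
    (hR : ∀ x, Tendsto (fun z : ℝ × N => R z.1 z.2) (l ×ˢ 𝓝 x) (𝓝 (R₀ x)))
    (hle : ∀ x ∈ P, m x ≤ 0) (hneg : ∀ x ∈ P, x ≠ 0 → m x = 0 → R₀ x < 0) :
    ∀ᶠ h in l, ∀ x ∈ P, ‖x‖ = 1 → m x + h * R h x < 0 := by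
  have hK : IsCompact ((P : Set N) ∩ Metric.sphere 0 1) :=
    (isCompact_sphere (0 : N) 1).inter_left P.closed_of_finiteDimensional
  have hcov : ∀ x ∈ (P : Set N) ∩ Metric.sphere 0 1,
      ∀ᶠ z : ℝ × N in l ×ˢ 𝓝 x, z.2 ∈ P → m z.2 + z.1 * R z.1 z.2 < 0 := by
    rintro x ⟨hxP, hx1⟩
    have hx0 : x ≠ 0 := by
      rintro rfl
      simp at hx1
    have h1 : ∀ᶠ z : ℝ × N in l ×ˢ 𝓝 x, 0 < z.1 :=
      tendsto_fst.eventually (hl self_mem_nhdsWithin)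
    have hfst : Tendsto (fun z : ℝ × N => z.1) (l ×ˢ 𝓝 x) (𝓝 0) :=
      tendsto_fst.mono_right (hl.trans nhdsWithin_le_nhds)
    -- At a zero of `m` the perturbation is already negative nearby and `m ≤ 0` suffices; elsewhere
    -- `m` is negative and the perturbation is small. Compactness of the sphere makes the bound on
    -- `h` uniform.
    rcases eq_or_lt_of_le (hle x hxP) with h0 | h0
    · filter_upwards [h1, (hR x).eventually (gt_mem_nhds (hneg x hxP hx0 h0))] with z hz1 hz2 hz3
      exact add_neg_of_nonpos_of_neg (hle _ hz3) (mul_neg_of_pos_of_neg hz1 hz2)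
    · have h2 : Tendsto (fun z : ℝ × N => m z.2 + z.1 * R z.1 z.2) (l ×ˢ 𝓝 x)
          (𝓝 (m x + 0 * R₀ x)) :=
        ((hm.tendsto x).comp tendsto_snd).add (hfst.mul (hR x))
      rw [zero_mul, add_zero] at h2
      filter_upwards [h2.eventually (gt_mem_nhds h0)] with z hz _ using hz
  have hev := hK.mem_prod_nhdsSet_of_forall (l := l)
    (s := {z : ℝ × N | z.2 ∈ P → m z.2 + z.1 * R z.1 z.2 < 0}) hcov
  obtain ⟨A, hA, B, hB, hAB⟩ := mem_prod_iff.1 hev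
  filter_upwards [hA] with h hh x hxP hx1
  exact hAB (a := (h, x)) ⟨hh, subset_of_mem_nhdsSet hB ⟨hxP, by simpa using hx1⟩⟩ hxP

end Perturbation

/-! ### A covering argument for planar sets with small projection. -/

section NullSet

open MeasureTheory Filter Topology

/-- A planar set is small in the second direction if it satisfies, for every `η > 0`, a local
one-sided Lipschitz condition with constant `η`. -/
lemma volume_image_snd_eq_zero {a b : ℝ} {Z : Set (ℝ × ℝ)} (hZ : ∀ p ∈ Z, p.1 ∈ Set.Icc a b)
    (h : ∀ η > 0, ∀ p ∈ Z, ∃ r > 0, ∀ q ∈ Z, p.1 ≤ q.1 → q.1 < p.1 + r →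
      |q.2 - p.2| ≤ η * (q.1 - p.1)) :
    volume (Prod.snd '' Z) = 0 := by
  have hbound : ∀ η > 0, volume (Prod.snd '' Z) ≤ ENNReal.ofReal (η * (b - a + 1)) := by
    intro η hη
    have hh : ∀ p, ∃ r, 0 < r ∧ (p ∈ Z → ∀ q ∈ Z, p.1 ≤ q.1 → q.1 < p.1 + r →
        |q.2 - p.2| ≤ η * (q.1 - p.1)) := by
      intro p
      by_cases hp : p ∈ Z
      · obtain ⟨r, hr, hr'⟩ := h η hη p hp
        exact ⟨r, hr, fun _ => hr'⟩
      · exact ⟨1, one_pos, fun h => absurd h hp⟩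
    choose r hr0 hr using hh
    -- The radius depends on the point. The subsets with radius above `1/(k+1)` increase to `Z`, and
    -- continuity from below needs no measurability.
    set Y : ℕ → Set (ℝ × ℝ) := fun k => {p ∈ Z | 1 / ((k : ℝ) + 1) < r p} with hY
    have hYmono : Monotone fun k => Prod.snd '' Y k := by
      intro k l hkl
      refine Set.image_mono fun p hp => ⟨hp.1, lt_of_le_of_lt ?_ hp.2⟩
      exact one_div_le_one_div_of_le (by positivity) (by gcongr)
    have hYU : Prod.snd '' Z = ⋃ k, Prod.snd '' Y k := by
      rw [← Set.image_iUnion]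
      congr 1
      ext p
      simp only [Set.mem_iUnion, hY, Set.mem_ofPred_eq]
      refine ⟨fun hp => ?_, fun ⟨k, hk⟩ => hk.1⟩
      obtain ⟨k, hk⟩ := exists_nat_one_div_lt (hr0 p)
      exact ⟨k, hp, hk⟩
    rw [hYU, hYmono.measure_iUnion]
    refine iSup_le fun k => ?_
    rcases (Y k).eq_empty_or_nonempty with h0 | ⟨p₀, hp₀⟩
    · simp [h0]
    have hab : 0 ≤ b - a := by linarith [(hZ p₀ hp₀.1).1, (hZ p₀ hp₀.1).2]
    set e : ℝ := 1 / ((k : ℝ) + 1) with he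
    have he0 : 0 < e := by positivity
    have he1 : e ≤ 1 := by
      rw [he, div_le_one (by positivity)]
      linarith [Nat.cast_nonneg (α := ℝ) k]
    -- `M` strips of width `e` cover `[a, b]`; each contributes diameter at most `η e`, and `M e ≤ b
    -- - a + 1` because `e ≤ 1`.
    set M := ⌊(b - a) / e⌋₊ + 1 with hM
    have hcover : Prod.snd '' Y k ⊆ ⋃ j ∈ Finset.range M, Prod.snd ''
        {p ∈ Y k | p.1 ∈ Set.Icc (a + j * e) (a + (j + 1) * e)} := by
      rintro _ ⟨p, hp, rfl⟩
      have hpI := hZ p hp.1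
      have hn : 0 ≤ (p.1 - a) / e := div_nonneg (by linarith [hpI.1]) he0.le
      have hf1 := Nat.floor_le hn
      have hf2 := Nat.lt_floor_add_one ((p.1 - a) / e)
      rw [le_div_iff₀ he0] at hf1
      rw [div_lt_iff₀ he0] at hf2
      simp only [Set.mem_iUnion, Finset.mem_range]
      refine ⟨⌊(p.1 - a) / e⌋₊, Nat.lt_succ_of_le (Nat.floor_mono ?_), p, ⟨hp, ?_, ?_⟩, rfl⟩
      · gcongr
        exact hpI.2
      · linarith
      · linarith
    have hpiece : ∀ j ∈ Finset.range M, volume (Prod.snd ''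
        {p ∈ Y k | p.1 ∈ Set.Icc (a + j * e) (a + (j + 1) * e)}) ≤ ENNReal.ofReal (η * e) := by
      intro j _
      refine (Real.volume_le_diam _).trans (Metric.ediam_le ?_)
      have hpair : ∀ p ∈ {p ∈ Y k | p.1 ∈ Set.Icc (a + j * e) (a + (j + 1) * e)},
          ∀ q ∈ {p ∈ Y k | p.1 ∈ Set.Icc (a + j * e) (a + (j + 1) * e)}, p.1 ≤ q.1 →
          |q.2 - p.2| ≤ η * e := by
        rintro p ⟨hp, hp1, hp2⟩ q ⟨hq, hq1, hq2⟩ hpq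
        have h1 : q.1 - p.1 ≤ e := by linarith
        refine (hr p hp.1 q hq.1 hpq (by linarith [hp.2])).trans ?_
        gcongr
      rintro _ ⟨p, hp, rfl⟩ _ ⟨q, hq, rfl⟩
      rw [edist_dist, Real.dist_eq]
      refine ENNReal.ofReal_le_ofReal ?_
      rcases le_total p.1 q.1 with hpq | hpq
      · rw [abs_sub_comm]
        exact hpair p hp q hq hpq
      · exact hpair q hq p hp hpq
    calc volume (Prod.snd '' Y k) ≤ _ := measure_mono hcover
      _ ≤ ∑ j ∈ Finset.range M, volume (Prod.snd ''
          {p ∈ Y k | p.1 ∈ Set.Icc (a + j * e) (a + (j + 1) * e)}) :=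
        measure_biUnion_finset_le _ _
      _ ≤ ∑ _j ∈ Finset.range M, ENNReal.ofReal (η * e) := Finset.sum_le_sum hpiece
      _ = ENNReal.ofReal (M * (η * e)) := by
        rw [Finset.sum_const, Finset.card_range, nsmul_eq_mul,
          ENNReal.ofReal_mul (p := (M : ℝ)) (by positivity), ENNReal.ofReal_natCast]
      _ ≤ ENNReal.ofReal (η * (b - a + 1)) := by
        refine ENNReal.ofReal_le_ofReal ?_
        have h1 := Nat.floor_le (div_nonneg hab he0.le)
        rw [le_div_iff₀ he0] at h1
        have h2 : (M : ℝ) * e ≤ b - a + 1 := by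
          rw [hM]
          push_cast
          linarith
        calc (M : ℝ) * (η * e) = η * (M * e) := by ring
          _ ≤ _ := mul_le_mul_of_nonneg_left h2 hη.le
  have hlim : Tendsto (fun η : ℝ => ENNReal.ofReal (η * (b - a + 1))) (𝓝[>] 0) (𝓝 0) := by
    have h1 : Continuous fun η : ℝ => ENNReal.ofReal (η * (b - a + 1)) :=
      ENNReal.continuous_ofReal.comp (continuous_id.mul continuous_const)
    have h2 := (h1.tendsto 0).mono_left (nhdsWithin_le_nhds (s := Set.Ioi 0))
    simpa using h2
  refine le_antisymm (ge_of_tendsto hlim ?_) zero_le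
  filter_upwards [self_mem_nhdsWithin] with η hη using hbound η hη

end NullSet

/-! ### Reduction to a finite dimensional form -/

section Bordered

open Filter Topology

variable {W H : Type*}
  [NormedAddCommGroup W] [InnerProductSpace ℝ W]
  [NormedAddCommGroup H] [InnerProductSpace ℝ H]

/-- The operator `(w, y) ↦ (S w + y, proj_N (ι w))` on `W ⊕ N`. -/
def bordered (ι : W →L[ℝ] H) (N : Submodule ℝ H) [N.HasOrthogonalProjection] (S : W →L[ℝ] H) :
    W × N →L[ℝ] H × N :=
  (S.coprod N.subtypeL).prod ((N.orthogonalProjectionOnto ∘L ι) ∘L ContinuousLinearMap.fst ℝ W N)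

lemma bordered_apply (ι : W →L[ℝ] H) (N : Submodule ℝ H) [N.HasOrthogonalProjection]
    (S : W →L[ℝ] H) (z : W × N) :
    bordered ι N S z = (S z.1 + z.2, N.orthogonalProjectionOnto (ι z.1)) := rfl

/-- The solution operator `x ↦ w` of `S w ∈ N`, `proj_N (ι w) = x`. -/
def reduce (ι : W →L[ℝ] H) (N : Submodule ℝ H) [N.HasOrthogonalProjection] (S : W →L[ℝ] H) :
    N →L[ℝ] W :=
  ContinuousLinearMap.fst ℝ W N ∘L (bordered ι N S).inverse ∘L ContinuousLinearMap.inr ℝ H N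

variable {ι : W →L[ℝ] H} {N : Submodule ℝ H} [N.HasOrthogonalProjection] {S S' : W →L[ℝ] H}

lemma proj_reduce (hS : (bordered ι N S).IsInvertible) (x : N) :
    N.orthogonalProjectionOnto (ι (reduce ι N S x)) = x :=
  congrArg Prod.snd (hS.self_apply_inverse (0, x))

lemma apply_reduce_mem (hS : (bordered ι N S).IsInvertible) (x : N) : S (reduce ι N S x) ∈ N := by
  have h1 : S (reduce ι N S x) + ((bordered ι N S).inverse (0, x)).2 = 0 :=
    congrArg Prod.fst (hS.self_apply_inverse (0, x))
  rw [eq_neg_of_add_eq_zero_left h1]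
  exact N.neg_mem (Subtype.mem _)

lemma reduce_proj (hS : (bordered ι N S).IsInvertible) {w : W} (hw : S w = 0) :
    reduce ι N S (N.orthogonalProjectionOnto (ι w)) = w := by
  have h1 := hS.inverse_apply_self (w, 0)
  rw [bordered_apply, hw, ZeroMemClass.coe_zero, add_zero] at h1
  exact congrArg Prod.fst h1

lemma inner_reduce_of_mem (hS : (bordered ι N S).IsInvertible) {y : H} (hy : y ∈ N) (x : N) :
    inner ℝ y (ι (reduce ι N S x)) = inner ℝ y (x : H) := by
  have h1 := Submodule.inner_orthogonalProjectionOnto_eq_of_mem_left (K := N) ⟨y, hy⟩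
    (ι (reduce ι N S x))
  rw [proj_reduce hS] at h1
  exact h1.symm

/-- The reduced form `(x, x') ↦ ⟨S w_x, x'⟩`. -/
def reducedForm (ι : W →L[ℝ] H) (N : Submodule ℝ H) [N.HasOrthogonalProjection]
    (S : W →L[ℝ] H) : LinearMap.BilinForm ℝ N :=
  LinearMap.mk₂ ℝ (fun x y => inner ℝ (S (reduce ι N S x)) (y : H))
    (by intros; simp [inner_add_left]) (by intros; simp [inner_smul_left])
    (by intros; simp [inner_add_right]) (by intros; simp [inner_smul_right])

/-- The form `(x, x') ↦ ⟨J w_x, w_x'⟩`. -/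
def derivForm (ι : W →L[ℝ] H) (N : Submodule ℝ H) [N.HasOrthogonalProjection]
    (S J : W →L[ℝ] H) : LinearMap.BilinForm ℝ N :=
  LinearMap.mk₂ ℝ (fun x y => inner ℝ (J (reduce ι N S x)) (ι (reduce ι N S y)))
    (by intros; simp [inner_add_left]) (by intros; simp [inner_smul_left])
    (by intros; simp [inner_add_right]) (by intros; simp [inner_smul_right])

lemma reducedForm_apply (x y : N) :
    reducedForm ι N S x y = inner ℝ (S (reduce ι N S x)) (y : H) := rfl

lemma derivForm_apply {J : W →L[ℝ] H} (x y : N) :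
    derivForm ι N S J x y = inner ℝ (J (reduce ι N S x)) (ι (reduce ι N S y)) := rfl

lemma isSymm_reducedForm (hS : (bordered ι N S).IsInvertible) (h : IsSA ι S) :
    (reducedForm ι N S).IsSymm := by
  refine ⟨fun x y => ?_⟩
  rw [reducedForm_apply, reducedForm_apply, ← inner_reduce_of_mem hS (apply_reduce_mem hS x) y,
    ← inner_reduce_of_mem hS (apply_reduce_mem hS y) x, h.symm, real_inner_comm]

/-- `S' w'_x` and `S w_y` lie in `N`, so in pairings with them `y` and `x` may be replaced by `ι
w_y` and `ι w'_x`; symmetry of `S` then moves it across. The identity is exact, and its first order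
part is `derivForm`. -/
lemma reducedForm_sub (hS : (bordered ι N S).IsInvertible) (hS' : (bordered ι N S').IsInvertible)
    (h : IsSA ι S) (x y : N) :
    reducedForm ι N S' x y - reducedForm ι N S x y =
      inner ℝ ((S' - S) (reduce ι N S' x)) (ι (reduce ι N S y)) := by
  rw [sub_apply, inner_sub_left, h.symm]
  congr 1
  · exact (inner_reduce_of_mem hS (apply_reduce_mem hS' x) y).symm
  · rw [(isSymm_reducedForm hS h).eq x y, real_inner_comm]
    exact (inner_reduce_of_mem hS' (apply_reduce_mem hS y) x).symm

/-- Since `S w_x` itself lies in `N`, it can be used as test vector. -/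
lemma mem_ker_reducedForm (hS : (bordered ι N S).IsInvertible) {x : N} :
    x ∈ LinearMap.ker (reducedForm ι N S) ↔ S (reduce ι N S x) = 0 := by
  constructor
  · intro hx
    have h1 := LinearMap.congr_fun (LinearMap.mem_ker.1 hx) ⟨_, apply_reduce_mem hS x⟩
    exact inner_self_eq_zero.1 h1
  · intro hx
    refine LinearMap.mem_ker.2 (LinearMap.ext fun y => ?_)
    rw [reducedForm_apply, hx, inner_zero_left]
    rfl

lemma norm_reduce_pos (hS : (bordered ι N S).IsInvertible) {x : N} (hx : x ≠ 0) :
    0 < inner ℝ (ι (reduce ι N S x)) (ι (reduce ι N S x)) := by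
  refine real_inner_self_pos.2 fun h0 => hx ?_
  rw [← proj_reduce hS x, h0, map_zero]

lemma continuous_bordered : Continuous (bordered ι N) := by
  have h1 : Continuous fun S : W →L[ℝ] H => S.coprod N.subtypeL := by
    have : (fun S : W →L[ℝ] H => S.coprod N.subtypeL) = fun S =>
        S ∘L ContinuousLinearMap.fst ℝ W N + N.subtypeL ∘L ContinuousLinearMap.snd ℝ W N := by
      ext S z <;> simp
    rw [this]
    fun_prop
  have h2 : bordered ι N = fun S : W →L[ℝ] H =>
      ContinuousLinearMap.inl ℝ H N ∘L (S.coprod N.subtypeL) +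
      ContinuousLinearMap.inr ℝ H N ∘L
        ((N.orthogonalProjectionOnto ∘L ι) ∘L ContinuousLinearMap.fst ℝ W N) := by
    funext S
    refine ContinuousLinearMap.ext fun z => ?_
    rw [bordered_apply]
    ext <;> simp
  rw [h2]
  fun_prop

variable [CompleteSpace W]

lemma continuousAt_reduce [CompleteSpace N] (hS : (bordered ι N S).IsInvertible) :
    ContinuousAt (reduce ι N) S := by
  obtain ⟨e, he⟩ := hS
  have h1 : ContinuousAt (ContinuousLinearMap.inverse : (W × N →L[ℝ] H × N) → _)
      (bordered ι N S) := by
    rw [← he]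
    exact (contDiffAt_map_inverse (n := 0) e).continuousAt
  have h2 : ContinuousAt (fun S => (bordered ι N S).inverse) S :=
    ContinuousAt.comp (g := ContinuousLinearMap.inverse) (f := bordered ι N) h1
      continuous_bordered.continuousAt
  exact continuousAt_const.clm_comp (h2.clm_comp continuousAt_const)

lemma eventually_isInvertible_bordered [CompleteSpace N] (hS : (bordered ι N S).IsInvertible) :
    ∀ᶠ S' in 𝓝 S, (bordered ι N S').IsInvertible := by
  obtain ⟨e, he⟩ := hS
  have h1 := ContinuousLinearEquiv.nhds e
  rw [he] at h1
  exact continuous_bordered.continuousAt h1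

/-- For `N = ι (ker S)` one has the orthogonal decomposition `H = im S ⊕ N`, and the second
component of the operator fixes the part of `w` in `ker S`. -/
lemma IsSA.isInvertible_bordered [CompleteSpace H] (hι : Function.Injective ι) (hc : IsCompactOperator ι)
    (h : IsSA ι S) [(kerH ι S).HasOrthogonalProjection] [CompleteSpace (kerH ι S)] :
    (bordered ι (kerH ι S) S).IsInvertible := by
  have horth : ∀ w, ∀ y ∈ kerH ι S, inner ℝ (S w) y = 0 := by
    rintro w _ ⟨x, hx, rfl⟩
    have hx0 : S x = 0 := hx
    exact (h.symm w x).trans (by rw [hx0, inner_zero_right])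
  have hbij : Function.Bijective (bordered ι (kerH ι S) S) := by
    constructor
    · rw [injective_iff_map_eq_zero]
      rintro ⟨w, y⟩ h0
      have h1 : S w + y = 0 := congrArg Prod.fst h0
      have h2 : (kerH ι S).orthogonalProjectionOnto (ι w) = 0 := congrArg Prod.snd h0
      have hy : (y : H) = 0 := by
        rw [← inner_self_eq_zero (𝕜 := ℝ)]
        have h3 := horth w y y.2
        rwa [eq_neg_of_add_eq_zero_left h1, inner_neg_left, neg_eq_zero] at h3
      rw [hy, add_zero] at h1
      have hw : ι w ∈ kerH ι S := ⟨w, h1, rfl⟩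
      have h3 := congrArg Subtype.val
        (Submodule.orthogonalProjectionOnto_mem_subspace_eq_self (K := kerH ι S) ⟨ι w, hw⟩)
      rw [h2] at h3
      exact Prod.ext (hι (h3.symm.trans (map_zero ι).symm)) (Subtype.ext hy)
    · rintro ⟨y, x⟩
      obtain ⟨w, z, hz, hwz⟩ := h.exists_add_eq hι hc y
      obtain ⟨v, hv, hvx⟩ := (x - (kerH ι S).orthogonalProjectionOnto (ι w)).2
      refine ⟨(w + v, ⟨z, hz⟩), ?_⟩
      have hv0 : S v = 0 := hv
      have hvx' : ι v = (x - (kerH ι S).orthogonalProjectionOnto (ι w) : kerH ι S) := hvx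
      rw [bordered_apply]
      refine Prod.ext ?_ ?_
      · simpa [hv0] using hwz
      · change (kerH ι S).orthogonalProjectionOnto (ι (w + v)) = x
        rw [map_add, map_add, hvx', Submodule.orthogonalProjectionOnto_mem_subspace_eq_self]
        abel
  exact ⟨ContinuousLinearEquiv.ofBijective _ (LinearMap.ker_eq_bot.2 hbij.1)
    (LinearMap.range_eq_top.2 hbij.2), rfl⟩

end Bordered

/-! ### Almost every shift is transversal -/

section Transversality

open Filter Topology MeasureTheory

lemma tendsto_clm_apply_clm_apply {X E F G : Type*} [NormedAddCommGroup E] [NormedSpace ℝ E]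
    [NormedAddCommGroup F] [NormedSpace ℝ F] [NormedAddCommGroup G] [NormedSpace ℝ G]
    {l : Filter X} {A : X → F →L[ℝ] G} {u : X → E →L[ℝ] F} {A₀ : F →L[ℝ] G} {u₀ : E →L[ℝ] F}
    (hA : Tendsto A l (𝓝 A₀)) (hu : Tendsto u l (𝓝 u₀)) {x : E} :
    Tendsto (fun z : X × E => A z.1 (u z.1 z.2)) (l ×ˢ 𝓝 x) (𝓝 (A₀ (u₀ x))) := by
  have h1 : Tendsto (fun z : X × E => u z.1 z.2) (l ×ˢ 𝓝 x) (𝓝 (u₀ x)) :=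
    (isBoundedBilinearMap_apply.continuous.tendsto (u₀, x)).comp
      ((hu.comp tendsto_fst).prodMk_nhds tendsto_snd)
  exact (isBoundedBilinearMap_apply.continuous.tendsto (A₀, u₀ x)).comp
    ((hA.comp tendsto_fst).prodMk_nhds h1)

variable {W H : Type*}
  [NormedAddCommGroup W] [InnerProductSpace ℝ W]
  [NormedAddCommGroup H] [InnerProductSpace ℝ H]
  {ι : W →L[ℝ] H} {N : Submodule ℝ H}

/-- The inner product is at least `(1 - 1/4 - 1/4 - 1/16) ‖x‖²`. -/
lemma inner_pos_of_norm_sub_lt {A B : N →L[ℝ] H} (hA : ‖A - N.subtypeL‖ < 1 / 4)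
    (hB : ‖B - N.subtypeL‖ < 1 / 4) {x : N} (hx : x ≠ 0) : 0 < inner ℝ (A x) (B x) := by
  have hx0 : 0 < ‖x‖ := norm_pos_iff.2 hx
  have h1 : ‖(A - N.subtypeL) x‖ ≤ 1 / 4 * ‖x‖ := (A - N.subtypeL).le_of_opNorm_le hA.le x
  have h2 : ‖(B - N.subtypeL) x‖ ≤ 1 / 4 * ‖x‖ := (B - N.subtypeL).le_of_opNorm_le hB.le x
  set u := (A - N.subtypeL) x with hu
  set v := (B - N.subtypeL) x with hv
  have hAx : A x = x + u := by simp [hu]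
  have hBx : B x = x + v := by simp [hv]
  have hxx : inner ℝ (x : H) (x : H) = ‖x‖ ^ 2 := real_inner_self_eq_norm_sq _
  have hxn : ‖(x : H)‖ = ‖x‖ := rfl
  have h3 := abs_le.1 (abs_real_inner_le_norm (x : H) v)
  have h4 := abs_le.1 (abs_real_inner_le_norm u (x : H))
  have h5 := abs_le.1 (abs_real_inner_le_norm u v)
  rw [hAx, hBx, inner_add_left, inner_add_right, inner_add_right, hxx]
  rw [hxn] at h3 h4
  nlinarith [norm_nonneg u, norm_nonneg v, mul_le_mul_of_nonneg_left h2 hx0.le,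
    mul_le_mul_of_nonneg_right h1 hx0.le, mul_le_mul h1 h2 (norm_nonneg v) (by positivity)]

variable [FiniteDimensional ℝ N]

/-- At `S₀` the map `x ↦ ι w_x` is the inclusion of the kernel; the rest is continuity. -/
lemma IsSA.exists_isOpen [CompleteSpace W] [CompleteSpace H] (hι : Function.Injective ι)
    (hc : IsCompactOperator ι) {S₀ : W →L[ℝ] H} (h : IsSA ι S₀)
    [FiniteDimensional ℝ (kerH ι S₀)] :
    ∃ O : Set (W →L[ℝ] H), IsOpen O ∧ S₀ ∈ O ∧ ∀ S ∈ O,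
      (bordered ι (kerH ι S₀) S).IsInvertible ∧
      ‖ι ∘L reduce ι (kerH ι S₀) S - (kerH ι S₀).subtypeL‖ < 1 / 4 := by
  have hinv := h.isInvertible_bordered hι hc
  have h0 : ι ∘L reduce ι (kerH ι S₀) S₀ = (kerH ι S₀).subtypeL := by
    refine ContinuousLinearMap.ext ?_
    rintro ⟨_, w, hw, rfl⟩
    have h1 := reduce_proj hinv (w := w) hw
    have h2 : (kerH ι S₀).orthogonalProjectionOnto (ι w) = ⟨ι w, w, hw, rfl⟩ :=
      Submodule.orthogonalProjectionOnto_mem_subspace_eq_self (K := kerH ι S₀) ⟨ι w, w, hw, rfl⟩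
    rw [h2] at h1
    exact congrArg ι h1
  have hcont : ContinuousAt (fun S => ι ∘L reduce ι (kerH ι S₀) S - (kerH ι S₀).subtypeL) S₀ :=
    (continuousAt_const.clm_comp (continuousAt_reduce hinv)).sub continuousAt_const
  have hev : ∀ᶠ S in 𝓝 S₀, ‖ι ∘L reduce ι (kerH ι S₀) S - (kerH ι S₀).subtypeL‖ < 1 / 4 := by
    refine (ContinuousAt.norm (E := kerH ι S₀ →L[ℝ] H) hcont).eventually (gt_mem_nhds ?_)
    beta_reduce
    rw [h0, sub_self, ContinuousLinearMap.opNorm_zero]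
    norm_num
  obtain ⟨O, hO, hOo, hOm⟩ := eventually_nhds_iff.1 ((eventually_isInvertible_bordered hinv).and hev)
  exact ⟨O, hOo, hOm, hO⟩

/-- The difference of the forms is `c ⟨ι w'_x, ι w_x⟩`, and both vectors are close to `x`. This
strict monotonicity in `λ` drives the comparison of bad points. -/
lemma reducedForm_lt {S : W →L[ℝ] H} (h : IsSA ι S) {c : ℝ} (hc : 0 < c)
    (hS : (bordered ι N S).IsInvertible) (hS' : (bordered ι N (S + c • ι)).IsInvertible)
    (hn : ‖ι ∘L reduce ι N S - N.subtypeL‖ < 1 / 4)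
    (hn' : ‖ι ∘L reduce ι N (S + c • ι) - N.subtypeL‖ < 1 / 4) {x : N} (hx : x ≠ 0) :
    reducedForm ι N S x x < reducedForm ι N (S + c • ι) x x := by
  rw [← sub_pos, reducedForm_sub hS hS' h, add_sub_cancel_left, smul_apply, inner_smul_left]
  exact mul_pos hc (inner_pos_of_norm_sub_lt hn' hn hx)

variable {a b : ℝ} {T : ℝ → W →L[ℝ] H}

/-- One-sided perturbation of the reduced form along the line `λ + c h`. -/
lemma exists_forall_mul_reducedForm_nonpos [CompleteSpace W] {O : Set (W →L[ℝ] H)} (hO : IsOpen O)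
    (hinv : ∀ S ∈ O, (bordered ι N S).IsInvertible) {t c₀ : ℝ} (hSA : IsSA ι (T t + c₀ • ι))
    (hS : T t + c₀ • ι ∈ O) {J : W →L[ℝ] H} (hJ : HasDerivWithinAt T J (Set.Icc a b) t)
    {σ c : ℝ} (hσ : σ * c < 0) {P : Submodule ℝ N}
    (hP : ∀ x ∈ P, σ * reducedForm ι N (T t + c₀ • ι) x x ≤ 0 ∧
      (reducedForm ι N (T t + c₀ • ι) x x = 0 → σ * derivForm ι N (T t + c₀ • ι) J x x ≤ 0))
    (hσ0 : σ ≠ 0) :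
    ∃ r > 0, ∀ h, 0 ≤ h → h < r → t + h ∈ Set.Icc a b →
      T (t + h) + (c₀ + c * h) • ι ∈ O ∧
      ∀ x ∈ P, σ * reducedForm ι N (T (t + h) + (c₀ + c * h) • ι) x x ≤ 0 := by
  set S := T t + c₀ • ι with hSdef
  -- Admissible positive increments; the set is empty for `t = b`, where all limits are vacuous.
  set s : Set ℝ := {h | 0 < h ∧ t + h ∈ Set.Icc a b} with hs
  set Sh : ℝ → W →L[ℝ] H := fun h => T (t + h) + (c₀ + c * h) • ι with hSh
  -- The difference quotient along the line; it tends to `J + c ι`. At zeros of the form on `P` the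
  -- term `σ c ‖ι w_x‖² < 0` makes the limiting perturbation strictly negative.
  set A : ℝ → W →L[ℝ] H := fun h => h⁻¹ • (Sh h - S) with hA
  have hl : 𝓝[s] (0 : ℝ) ≤ 𝓝[>] 0 := nhdsWithin_mono _ fun h hh => hh.1
  have hShA : ∀ h, h ≠ 0 → Sh h = S + h • A h := fun h hh => by
    rw [hA, smul_smul, mul_inv_cancel₀ hh, one_smul, add_sub_cancel]
  have hAlim : Tendsto A (𝓝[s] 0) (𝓝 (J + c • ι)) := by
    have hmap : Tendsto (fun h : ℝ => t + h) (𝓝[s] 0) (𝓝[Set.Icc a b \ {t}] t) := by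
      refine tendsto_nhdsWithin_iff.2 ⟨?_, ?_⟩
      · have : Continuous fun h : ℝ => t + h := by fun_prop
        exact ((this.tendsto 0).mono_left nhdsWithin_le_nhds).trans_eq (by simp)
      · filter_upwards [self_mem_nhdsWithin] with h hh
        exact ⟨hh.2, fun h0 => hh.1.ne' (by simpa using h0)⟩
    have h1 := ((hasDerivWithinAt_iff_tendsto_slope.1 hJ).comp hmap).add_const (c • ι)
    refine h1.congr' ?_
    filter_upwards [self_mem_nhdsWithin] with h hh
    have hh0 : h ≠ 0 := hh.1.ne'
    have h2 : Sh h - S = (T (t + h) - T t) + h • (c • ι) := by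
      simp only [hSh, hSdef, smul_smul, mul_comm h c, add_smul]
      abel
    rw [hA]
    simp only [Function.comp_apply, slope, vsub_eq_sub, add_sub_cancel_left]
    rw [h2, smul_add, inv_smul_smul₀ hh0]
  have hid : Tendsto (fun h : ℝ => h) (𝓝[s] 0) (𝓝 0) :=
    tendsto_id.mono_right nhdsWithin_le_nhds
  have hne : ∀ᶠ h in 𝓝[s] (0 : ℝ), h ≠ 0 := by
    filter_upwards [self_mem_nhdsWithin] with h hh using hh.1.ne'
  have hSlim : Tendsto Sh (𝓝[s] 0) (𝓝 S) := by
    have h1 : Tendsto (fun h => S + h • A h) (𝓝[s] 0) (𝓝 (S + (0 : ℝ) • (J + c • ι))) :=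
      tendsto_const_nhds.add (hid.smul hAlim)
    rw [zero_smul, add_zero] at h1
    refine h1.congr' ?_
    filter_upwards [hne] with h hh using (hShA h hh).symm
  have hu : Tendsto (fun h => reduce ι N (Sh h)) (𝓝[s] 0) (𝓝 (reduce ι N S)) :=
    (continuousAt_reduce (hinv S hS)).tendsto.comp hSlim
  have hAu := fun x => tendsto_clm_apply_clm_apply hAlim hu (x := x)
  have hev := eventually_forall_add_mul_neg (P := P)
    (m := fun x => σ * reducedForm ι N S x x) (l := 𝓝[s] 0)
    (R := fun h x => σ * inner ℝ (A h (reduce ι N (Sh h) x)) (ι (reduce ι N S x)))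
    (R₀ := fun x => σ * inner ℝ ((J + c • ι) (reduce ι N S x)) (ι (reduce ι N S x)))
    (by simp only [reducedForm_apply]; fun_prop) hl
    (by
      intro x
      refine tendsto_const_nhds.mul (Tendsto.inner ?_ ?_)
      · exact hAu x
      · have : Continuous fun x => ι (reduce ι N S x) := by fun_prop
        exact (this.tendsto x).comp tendsto_snd)
    (fun x hx => (hP x hx).1)
    (by
      intro x hx hx0 h0
      have h1 := (hP x hx).2 ((mul_eq_zero.1 h0).resolve_left hσ0)
      have h2 := norm_reduce_pos (hinv S hS) hx0
      rw [derivForm_apply] at h1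
      simp only [add_apply, smul_apply, inner_add_left,
        inner_smul_left, conj_trivial]
      nlinarith)
  have hev' : ∀ᶠ h in 𝓝[s] (0 : ℝ), Sh h ∈ O ∧
      ∀ x ∈ P, σ * reducedForm ι N (Sh h) x x ≤ 0 := by
    filter_upwards [hev, hne, hSlim.eventually (hO.mem_nhds hS)] with h h1 h2 h3
    refine ⟨h3, fun x hx => ?_⟩
    have hform : ∀ y, reducedForm ι N (Sh h) y y = reducedForm ι N S y y +
        h * inner ℝ (A h (reduce ι N (Sh h) y)) (ι (reduce ι N S y)) := by
      intro y
      have h4 := reducedForm_sub (hinv S hS) (hinv _ h3) hSA y y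
      have h5 : Sh h - S = h • A h := by rw [hShA h h2, add_sub_cancel_left]
      rw [h5, smul_apply, inner_smul_left] at h4
      rw [← sub_eq_iff_eq_add']
      exact h4
    rcases eq_or_ne x 0 with rfl | hx0
    · simp
    · have hn : 0 < ‖x‖ := norm_pos_iff.2 hx0
      -- The estimate on the unit sphere extends to `P` by homogeneity.
      have h4 := h1 (‖x‖⁻¹ • x) (P.smul_mem _ hx) (by
        rw [norm_smul, norm_inv, norm_norm, inv_mul_cancel₀ hn.ne'])
      have h5 : σ * reducedForm ι N (Sh h) (‖x‖⁻¹ • x) (‖x‖⁻¹ • x) < 0 := by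
        rw [hform]
        refine lt_of_eq_of_lt ?_ h4
        ring
      rw [map_smul, map_smul, LinearMap.smul_apply, smul_eq_mul, smul_eq_mul] at h5
      have h6 : σ * reducedForm ι N (Sh h) x x =
          ‖x‖ * ‖x‖ * (σ * (‖x‖⁻¹ * (‖x‖⁻¹ * reducedForm ι N (Sh h) x x))) := by
        field_simp
      rw [h6]
      exact (mul_neg_of_pos_of_neg (mul_pos hn hn) h5).le
  obtain ⟨r, hr, hsub⟩ := Metric.mem_nhdsWithin_iff.1 hev'
  refine ⟨r, hr, fun h h0 hhr hmem => ?_⟩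
  rcases eq_or_lt_of_le h0 with rfl | hpos
  · rw [add_zero, mul_zero, add_zero]
    exact ⟨hS, fun x hx => (hP x hx).1⟩
  · refine hsub ⟨?_, hpos, hmem⟩
    rwa [Metric.mem_ball, dist_zero_right, Real.norm_of_nonneg h0]

/-- The semidefinite subspaces at a degenerate crossing. -/
def HasSemidefiniteSubspaces (ι : W →L[ℝ] H) (N : Submodule ℝ H) [FiniteDimensional ℝ N]
    (S J : W →L[ℝ] H) (d : ℕ) : Prop :=
  ∃ P Q : Submodule ℝ N, finrank ℝ P = d ∧
    (∀ x ∈ P, reducedForm ι N S x x ≤ 0 ∧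
      (reducedForm ι N S x x = 0 → derivForm ι N S J x x ≤ 0)) ∧
    (∀ x ∈ Q, 0 ≤ reducedForm ι N S x x ∧
      (reducedForm ι N S x x = 0 → 0 ≤ derivForm ι N S J x x)) ∧
    finrank ℝ N + 1 ≤ finrank ℝ P + finrank ℝ Q

/-- The kernel of the reduced form is `ker S`, and there `derivForm` is the crossing form;
degeneracy of the crossing is degeneracy of the pair. -/
lemma exists_hasSemidefiniteSubspaces (hab : a < b) (hι : Function.Injective ι)
    (hsa : ∀ t ∈ Set.Icc a b, IsSA ι (T t)) {t c : ℝ} (ht : t ∈ Set.Icc a b)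
    (hT : DifferentiableWithinAt ℝ T (Set.Icc a b) t) (hfd : FiniteDimensional ℝ (T t + c • ι).ker)
    (hinv : (bordered ι N (T t + c • ι)).IsInvertible)
    (hbad : ¬ Function.Bijective (crossingOp ι hι a b (shift ι T c) t)) :
    ∃ d, HasSemidefiniteSubspaces ι N (T t + c • ι) (derivWithin T (Set.Icc a b) t) d := by
  rw [@bijective_crossingOp_iff _ _ _ _ _ _ ι a b (shift ι T c) hι t hfd] at hbad
  push Not at hbad
  obtain ⟨w, hw, hwy, hw0⟩ := hbad
  rw [derivWithin_shift] at hwy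
  set S := T t + c • ι with hS
  have hwS : S w = 0 := hw
  have hred := reduce_proj hinv hwS
  obtain ⟨P, Q, hP, hQ, hdim⟩ := exists_semidefinite_subspaces_of_pair
    (isSymm_reducedForm hinv ((hsa t ht).add_smul c))
    (q := derivForm ι N S (derivWithin T (Set.Icc a b) t))
    ⟨fun x y => by
      rw [derivForm_apply, derivForm_apply, inner_deriv_symm hab hsa ht hT.hasDerivWithinAt,
        real_inner_comm]⟩
    ⟨N.orthogonalProjectionOnto (ι w), fun h0 => hw0 (by rw [← hred, h0, map_zero]),
      (mem_ker_reducedForm hinv).2 (by rw [hred, hwS]),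
      fun y hy => by
        rw [derivForm_apply, hred]
        exact hwy _ ((mem_ker_reducedForm hinv).1 hy)⟩
  exact ⟨_, P, Q, rfl, hP, hQ, hdim⟩

/-- Let `(t, c₀)` and `(s, μ)` be bad points with `s ≥ t` close to `t`. If `μ < c₀ - η (s - t)`, the
form at `(s, c₀ - η (s - t))` is nonpositive on `P`, while at `(s, μ)` it is nonnegative on `Q'`.
Fixing `d = dim P = dim P'` makes `P` and `Q'` intersect, against strict monotonicity in `λ`. The
upper bound uses `P'` and `Q` in the same way. -/
lemma volume_image_snd_hasSemidefiniteSubspaces [CompleteSpace W] {O : Set (W →L[ℝ] H)}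
    (hO : IsOpen O)
    (hnear : ∀ S ∈ O, (bordered ι N S).IsInvertible ∧ ‖ι ∘L reduce ι N S - N.subtypeL‖ < 1 / 4)
    (hsa : ∀ t ∈ Set.Icc a b, IsSA ι (T t)) (hT : DifferentiableOn ℝ T (Set.Icc a b)) (d : ℕ) :
    volume (Prod.snd '' {p : ℝ × ℝ | p.1 ∈ Set.Icc a b ∧ T p.1 + p.2 • ι ∈ O ∧
      HasSemidefiniteSubspaces ι N (T p.1 + p.2 • ι) (derivWithin T (Set.Icc a b) p.1) d}) = 0 := by
  refine volume_image_snd_eq_zero (a := a) (b := b) (fun p hp => hp.1) ?_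
  rintro η hη ⟨t, c₀⟩ ⟨ht, hSO, P, Q, hPd, hP, hQ, hdim⟩
  dsimp only at ht hSO hP hQ
  have hSA := (hsa t ht).add_smul c₀
  have hJ := (hT t ht).hasDerivWithinAt
  obtain ⟨r₁, hr₁, h₁⟩ := exists_forall_mul_reducedForm_nonpos hO (fun S hS => (hnear S hS).1) hSA
    hSO hJ (σ := 1) (c := -η) (by linarith) (P := P)
    (fun x hx => by simpa only [one_mul] using hP x hx) one_ne_zero
  obtain ⟨r₂, hr₂, h₂⟩ := exists_forall_mul_reducedForm_nonpos hO (fun S hS => (hnear S hS).1) hSA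
    hSO hJ (σ := -1) (c := η) (by linarith) (P := Q)
    (fun x hx => by simpa only [neg_one_mul, neg_nonpos] using hQ x hx) (by norm_num)
  refine ⟨min r₁ r₂, lt_min hr₁ hr₂, ?_⟩
  rintro ⟨s, μ⟩ ⟨hs, hSO', P', Q', hPd', hP', hQ', hdim'⟩ hts hsr
  dsimp only at hs hSO' hP' hQ' hts hsr ⊢
  have hh0 : 0 ≤ s - t := sub_nonneg.2 hts
  have hadd : t + (s - t) = s := by ring
  obtain ⟨hO₁, hf₁⟩ := h₁ (s - t) hh0 (by linarith [min_le_left r₁ r₂]) (by rwa [hadd])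
  obtain ⟨hO₂, hf₂⟩ := h₂ (s - t) hh0 (by linarith [min_le_right r₁ r₂]) (by rwa [hadd])
  rw [hadd] at hO₁ hf₁ hO₂ hf₂
  rw [abs_le]
  constructor
  · by_contra! hlt
    obtain ⟨x, hx0, hxP, hxQ⟩ := exists_ne_zero_mem_of_finrank_lt (P := P) (Q := Q') (by omega)
    have hcpos : 0 < c₀ + -η * (s - t) - μ := by linarith
    have heq : T s + (c₀ + -η * (s - t)) • ι =
        (T s + μ • ι) + (c₀ + -η * (s - t) - μ) • ι := by
      rw [add_assoc, ← add_smul, add_sub_cancel]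
    have h3 := hf₁ x hxP
    rw [one_mul] at h3
    rw [heq] at hO₁ h3
    have h4 := reducedForm_lt ((hsa s hs).add_smul μ) hcpos (hnear _ hSO').1 (hnear _ hO₁).1
      (hnear _ hSO').2 (hnear _ hO₁).2 hx0
    linarith [(hQ' x hxQ).1]
  · by_contra! hlt
    obtain ⟨x, hx0, hxP, hxQ⟩ := exists_ne_zero_mem_of_finrank_lt (P := P') (Q := Q) (by omega)
    have hcpos : 0 < μ - (c₀ + η * (s - t)) := by linarith
    have heq : T s + μ • ι =
        (T s + (c₀ + η * (s - t)) • ι) + (μ - (c₀ + η * (s - t))) • ι := by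
      rw [add_assoc, ← add_smul, add_sub_cancel]
    have h3 := hf₂ x hxQ
    have h5 := (hP' x hxP).1
    rw [heq] at hSO' h5
    have h4 := reducedForm_lt ((hsa s hs).add_smul (c₀ + η * (s - t))) hcpos (hnear _ hO₂).1
      (hnear _ hSO').1 (hnear _ hO₂).2 (hnear _ hSO').2 hx0
    linarith

variable [CompleteSpace W] [CompleteSpace H]

theorem volume_not_isTransversal (hab : a < b) (hι : Function.Injective ι)
    (hc : IsCompactOperator ι) (hsa : ∀ t ∈ Set.Icc a b, IsSA ι (T t))
    (hT : DifferentiableOn ℝ T (Set.Icc a b)) :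
    volume {c | ¬ IsTransversal ι hι a b (shift ι T c)} = 0 := by
  set Z : Set (ℝ × ℝ) := {p | p.1 ∈ Set.Icc a b ∧
    ¬ Function.Bijective (crossingOp ι hι a b (shift ι T p.2) p.1)} with hZ
  have himg : {c | ¬ IsTransversal ι hι a b (shift ι T c)} = Prod.snd '' Z := by
    ext c
    simp only [IsTransversal, Set.mem_ofPred_eq, Set.mem_image, Prod.exists, exists_eq_right, hZ]
    push Not
    rfl
  rw [himg]
  -- Pulling Lebesgue outer measure back along the projection lets nullity of the image be checked
  -- locally in the plane.
  have hnull := measure_null_of_locally_null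
    (μ := OuterMeasure.comap (Prod.snd : ℝ × ℝ → ℝ) (volume : Measure ℝ).toOuterMeasure) Z ?_
  · simpa using hnull
  rintro ⟨t₀, c₀⟩ ⟨ht₀, -⟩
  dsimp only at ht₀
  have h₀ := (hsa t₀ ht₀).add_smul c₀
  have hfd := h₀.finiteDimensional_ker hι hc
  obtain ⟨O, hO, hOm, hnear⟩ := h₀.exists_isOpen hι hc
  refine ⟨Z ∩ {p | T p.1 + p.2 • ι ∈ O}, ?_, ?_⟩
  · have hcont : ContinuousWithinAt (fun p : ℝ × ℝ => T p.1 + p.2 • ι) Z (t₀, c₀) := by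
      refine ContinuousWithinAt.add ?_ ?_
      · exact ContinuousWithinAt.comp (t := Set.Icc a b) (hT t₀ ht₀).continuousWithinAt
          continuous_fst.continuousWithinAt fun p hp => hp.1
      · exact (continuous_snd.smul continuous_const).continuousWithinAt
    exact inter_mem self_mem_nhdsWithin (hcont (hO.mem_nhds hOm))
  · rw [OuterMeasure.comap_apply]
    have hsub : Prod.snd '' (Z ∩ {p | T p.1 + p.2 • ι ∈ O}) ⊆
        ⋃ d : ℕ, Prod.snd '' {p : ℝ × ℝ | p.1 ∈ Set.Icc a b ∧ T p.1 + p.2 • ι ∈ O ∧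
          HasSemidefiniteSubspaces ι (kerH ι (T t₀ + c₀ • ι)) (T p.1 + p.2 • ι)
            (derivWithin T (Set.Icc a b) p.1) d} := by
      rintro _ ⟨p, ⟨⟨hp, hbad⟩, hpO⟩, rfl⟩
      obtain ⟨d, hd⟩ := exists_hasSemidefiniteSubspaces hab hι hsa hp (hT _ hp)
        (((hsa _ hp).add_smul p.2).finiteDimensional_ker hι hc) (hnear _ hpO).1 hbad
      exact Set.mem_iUnion.2 ⟨d, p, ⟨hp, hpO, hd⟩, rfl⟩
    exact measure_mono_null hsub (measure_iUnion_null fun d =>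
      volume_image_snd_hasSemidefiniteSubspaces hO hnear hsa hT d)

/-- There are arbitrarily small transversal shifts. -/
theorem exists_isTransversal_shift (hab : a < b) (hι : Function.Injective ι)
    (hc : IsCompactOperator ι) (hsa : ∀ t ∈ Set.Icc a b, IsSA ι (T t))
    (hT : DifferentiableOn ℝ T (Set.Icc a b)) {δ : ℝ} (hδ : 0 < δ) :
    ∃ ε ∈ Set.Ioc 0 δ, IsTransversal ι hι a b (shift ι T ε) := by
  by_contra! hcon
  have h1 : volume (Set.Ioc 0 δ) = 0 :=
    measure_mono_null (fun c hcc => hcon c hcc) (volume_not_isTransversal hab hι hc hsa hT)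
  rw [Real.volume_Ioc, sub_zero, ENNReal.ofReal_eq_zero] at h1
  linarith

end Transversality

end OTSF

end

/-! ### The main theorem. -/

theorem mainTheorem11 {W H : Type*}
    [NormedAddCommGroup W] [InnerProductSpace ℝ W] [CompleteSpace W]
    [NormedAddCommGroup H] [InnerProductSpace ℝ H] [CompleteSpace H]
    [TopologicalSpace.SeparableSpace H]
    (ι : W →L[ℝ] H) (hι : Function.Injective ι) (hdense : DenseRange ι)
    (hcompact : IsCompactOperator ι)
    (a b : ℝ) (hab : a < b) (T : ℝ → W →L[ℝ] H)
    (hT : ContDiffOn ℝ 1 T (Set.Icc a b))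
    (hsa : ∀ t ∈ Set.Icc a b, T t ∈ OTSF.selfAdjointOps ι hι) :
    (∃ s : ℝ, OTSF.IsOrientationTransport ι a b hab T s) ∧
    (∃ n : ℤ, OTSF.IsSpectralFlow ι hι a b T n) ∧
    ∀ (s : ℝ) (n : ℤ), OTSF.IsOrientationTransport ι a b hab T s →
      OTSF.IsSpectralFlow ι hι a b T n → s = (-1 : ℝ) ^ n := by
  have hsa' : ∀ t ∈ Set.Icc a b, OTSF.IsSA ι (T t) := fun t ht => OTSF.IsSA.of_mem (hsa t ht)
  have hTc : ContinuousOn T (Set.Icc a b) := hT.continuousOn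
  have hTd : DifferentiableOn ℝ T (Set.Icc a b) := hT.differentiableOn one_ne_zero
  have ha : a ∈ Set.Icc a b := Set.left_mem_Icc.2 hab.le
  have hb : b ∈ Set.Icc a b := Set.right_mem_Icc.2 hab.le
  refine ⟨?_, ?_, ?_⟩
  · obtain ⟨φ, hφ⟩ := OTSF.exists_isDetTrivialization hι hcompact hab.le hTc hsa'
    obtain ⟨x, hx⟩ := ((hsa' a ha).Psi_bijective hι hcompact).2 1
    exact ⟨_, φ, hφ, x, hx, rfl⟩
  · obtain ⟨δ₁, hδ₁, h₁⟩ := OTSF.exists_pos_bijective_add_smul hab.le hι hcompact hTc hsa' ha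
    obtain ⟨δ₂, hδ₂, h₂⟩ := OTSF.exists_pos_bijective_add_smul hab.le hι hcompact hTc hsa' hb
    have hδ : 0 < min δ₁ δ₂ := lt_min hδ₁ hδ₂
    obtain ⟨ε, hε, htr⟩ := OTSF.exists_isTransversal_shift hab hι hcompact hsa' hTd hδ
    exact ⟨_, min δ₁ δ₂, hδ, fun c hc =>
      ⟨h₁ c ⟨hc.1, hc.2.trans (min_le_left _ _)⟩, h₂ c ⟨hc.1, hc.2.trans (min_le_right _ _)⟩⟩,
      ε, hε, htr, rfl⟩
  · rintro s n hs ⟨δ, -, hbij, ε, hε, htr, rfl⟩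
    -- The rectangle reaches up to the very `ε` used for the spectral flow, so that both invariants
    -- become the sign of `D(a, ε) D(b, ε)`.
    obtain ⟨F⟩ := OTSF.exists_framedStabilizer hι hcompact hab.le hε.1.le hTc hsa'
    have hbij' : ∀ c ∈ Set.Ioc 0 ε, Function.Bijective (T a + c • ι) ∧
        Function.Bijective (T b + c • ι) := fun c hc => hbij c ⟨hc.1, hc.2.trans hε.2⟩
    have hε' : ε ∈ Set.Ioc 0 ε := ⟨hε.1, le_rfl⟩
    rw [hs.eq_sign F hε.1 hι hcompact hsa' (fun c hc => (hbij' c hc).1) fun c hc => (hbij' c hc).2]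
    exact F.sign_eq_neg_one_zpow hε.1.le hab hι hcompact hsa' hTd
      ((((hsa' a ha).add_smul ε).bijective_iff hι hcompact).1 (hbij' ε hε').1)
      ((((hsa' b hb).add_smul ε).bijective_iff hι hcompact).1 (hbij' ε hε').2) htr
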